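/- For $n=0,1,2,\dots$ let $$R_n(t)=(-1)^{n+1}\Bigl(t+\frac n2\Bigr)\frac{\bigl((t-1)\cdots(t-n)\cdot(t+n+1)\cdots(t+2n)\bigr)^2}{n!\,\bigl(t(t+1)\cdots(t+n)\bigr)^3},$$ with the partial-fraction decomposition $$R_n(t)=\sum_{k=0}^n\Bigl(\frac{A_k}{(t+k)^3}+\frac{A_k'}{(t+k)^2}+\frac{A_k''}{t+k}\Bigr)+B(t),\qquad A_k,A_k',A_k''\in\mathbb Q,\quad B\in\mathbb Q[t],$$ where $A_k=A_{n,k}$, $A_k'=A_{n,k}'$, $A_k''=A_{n,k}''$ and $B=B_n$ depend on $n$. Let $r_n$ and $\widetilde r_n$ be the values at $z=-1$ of the analytic continuations, from the open unit disc $|z|<1$ to the closed disc $|z|\le1$ without the point $z=1$, of $$r_n(z)=\sum_{\nu=1}^\infty z^\nu R_n(\nu),\qquad \widetilde r_n(z)=-\sum_{\nu=1}^\infty z^\nu R_n'(\nu).$$ For a polynomial $P(t)=\sum_jP_j\frac{(t-1)\cdots(t-j)}{j!}$ put $\sigma(P)=\sum_jP_j(-\tfrac12)^{j+1}$ (the value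 at $z=-1$ of $\sum_{\nu\ge1}P(\nu)z^\nu$), and define the rational numbers $$a_n=-\sum_{k=0}^n(-1)^kA_k',\qquad b_n=\sum_{k=0}^n\sum_{l=1}^k(-1)^{k+l}\Bigl(\frac{A_k}{l^3}+\frac{A_k'}{l^2}+\frac{A_k''}{l}\Bigr)-\sigma(B),$$ $$\widetilde b_n=\sum_{k=0}^n\sum_{l=1}^k(-1)^{k+l}\Bigl(\frac{3A_k}{l^4}+\frac{2A_k'}{l^3}+\frac{A_k''}{l^2}\Bigr)-\sigma(-B').$$ Then these analytic continuations exist, and for all $n\ge0$ $$r_n=a_n\frac{\pi^2}{12}-b_n,\qquad \widetilde r_n=a_n\frac{3\zeta(3)}2-\widetilde b_n.$$ The sequences $r_n$, $\widetilde r_n$ and the coefficients $a_n$, $b_n$, $\widetilde b_n$ all satisfy (each in place of $u_n$) the recurrence relation $$\begin{aligned} &(1457n^2-1363n+348)(n+1)^4u_{n+1}\\ &\quad-(148614n^6+158202n^5-9295n^4-61894n^3-11111n^2+8932n+2784)u_n\\ &\quad+(97619n^6-91321n^5-9443n^4+35343n^3-5440n^2-5678n+1768)u_{n-1}\\ &\quad-3(1457n^2+1551n+442)(3n-2)(3n-4)(n-1)^2u_{n-2}=0,\qquad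 n=2,3,\dots, \end{aligned}$$ of order $3$, and the initial values are $$a_0=1,\ a_1=8,\ a_2=264;\qquad b_0=0,\ b_1=\tfrac{13}2,\ b_2=\tfrac{1737}8;\qquad \widetilde b_0=0,\ \widetilde b_1=\tfrac{29}2,\ \widetilde b_2=\tfrac{7617}{16}.$$ In addition, $$\limsup_{n\to\infty}|r_n|^{1/n}=\limsup_{n\to\infty}|\widetilde r_n|^{1/n}=|\lambda_{1,2}|=0.51616460\dots,$$ $$\lim_{n\to\infty}|a_n|^{1/n}=\lim_{n\to\infty}|b_n|^{1/n}=\lim_{n\to\infty}|\widetilde b_n|^{1/n}=\lambda_3=101.34149804\dots,$$ where $\lambda_{1,2}=0.32925097\ldots\pm i\,0.39751691\ldots$ and $\lambda_3$ are the zeros of $\lambda^3-102\lambda^2+67\lambda-27$. -/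

import Mathlib

open Filter Topology Polynomial

namespace WellPoised

noncomputable section

/-! ### The rational function and its series at `-1` -/

/-- The numerator
`(-1)^(n+1) / n! * (t + n/2) * ((t-1)...(t-n) * (t+n+1)...(t+2n))^2`. -/
def num (n : ℕ) : ℚ[X] :=
  C ((-1) ^ (n + 1) / (n.factorial : ℚ)) * (X + C ((n : ℚ) / 2)) *
    ((∏ j ∈ Finset.Icc 1 n, (X - C (j : ℚ))) *
      (∏ j ∈ Finset.Icc (n + 1) (2 * n), (X + C (j : ℚ)))) ^ 2

/-- The denominator `(t (t+1) ... (t+n))^3`. -/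
def den (n : ℕ) : ℚ[X] :=
  (∏ j ∈ Finset.range (n + 1), (X + C (j : ℚ))) ^ 3

/-- The denominator without its factor `(t+k)^3`. -/
def denErase (n k : ℕ) : ℚ[X] :=
  (∏ j ∈ (Finset.range (n + 1)).erase k, (X + C (j : ℚ))) ^ 3

/-- The well-poised rational function `R_n(t)` of a real variable. -/
def R (n : ℕ) (t : ℝ) : ℝ :=
  aeval t (num n) / aeval t (den n)

/-- The coefficients `-R_n'(t)` of the second series. -/
def negDerivR (n : ℕ) (t : ℝ) : ℝ :=
  -deriv (R n) t

/-- The power series `∑_{ν ≥ 1} c(ν) z^ν` converges in the open unit disc, its sum continues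
analytically to the closed unit disc without the point `1`, and the continuation takes the value
`v` at `-1`. -/
def HasContinuedValue (c : ℝ → ℝ) (v : ℝ) : Prop :=
  ∃ F : ℂ → ℂ,
    AnalyticOnNhd ℂ F (Metric.closedBall 0 1 \ {1}) ∧
    (∀ z : ℂ, ‖z‖ < 1 →
      HasSum (fun ν : ℕ => (c ((ν : ℝ) + 1) : ℂ) * z ^ (ν + 1)) (F z)) ∧
    F (-1) = (v : ℂ)

/-- The value at `z = -1` of `∑_{ν ≥ 1} c(ν) z^ν`, as the limit from inside the unit disc. By
continuity this is the value of the analytic continuation whenever `HasContinuedValue c v` holds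
for some `v`. -/
def valueAtNegOne (c : ℝ → ℝ) : ℝ :=
  limUnder (𝓝[>] (-1 : ℝ)) (fun x : ℝ => ∑' ν : ℕ, c ((ν : ℝ) + 1) * x ^ (ν + 1))

/-- `r_n = r_n(-1)`, where `r_n(z) = ∑_{ν ≥ 1} z^ν R_n(ν)`. -/
def r (n : ℕ) : ℝ := valueAtNegOne (R n)

/-- `r̃_n = r̃_n(-1)`, where `r̃_n(z) = -∑_{ν ≥ 1} z^ν R_n'(ν)`. -/
def rt (n : ℕ) : ℝ := valueAtNegOne (negDerivR n)

/-! ### The partial-fraction decomposition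
`R_n(t) = ∑_{k=0}^n (A_k/(t+k)^3 + A'_k/(t+k)^2 + A''_k/(t+k)) + B(t)` -/

/-- The coefficient of `(t+k)^(i-3)` in the Laurent expansion of `R_n(t)` at `t = -k`
(for `k ≤ n`), that is, the `i`-th Taylor coefficient at `-k` of `R_n(t) (t+k)^3`. -/
def laurentCoeff (n k i : ℕ) : ℚ :=
  PowerSeries.coeff i
    ((((num n).comp (X - C (k : ℚ)) : ℚ[X]) : PowerSeries ℚ) *
      (((denErase n k).comp (X - C (k : ℚ)) : ℚ[X]) : PowerSeries ℚ)⁻¹)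

/-- `A_k`, the coefficient of `1/(t+k)^3`. -/
def A (n k : ℕ) : ℚ := laurentCoeff n k 0

/-- `A'_k`, the coefficient of `1/(t+k)^2`. -/
def A' (n k : ℕ) : ℚ := laurentCoeff n k 1

/-- `A''_k`, the coefficient of `1/(t+k)`. -/
def A'' (n k : ℕ) : ℚ := laurentCoeff n k 2

/-- `B(t)`, the polynomial part of `R_n(t)`. -/
def B (n : ℕ) : ℚ[X] := num n /ₘ den n

/-- The value at `z = -1` of the rational function `∑_{ν ≥ 1} P(ν) z^ν`. If
`P(t) = ∑_j P_j (t-1)...(t-j)/j!`, then `P_j` is the `j`-th forward difference of `P` at `1`, and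
the sum is `∑_j P_j (z/(1-z))^(j+1)`. -/
def polySum (P : ℚ[X]) : ℚ :=
  ∑ j ∈ Finset.range (P.natDegree + 1),
    ((fwdDiff (1 : ℚ))^[j] (fun t => P.eval t)) 1 * (-1 / 2) ^ (j + 1)

/-! ### The coefficients of the linear forms

For `s ≥ 1` the value at `z = -1` of `∑_{ν ≥ 1} z^ν/(ν+k)^s` is
`(-1)^k (Li_s(-1) - ∑_{l=1}^k (-1)^l/l^s)`. -/

/-- `a_n`, minus the coefficient of `Li_2(-1) = -π²/12` in `r_n`. -/
def a (n : ℕ) : ℚ :=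
  -∑ k ∈ Finset.range (n + 1), (-1) ^ k * A' n k

/-- `b_n`, minus the rational part of `r_n`. -/
def b (n : ℕ) : ℚ :=
  (∑ k ∈ Finset.range (n + 1), ∑ l ∈ Finset.Icc 1 k,
    (-1) ^ (k + l) * (A n k / (l : ℚ) ^ 3 + A' n k / (l : ℚ) ^ 2 + A'' n k / (l : ℚ)))
    - polySum (B n)

/-- `b̃_n`, minus the rational part of `r̃_n`. -/
def bt (n : ℕ) : ℚ :=
  (∑ k ∈ Finset.range (n + 1), ∑ l ∈ Finset.Icc 1 k,
    (-1) ^ (k + l) *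
      (3 * A n k / (l : ℚ) ^ 4 + 2 * A' n k / (l : ℚ) ^ 3 + A'' n k / (l : ℚ) ^ 2))
    - polySum (-derivative (B n))

/-! ### The recurrence relation -/

/-- The third-order recurrence relation for a sequence `u`, for all `n ≥ 2`. -/
def SatisfiesRecurrence {K : Type*} [Field K] (u : ℕ → K) : Prop :=
  ∀ n : ℕ, 2 ≤ n →
    (1457 * (n : K) ^ 2 - 1363 * n + 348) * ((n : K) + 1) ^ 4 * u (n + 1)
    - (148614 * (n : K) ^ 6 + 158202 * (n : K) ^ 5 - 9295 * (n : K) ^ 4 - 61894 * (n : K) ^ 3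
        - 11111 * (n : K) ^ 2 + 8932 * n + 2784) * u n
    + (97619 * (n : K) ^ 6 - 91321 * (n : K) ^ 5 - 9443 * (n : K) ^ 4 + 35343 * (n : K) ^ 3
        - 5440 * (n : K) ^ 2 - 5678 * n + 1768) * u (n - 1)
    - 3 * (1457 * (n : K) ^ 2 + 1551 * n + 442) * (3 * (n : K) - 2) * (3 * (n : K) - 4)
        * ((n : K) - 1) ^ 2 * u (n - 2) = 0

end

end WellPoised

/-! The recurrence is creative telescoping. With S = `cert m`, the operator with coefficients
`rec0`, ..., `rec3`, applied to m ↦ R_m(t), gives S(t) + S(t+1). The sign is plus because the series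
are summed against (-1)^ν: the Abel value at -1 of S(t) + S(t+1) is -S(1). Since S has a double zero
at t = 1, both S(1) and S'(1) vanish, so `r` satisfies the recurrence and, after differentiation, so
does `rt`. Comparing the coefficients of 1/(t+k)^2 and taking their alternating sum gives it for
`a`; for `b` and `bt` it follows by linearity from the formulas for `r` and `rt`.

These formulas come from summing the partial fractions term by term. The symmetry R_n(-n-t) = (-1)^n
R_n(t) makes the alternating sums of A_k and A''_k vanish, so Li_2(-1) alone survives in `r` and
Li_3(-1) alone in `rt`. The continuations come from Laplace integrals for the polar terms and from
repeated differences for the polynomial part.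

The growth rests on a dichotomy of Poincaré–Perron type (`recurrence_growth`): a nonzero solution
either has the n-th root limit λ_3 or has limsup |λ_1|. The sequences `a`, `b`, `bt` are
nondecreasing and at least 1 from n = 1 on, which excludes |λ_1| < 1. For `r` and `rt` the limit λ_3
> 101 is excluded by a bound of the form polynomial times 75^n. In that bound an n-fold Euler
transform gains 2^n, because R_n and R_n' vanish at 1, ..., n; the differenced polar terms cancel
one binomial factor of the partial-fraction coefficients, and what remains is at most 150^n up to a
polynomial. -/

namespace WellPoised
noncomputable section

/-! ### The polynomial identity behind the certificate. -/

/-- The polynomial factor of the certificate of the recurrence relation. -/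
def certPoly {K : Type*} [CommRing K] (m t : K) : K :=
  (-1457 * m ^ 5 - 17578 * m ^ 4 - 82974 * m ^ 3 - 190944 * m ^ 2 - 213705 * m - 93150) * t ^
    12 +
  (-170469 * m ^ 6 - 2231466 * m ^ 5 - 12050579 * m ^ 4 - 34327758 * m ^ 3 - 54360532 * m ^ 2
    - 45358308 * m - 15582792) * t ^ 11 +
  (-2307888 * m ^ 7 - 32826492 * m ^ 6 - 197813945 * m ^ 5 - 653946792 * m ^ 4 - 1279625465 *
    m ^ 3 - 1480927484 * m ^ 2 - 938006586 * m - 250706868) * t ^ 10 +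
  (-13691429 * m ^ 8 - 209764666 * m ^ 7 - 1388174647 * m ^ 6 - 5176618488 * m ^ 5 -
    11883109642 * m ^ 4 - 17173457618 * m ^ 3 - 15238764038 * m ^ 2 - 7578872568 * m -
    1614175944) * t ^ 9 +
  (-43213163 * m ^ 9 - 704601534 * m ^ 8 - 5030862460 * m ^ 7 - 20609630062 * m ^ 6 -
    53280292845 * m ^ 5 - 89927642770 * m ^ 4 - 98795644587 * m ^ 3 - 67846772248 * m ^ 2 -
    26272065357 * m - 4330249806) * t ^ 8 +
  (-70773775 * m ^ 10 - 1193523217 * m ^ 9 - 8855241974 * m ^ 8 - 37886702120 * m ^ 7 -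
    102819220382 * m ^ 6 - 183017029745 * m ^ 5 - 212523473599 * m ^ 4 - 153340521742 * m ^ 3 -
    59937623082 * m ^ 2 - 7351391436 * m + 1416507264) * t ^ 7 +
  (-32741704 * m ^ 11 - 421517103 * m ^ 10 - 1690150805 * m ^ 9 + 2279764770 * m ^ 8 +
    48280259187 * m ^ 7 + 217041807611 * m ^ 6 + 546581054978 * m ^ 5 + 875920191518 * m ^ 4 +
    913969385820 * m ^ 3 + 602837017080 * m ^ 2 + 228367902120 * m + 37812603024) * t ^ 6 +
  (75890759 * m ^ 12 + 1888661677 * m ^ 11 + 20822252195 * m ^ 10 + 135198310945 * m ^ 9 +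
    577620676452 * m ^ 8 + 1713704801403 * m ^ 7 + 3622978660410 * m ^ 6 + 5499022499743 * m ^ 5
    + 5942406509356 * m ^ 4 + 4451447484180 * m ^ 3 + 2188402746160 * m ^ 2 + 631403453808 * m +
    80358385440) * t ^ 5 +
  (105316331 * m ^ 13 + 2545487429 * m ^ 12 + 27721243091 * m ^ 11 + 180116068941 * m ^ 10 +
    778342955787 * m ^ 9 + 2357951470179 * m ^ 8 + 5136011844026 * m ^ 7 + 8103519716825 * m ^ 6
    + 9186870769013 * m ^ 5 + 7289385204230 * m ^ 4 + 3831922720940 * m ^ 3 + 1189007988200 * m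
    ^ 2 + 158445295344 * m - 3101019168) * t ^ 4 +
  (-45231108 * m ^ 14 - 1144665589 * m ^ 13 - 13803595097 * m ^ 12 - 104620926284 * m ^ 11 -
    553049391874 * m ^ 10 - 2141700029999 * m ^ 9 - 6225118810759 * m ^ 8 - 13722520925788 * m ^
    7 - 22956206233258 * m ^ 6 - 28908361208468 * m ^ 5 - 26907289827648 * m ^ 4 -
    17913561838384 * m ^ 3 - 8049023683168 * m ^ 2 - 2180983578624 * m - 268356202752) * t ^ 3 +
  (-196327836 * m ^ 15 - 5188508741 * m ^ 14 - 63773125498 * m ^ 13 - 483337187640 * m ^ 12 -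
    2524502982704 * m ^ 11 - 9618184147951 * m ^ 10 - 27590410581372 * m ^ 9 - 60621649532872 *
    m ^ 8 - 102754844204626 * m ^ 7 - 134206203579732 * m ^ 6 - 133786846988108 * m ^ 5 -
    99821435449128 * m ^ 4 - 53872540166352 * m ^ 3 - 19816627514144 * m ^ 2 - 4432967966592 * m
    - 453457876992) * t ^ 2 +
  (-160820746 * m ^ 16 - 4470670691 * m ^ 15 - 57865066370 * m ^ 14 - 462660405543 * m ^ 13 -
    2556243363734 * m ^ 12 - 10342396032821 * m ^ 11 - 31675577321958 * m ^ 10 - 74853154737037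
    * m ^ 9 - 137814193629344 * m ^ 8 - 198151669645316 * m ^ 7 - 221511571718072 * m ^ 6 -
    190261026085872 * m ^ 5 - 122911829140512 * m ^ 4 - 57635493708992 * m ^ 3 - 18464118080640
    * m ^ 2 - 3602222128128 * m - 321534273024) * t +
  (-45614299 * m ^ 17 - 1334412109 * m ^ 16 - 18218674297 * m ^ 15 - 154095464961 * m ^ 14 -
    903806575855 * m ^ 13 - 3898562712563 * m ^ 12 - 12797438359387 * m ^ 11 - 32628716246931 *
    m ^ 10 - 65359249851362 * m ^ 9 - 103345743402252 * m ^ 8 - 128846974176128 * m ^ 7 -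
    125784903868960 * m ^ 6 - 94836973694464 * m ^ 5 - 53975379653888 * m ^ 4 - 22351710997248 *
    m ^ 3 - 6332677003008 * m ^ 2 - 1093412820480 * m - 86417998848)

-- This is the telescoping relation divided by `base m t` and multiplied by
-- (m+1)(m+2)((t+m+1)(t+m+2)(t+m+3))^5. The signs alternate because `base` changes sign with each
-- step in m, and `rec3` has lost one factor m+3 to the denominator of the third step.
set_option maxRecDepth 20000 in
set_option maxHeartbeats 0 in
theorem certPoly_identity (m t : ℝ) :
    -(3 * (1457 * (m + 2) ^ 2 + 1551 * (m + 2) + 442) * (3 * (m + 2) - 2) * (3 * (m + 2) - 4)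
        * (m + 1) ^ 2) * ((m + 1) * (m + 2) * (2 * t + m)
        * ((t + m + 1) * (t + m + 2) * (t + m + 3)) ^ 5)
    - (97619 * (m + 2) ^ 6 - 91321 * (m + 2) ^ 5 - 9443 * (m + 2) ^ 4 + 35343 * (m + 2) ^ 3
        - 5440 * (m + 2) ^ 2 - 5678 * (m + 2) + 1768) * ((m + 2) * (2 * t + (m + 1))
        * ((t - m - 1) * (t + 2 * m + 1) * (t + 2 * m + 2)) ^ 2
        * ((t + m + 2) * (t + m + 3)) ^ 5)
    + -(148614 * (m + 2) ^ 6 + 158202 * (m + 2) ^ 5 - 9295 * (m + 2) ^ 4 - 61894 * (m + 2) ^ 3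
        - 11111 * (m + 2) ^ 2 + 8932 * (m + 2) + 2784) * ((2 * t + (m + 2))
        * (((t - m - 1) * (t + 2 * m + 1) * (t + 2 * m + 2)) *
          ((t - m - 2) * (t + 2 * m + 3) * (t + 2 * m + 4))) ^ 2 * (t + m + 3) ^ 5)
    - (1457 * (m + 2) ^ 2 - 1363 * (m + 2) + 348) * (m + 3) ^ 3 * ((2 * t + (m + 3))
        * (((t - m - 1) * (t + 2 * m + 1) * (t + 2 * m + 2)) *
          ((t - m - 2) * (t + 2 * m + 3) * (t + 2 * m + 4)) *
          ((t - m - 3) * (t + 2 * m + 5) * (t + 2 * m + 6))) ^ 2)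
    = (t - m - 1) ^ 2 * certPoly m t * (t + m + 3) ^ 5
      + t ^ 5 * (t + 2 * m + 1) ^ 2 * certPoly m (t + 1) := by
  unfold certPoly
  ring

end
end WellPoised

namespace WellPoised
noncomputable section

/-! ### Telescoping of the rational functions -/

/-- The function `R m t / (2 t + m)`. -/
def base (m : ℕ) (t : ℝ) : ℝ :=
  (-1) ^ (m + 1) / (2 * m.factorial) *
    ((∏ i ∈ Finset.range m, (t - (i + 1))) * ∏ i ∈ Finset.range m, (t + m + 1 + i)) ^ 2 /
    (∏ i ∈ Finset.range (m + 1), (t + i)) ^ 3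

lemma prod_Icc_sub (n : ℕ) (t : ℝ) :
    ∏ j ∈ Finset.Icc 1 n, (t - (j : ℝ)) = ∏ i ∈ Finset.range n, (t - (i + 1)) := by
  rw [← Finset.Ico_add_one_right_eq_Icc, Finset.prod_Ico_eq_prod_range]
  refine Finset.prod_congr (by simp) fun i _ => by push_cast; ring

lemma prod_Icc_add (n : ℕ) (t : ℝ) :
    ∏ j ∈ Finset.Icc (n + 1) (2 * n), (t + (j : ℝ)) = ∏ i ∈ Finset.range n, (t + n + 1 + i) := by
  rw [← Finset.Ico_add_one_right_eq_Icc, Finset.prod_Ico_eq_prod_range]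
  refine Finset.prod_congr (by congr 1; omega) fun i _ => by push_cast; ring

lemma aeval_num (n : ℕ) (t : ℝ) :
    aeval t (num n) = (-1) ^ (n + 1) / n.factorial * (t + n / 2) *
      ((∏ i ∈ Finset.range n, (t - (i + 1))) * ∏ i ∈ Finset.range n, (t + n + 1 + i)) ^ 2 := by
  rw [← prod_Icc_sub, ← prod_Icc_add]
  simp [num, map_prod]

lemma aeval_den (n : ℕ) (t : ℝ) :
    aeval t (den n) = (∏ i ∈ Finset.range (n + 1), (t + i)) ^ 3 := by
  simp [den, map_prod]

/-- The linear factor is split off because the remaining product has simple quotients under m → m+1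
and t → t+1. -/
lemma R_eq_base (n : ℕ) (t : ℝ) : R n t = (2 * t + n) * base n t := by
  rw [R, aeval_num, aeval_den, base]
  field_simp

lemma prod_add_ne_zero {t : ℝ} {n : ℕ} (ht : ∀ j < n, t + (j : ℕ) ≠ 0) :
    ∏ i ∈ Finset.range n, (t + i) ≠ 0 :=
  Finset.prod_ne_zero_iff.2 fun i hi => ht i (Finset.mem_range.1 hi)

lemma prod_shift (m : ℕ) (t : ℝ) :
    (∏ i ∈ Finset.range m, (t + 1 + m + 1 + i)) * (t + m + 1) =
      (∏ i ∈ Finset.range m, (t + m + 1 + i)) * (t + 2 * m + 1) := by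
  have h1 := Finset.prod_range_succ (fun i : ℕ => t + m + 1 + (i : ℝ)) m
  have h2 := Finset.prod_range_succ' (fun i : ℕ => t + m + 1 + (i : ℝ)) m
  rw [h1] at h2
  have h3 : ∏ i ∈ Finset.range m, (t + 1 + m + 1 + (i : ℝ)) =
      ∏ i ∈ Finset.range m, (t + m + 1 + ((i + 1 : ℕ) : ℝ)) :=
    Finset.prod_congr rfl fun i _ => by push_cast; ring
  rw [h3]
  simp only [Nat.cast_zero, add_zero] at h2
  rw [← h2]; ring

lemma base_succ (m : ℕ) {t : ℝ} (ht : ∀ j : ℕ, t + j ≠ 0) :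
    base (m + 1) t = -base m t * ((t - m - 1) * (t + 2 * m + 1) * (t + 2 * m + 2)) ^ 2 /
      ((m + 1) * (t + m + 1) ^ 5) := by
  have h1 : t + m + 1 ≠ 0 := by have := ht (m + 1); push_cast at this; rwa [← add_assoc] at this
  have hp := prod_shift m t
  have h2 : ∏ i ∈ Finset.range (m + 1), (t + ((m + 1 : ℕ) : ℝ) + 1 + i) =
      (∏ i ∈ Finset.range m, (t + m + 1 + i)) * (t + 2 * m + 1) / (t + m + 1) *
        (t + 2 * m + 2) := by
    rw [Finset.prod_range_succ, ← hp]
    have : ∏ i ∈ Finset.range m, (t + ((m + 1 : ℕ) : ℝ) + 1 + i) =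
        ∏ i ∈ Finset.range m, (t + 1 + m + 1 + i) :=
      Finset.prod_congr rfl fun i _ => by push_cast; ring
    rw [this]
    field_simp
    push_cast; ring
  have hd := prod_add_ne_zero (n := m + 1) fun j _ => ht j
  rw [base, h2, Finset.prod_range_succ (fun i : ℕ => t - (i + 1 : ℝ)),
    Finset.prod_range_succ _ (m + 1), base, Nat.factorial_succ]
  have hm : (m : ℝ) + 1 ≠ 0 := by positivity
  have hf : (m.factorial : ℝ) ≠ 0 := by positivity
  push_cast
  rw [pow_succ (-1 : ℝ) (m + 1)]
  have h1' : t + (m + 1 : ℝ) ≠ 0 := by rwa [← add_assoc]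
  field_simp
  ring

/-- The squared numerator contributes t^2 and the cubed denominator t^3 to the factor t^5. Keeping
(t-m)^2 on the left avoids a division at t = m, an integer at which the identity is needed; the
certificate supplies exactly this factor after the shift. -/
lemma base_shift (m : ℕ) {t : ℝ} (ht : ∀ j : ℕ, t + j ≠ 0) :
    base m (t + 1) * (t - m) ^ 2 =
      base m t * (t ^ 5 * (t + 2 * m + 1) ^ 2) / (t + m + 1) ^ 5 := by
  have h1 : t + m + 1 ≠ 0 := by have := ht (m + 1); push_cast at this; rwa [← add_assoc] at this
  have h0 : t ≠ 0 := by simpa using ht 0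
  have hp := prod_shift m t
  have hd := prod_add_ne_zero (n := m + 1) fun j _ => ht j
  have ha : (∏ i ∈ Finset.range m, (t + 1 - (i + 1 : ℝ))) * (t - m) =
      t * ∏ i ∈ Finset.range m, (t - (i + 1 : ℝ)) := by
    have e1 := Finset.prod_range_succ (fun i : ℕ => t - (i : ℝ)) m
    rw [Finset.prod_range_succ'] at e1
    simp only [Nat.cast_zero, sub_zero, Nat.cast_add, Nat.cast_one] at e1
    rw [mul_comm t, e1]
    congr 1
    exact Finset.prod_congr rfl fun i _ => by ring
  have hb : (∏ i ∈ Finset.range (m + 1), (t + 1 + (i : ℝ))) * t =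
      (∏ i ∈ Finset.range (m + 1), (t + (i : ℝ))) * (t + m + 1) := by
    have e1 := Finset.prod_range_succ (fun i : ℕ => t + (i : ℝ)) (m + 1)
    rw [Finset.prod_range_succ'] at e1
    simp only [Nat.cast_zero, add_zero, Nat.cast_add, Nat.cast_one] at e1
    rw [← add_assoc] at e1
    rw [← e1]
    congr 1
    exact Finset.prod_congr rfl fun i _ => by ring
  have hd1 : ∏ i ∈ Finset.range (m + 1), (t + 1 + (i : ℝ)) ≠ 0 := by
    refine Finset.prod_ne_zero_iff.2 fun i _ => ?_
    have := ht (i + 1); push_cast at this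
    rwa [add_assoc, add_comm (1 : ℝ)]
  rw [base, base]
  set a1 := ∏ i ∈ Finset.range m, (t + 1 - (i + 1 : ℝ))
  set a0 := ∏ i ∈ Finset.range m, (t - (i + 1 : ℝ))
  set b1 := ∏ i ∈ Finset.range m, (t + 1 + m + 1 + (i : ℝ))
  set b0 := ∏ i ∈ Finset.range m, (t + m + 1 + (i : ℝ))
  set d1 := ∏ i ∈ Finset.range (m + 1), (t + 1 + (i : ℝ))
  set d0 := ∏ i ∈ Finset.range (m + 1), (t + (i : ℝ))
  generalize (-1 : ℝ) ^ (m + 1) / (2 * m.factorial) = c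
  have e : (a1 * b1) ^ 2 * (t - m) ^ 2 * (d0 ^ 3 * (t + m + 1) ^ 5) =
      (a0 * b0) ^ 2 * (t ^ 5 * (t + 2 * m + 1) ^ 2) * d1 ^ 3 := by
    calc _ = (a1 * (t - m)) ^ 2 * (b1 * (t + m + 1)) ^ 2 * (d0 * (t + m + 1)) ^ 3 := by ring
      _ = _ := by rw [ha, hp, ← hb]; ring
  rw [div_mul_eq_mul_div, div_mul_eq_mul_div, div_div, div_eq_div_iff (by positivity) (by positivity)]
  linear_combination c * e

/-- The certificate of the recurrence relation. -/
def cert (m : ℕ) (t : ℝ) : ℝ :=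
  base m t * ((t - m - 1) ^ 2 * certPoly (m : ℝ) t) /
    ((m + 1) * (m + 2) * ((t + m + 1) * (t + m + 2)) ^ 5)

/-- The coefficient of `u m` in the recurrence relation. -/
def rec0 (m : ℕ) : ℝ :=
  -(3 * (1457 * ((m : ℝ) + 2) ^ 2 + 1551 * (m + 2) + 442) * (3 * (m + 2) - 2) * (3 * (m + 2) - 4)
        * (m + 1) ^ 2)

/-- The coefficient of `u (m + 1)` in the recurrence relation. -/
def rec1 (m : ℕ) : ℝ :=
  97619 * ((m : ℝ) + 2) ^ 6 - 91321 * (m + 2) ^ 5 - 9443 * (m + 2) ^ 4 + 35343 * (m + 2) ^ 3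
        - 5440 * (m + 2) ^ 2 - 5678 * (m + 2) + 1768

/-- The coefficient of `u (m + 2)` in the recurrence relation. -/
def rec2 (m : ℕ) : ℝ :=
  -(148614 * ((m : ℝ) + 2) ^ 6 + 158202 * (m + 2) ^ 5 - 9295 * (m + 2) ^ 4 - 61894 * (m + 2) ^ 3
        - 11111 * (m + 2) ^ 2 + 8932 * (m + 2) + 2784)

/-- The coefficient of `u (m + 3)` in the recurrence relation. -/
def rec3 (m : ℕ) : ℝ :=
  (1457 * ((m : ℝ) + 2) ^ 2 - 1363 * (m + 2) + 348) * (m + 3) ^ 4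

/-- The denominators are cleared with letters in place of the linear factors: `x i` stands for
t+m+i, `M i` for m+i, `u i` for the numerator of the i-th quotient of `base`, `w i` for 2t+m+i. The
large coefficients thus never enter `field_simp`. -/
lemma telescoping_aux {K x1 x2 x3 u1 u2 u3 M1 M2 M3 : ℝ} (w0 w1 w2 w3 c0 c1 c2 c3 A B : ℝ)
    (hx1 : x1 ≠ 0) (hx2 : x2 ≠ 0) (hx3 : x3 ≠ 0) (hM1 : M1 ≠ 0) (hM2 : M2 ≠ 0) (hM3 : M3 ≠ 0)
    (h : c0 * (M1 * M2 * w0 * (x1 * x2 * x3) ^ 5) - c1 * (M2 * w1 * u1 ^ 2 * (x2 * x3) ^ 5)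
      + c2 * (w2 * (u1 * u2) ^ 2 * x3 ^ 5) - c3 * (w3 * (u1 * u2 * u3) ^ 2) = A * x3 ^ 5 + B) :
    c0 * (w0 * K) + c1 * (w1 * (-K * u1 ^ 2 / (M1 * x1 ^ 5))) +
      c2 * (w2 * (-(-K * u1 ^ 2 / (M1 * x1 ^ 5)) * u2 ^ 2 / (M2 * x2 ^ 5))) +
      (c3 * M3) * (w3 * (-(-(-K * u1 ^ 2 / (M1 * x1 ^ 5)) * u2 ^ 2 / (M2 * x2 ^ 5)) * u3 ^ 2 /
        (M3 * x3 ^ 5))) =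
    K * A / (M1 * M2 * (x1 * x2) ^ 5) + K * B / (M1 * M2 * (x1 * x2 * x3) ^ 5) := by
  have h' : K * A / (M1 * M2 * (x1 * x2) ^ 5) + K * B / (M1 * M2 * (x1 * x2 * x3) ^ 5) =
      K * (A * x3 ^ 5 + B) / (M1 * M2 * (x1 * x2 * x3) ^ 5) := by
    field_simp
  rw [h', ← h]
  field_simp
  ring

theorem telescoping (m : ℕ) {t : ℝ} (ht : ∀ j : ℕ, t + j ≠ 0) :
    rec0 m * R m t + rec1 m * R (m + 1) t + rec2 m * R (m + 2) t + rec3 m * R (m + 3) t =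
      cert m t + cert m (t + 1) := by
  have h1 : t + m + 1 ≠ 0 := by have := ht (m + 1); push_cast at this; rwa [← add_assoc] at this
  have h2 : t + m + 2 ≠ 0 := by have := ht (m + 2); push_cast at this; rwa [← add_assoc] at this
  have h3 : t + m + 3 ≠ 0 := by have := ht (m + 3); push_cast at this; rwa [← add_assoc] at this
  have m1 : (m : ℝ) + 1 ≠ 0 := by positivity
  have m2 : (m : ℝ) + 2 ≠ 0 := by positivity
  have m3 : (m : ℝ) + 3 ≠ 0 := by positivity
  have b1 : base (m + 1) t = -base m t * ((t - m - 1) * (t + 2 * m + 1) * (t + 2 * m + 2)) ^ 2 /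
      ((m + 1) * (t + m + 1) ^ 5) := base_succ m ht
  have b2 : base (m + 2) t = -base (m + 1) t *
      ((t - m - 2) * (t + 2 * m + 3) * (t + 2 * m + 4)) ^ 2 / ((m + 2) * (t + m + 2) ^ 5) := by
    rw [base_succ (m + 1) ht]; push_cast; ring_nf
  have b3 : base (m + 3) t = -base (m + 2) t *
      ((t - m - 3) * (t + 2 * m + 5) * (t + 2 * m + 6)) ^ 2 / ((m + 3) * (t + m + 3) ^ 5) := by
    rw [base_succ (m + 2) ht]; push_cast; ring_nf
  have hs : cert m (t + 1) = base m t * (t ^ 5 * (t + 2 * m + 1) ^ 2) * certPoly (m : ℝ) (t + 1) /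
      ((m + 1) * (m + 2) * ((t + m + 1) * (t + m + 2) * (t + m + 3)) ^ 5) := by
    have e : cert m (t + 1) = (base m (t + 1) * (t - m) ^ 2) * certPoly (m : ℝ) (t + 1) /
      ((m + 1) * (m + 2) * ((t + m + 2) * (t + m + 3)) ^ 5) := by
      rw [cert]; ring_nf
    rw [e, base_shift m ht]
    field_simp
  have key := certPoly_identity m t
  rw [R_eq_base, R_eq_base, R_eq_base, R_eq_base, b3, b2, b1, hs, cert]
  have e3 : rec3 m = (1457 * ((m : ℝ) + 2) ^ 2 - 1363 * (m + 2) + 348) * (m + 3) ^ 3 * (m + 3) := by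
    rw [rec3]; ring
  rw [e3, mul_assoc (base m t) (t ^ 5 * _)]
  refine telescoping_aux _ _ _ _ _ _ _ _ _ _ h1 h2 h3 m1 m2 m3 ?_
  rw [rec0, rec1, rec2]
  push_cast
  exact key

end
end WellPoised

namespace WellPoised
noncomputable section

/-! ### Partial fractions -/

theorem exists_partialFraction {K : Type*} [Field K] [CharZero K] (p : K[X]) (N e : ℕ) :
    ∃ (q : K[X]) (r : ℕ → ℕ → K),
      p = q * (∏ j ∈ Finset.range N, (X + C (j : K))) ^ e +
        ∑ k ∈ Finset.range N, ∑ i ∈ Finset.range e, C (r k i) * (X + C (k : K)) ^ i *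
          (∏ j ∈ (Finset.range N).erase k, (X + C (j : K))) ^ e := by
  classical
  obtain ⟨q, r, hr, h⟩ := eq_quo_mul_prod_pow_add_sum_rem_mul_prod_pow (s := Finset.range N) p
    (g := fun j : ℕ => X + C (j : K)) (fun j _ => monic_X_add_C _)
    (by
      intro i _ j _ hij
      have := Polynomial.isCoprime_X_sub_C_of_isUnit_sub (a := -(i : K)) (b := -(j : K))
        (by
          rw [isUnit_iff_ne_zero, neg_sub_neg, sub_ne_zero]
          exact_mod_cast hij.symm)
      simpa using this) (fun _ => e)
  refine ⟨q, fun k i => if hi : i < e then (r k ⟨i, hi⟩).coeff 0 else 0, ?_⟩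
  rw [h]
  congr 1
  · rw [Finset.prod_pow]
  · refine Finset.sum_congr rfl fun k hk => ?_
    rw [Finset.sum_range]
    refine Finset.sum_congr rfl fun i _ => ?_
    have hc : r k i = C ((r k i).coeff 0) := by
      refine eq_C_of_degree_le_zero ?_
      have := hr k hk i
      rw [degree_X_add_C] at this
      exact Nat.WithBot.lt_one_iff_le_zero.1 this
    rw [← Finset.prod_pow]
    simp only [Fin.is_lt, dif_pos, Fin.eta]
    rw [← hc]

/-- The function `f` is, away from `0, -1, ..., -(N - 1)`, the sum of the polynomial `P` and of
the terms `α k s / (t + k) ^ (s + 1)` with `k < N` and `s < 5`. -/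
structure HasPF (f : ℝ → ℝ) (N : ℕ) (α : ℕ → ℕ → ℝ) (P : ℝ[X]) : Prop where
  zero : ∀ k s, N ≤ k → α k s = 0
  eq : ∀ t : ℝ, (∀ j < N, t + (j : ℕ) ≠ 0) →
    f t = P.eval t + ∑ k ∈ Finset.range N, ∑ s ∈ Finset.range 5, α k s / (t + k) ^ (s + 1)

namespace HasPF

variable {f g : ℝ → ℝ} {N M : ℕ} {α β : ℕ → ℕ → ℝ} {P Q : ℝ[X]}

lemma mono (h : HasPF f N α P) (hNM : N ≤ M) : HasPF f M α P where
  zero k s hk := h.zero k s (hNM.trans hk)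
  eq t ht := by
    rw [h.eq t fun j hj => ht j (hj.trans_le hNM)]
    congr 1
    refine Finset.sum_subset (Finset.range_subset_range.2 hNM) fun k _ hk => ?_
    simp only [Finset.mem_range, not_lt] at hk
    simp [h.zero k _ hk]

lemma add (h : HasPF f N α P) (h' : HasPF g N β Q) :
    HasPF (fun t => f t + g t) N (fun k s => α k s + β k s) (P + Q) where
  zero k s hk := by simp [h.zero k s hk, h'.zero k s hk]
  eq t ht := by
    simp only [h.eq t ht, h'.eq t ht, eval_add, add_div, Finset.sum_add_distrib]
    ring

lemma const_mul (c : ℝ) (h : HasPF f N α P) :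
    HasPF (fun t => c * f t) N (fun k s => c * α k s) (C c * P) where
  zero k s hk := by simp [h.zero k s hk]
  eq t ht := by
    simp only [h.eq t ht, eval_mul, eval_C, mul_div_assoc, ← Finset.mul_sum]
    ring

lemma shift (h : HasPF f N α P) :
    HasPF (fun t => f (t + 1)) (N + 1) (fun k s => if k = 0 then 0 else α (k - 1) s)
      (P.comp (X + 1)) where
  zero k s hk := by
    rw [if_neg (by omega)]
    exact h.zero _ s (by omega)
  eq t ht := by
    have ht' : ∀ j < N, t + 1 + (j : ℕ) ≠ 0 := fun j hj => by
      have := ht (j + 1) (by omega)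
      push_cast at this
      rwa [add_assoc, add_comm 1]
    rw [h.eq _ ht', Finset.sum_range_succ']
    simp only [eval_comp, eval_add, eval_X, eval_one, Nat.succ_ne_zero, if_false,
      Nat.add_sub_cancel, if_true, zero_div, Finset.sum_const_zero, add_zero, Nat.cast_add,
      Nat.cast_one]
    congr 1
    refine Finset.sum_congr rfl fun k _ => Finset.sum_congr rfl fun s _ => ?_
    ring

end HasPF

/-- Multiplying by the highest power of t - x and letting t tend to x kills the top coefficient;
induction removes the others. -/
lemma polar_coeff_eq_zero (e : ℕ) (γ : ℕ → ℝ) (h : ℝ → ℝ) (x : ℝ) (hh : ContinuousAt h x)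
    (heq : ∀ᶠ t in 𝓝[≠] x, ∑ s ∈ Finset.range e, γ s / (t - x) ^ (s + 1) + h t = 0) :
    ∀ s < e, γ s = 0 := by
  induction e with
  | zero => simp
  | succ e ih =>
    have hlim : Tendsto (fun t => ∑ s ∈ Finset.range (e + 1), γ s * (t - x) ^ (e - s) +
        h t * (t - x) ^ (e + 1)) (𝓝[≠] x) (𝓝 (γ e)) := by
      have hc : ContinuousAt (fun t => ∑ s ∈ Finset.range (e + 1), γ s * (t - x) ^ (e - s) +
        h t * (t - x) ^ (e + 1)) x := by fun_prop
      have := hc.tendsto.mono_left (nhdsWithin_le_nhds (s := {x}ᶜ))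
      convert this using 2
      rw [Finset.sum_range_succ, Finset.sum_eq_zero]
      · simp
      · intro s hs
        simp only [Finset.mem_range] at hs
        simp [Nat.sub_ne_zero_of_lt hs]
    have h0 : γ e = 0 := by
      refine tendsto_nhds_unique hlim ((tendsto_const_nhds (x := (0 : ℝ))).congr' ?_)
      filter_upwards [heq, self_mem_nhdsWithin] with t ht hne
      have hx : t - x ≠ 0 := sub_ne_zero.2 hne
      have := congrArg (fun y => y * (t - x) ^ (e + 1)) ht
      simp only [zero_mul, add_mul, Finset.sum_mul] at this
      rw [← this]
      congr 1
      refine Finset.sum_congr rfl fun s hs => ?_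
      simp only [Finset.mem_range] at hs
      rw [div_mul_eq_mul_div, mul_div_assoc]
      congr 1
      rw [eq_comm, show e + 1 = (e - s) + (s + 1) by omega, pow_add]
      field_simp
    intro s hs
    rcases Nat.lt_succ_iff_lt_or_eq.1 hs with hs | rfl
    · refine ih ?_ s hs
      filter_upwards [heq] with t ht
      rw [Finset.sum_range_succ, h0] at ht
      simpa using ht
    · exact h0

/-- Near -k everything except the polar part at -k is continuous, so the poles can be treated one at
a time. -/
lemma pf_coeff_eq_zero {N : ℕ} {α : ℕ → ℕ → ℝ} {P : ℝ[X]}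
    (h : ∀ t : ℝ, (∀ j : ℕ, t + j ≠ 0) →
      P.eval t + ∑ k ∈ Finset.range N, ∑ s ∈ Finset.range 5, α k s / (t + k) ^ (s + 1) = 0) :
    ∀ k < N, ∀ s < 5, α k s = 0 := by
  intro k hk
  refine polar_coeff_eq_zero 5 (α k) (fun t => P.eval t + ∑ j ∈ (Finset.range N).erase k,
    ∑ s ∈ Finset.range 5, α j s / (t + j) ^ (s + 1)) (-(k : ℝ)) ?_ ?_
  · refine ContinuousAt.add P.continuous.continuousAt ?_
    refine tendsto_finsetSum _ fun j hj => tendsto_finsetSum _ fun s _ => ?_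
    have : (-(k : ℝ) + j) ≠ 0 := by
      rw [neg_add_eq_sub, sub_ne_zero]
      exact_mod_cast (Finset.mem_erase.1 hj).1
    have hc : ContinuousAt (fun t : ℝ => α j s / (t + j) ^ (s + 1)) (-(k : ℝ)) :=
      ContinuousAt.div (by fun_prop) (by fun_prop) (pow_ne_zero _ this)
    exact hc.tendsto
  · have hnear : ∀ᶠ t : ℝ in 𝓝[≠] (-(k : ℝ)), ∀ j : ℕ, t + j ≠ 0 := by
      have hb : Metric.ball (-(k : ℝ)) 1 ∈ 𝓝[≠] (-(k : ℝ)) :=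
        mem_nhdsWithin_of_mem_nhds (Metric.ball_mem_nhds _ one_pos)
      filter_upwards [hb, self_mem_nhdsWithin] with t ht hne j hj
      rw [Metric.mem_ball, Real.dist_eq, abs_lt] at ht
      have hjk : j ≠ k := by
        rintro rfl
        exact hne (by simp; linarith)
      have e1 : ((k : ℝ) - j) < 1 := by linarith
      have e2 : -1 < ((k : ℝ) - j) := by linarith
      have e1' : ((k : ℤ) - j) < 1 := by exact_mod_cast e1
      have e2' : -1 < ((k : ℤ) - j) := by exact_mod_cast e2
      omega
    filter_upwards [hnear] with t ht
    have := h t ht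
    rw [← Finset.add_sum_erase _ _ (Finset.mem_range.2 hk)] at this
    simp only [sub_neg_eq_add]
    linarith

lemma HasPF.unique {f g : ℝ → ℝ} {N : ℕ} {α β : ℕ → ℕ → ℝ} {P Q : ℝ[X]} (h : HasPF f N α P)
    (h' : HasPF g N β Q) (hfg : ∀ t : ℝ, (∀ j : ℕ, t + j ≠ 0) → f t = g t) :
    ∀ k, ∀ s < 5, α k s = β k s := by
  intro k s hs
  by_cases hk : N ≤ k
  · rw [h.zero k s hk, h'.zero k s hk]
  have h0 := h.add (h'.const_mul (-1))
  have := pf_coeff_eq_zero (fun t ht => by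
    rw [← h0.eq t fun j _ => ht j, hfg t ht]; ring) k (not_le.1 hk) s hs
  linarith

lemma hasPF_of_polynomial {f : ℝ → ℝ} {N : ℕ} (p : ℝ[X])
    (h : ∀ t : ℝ, (∀ j < N, t + (j : ℕ) ≠ 0) →
      f t = p.eval t / (∏ j ∈ Finset.range N, (t + j)) ^ 5) :
    ∃ α P, HasPF f N α P := by
  obtain ⟨q, r, hp⟩ := exists_partialFraction p N 5
  refine ⟨fun k s => if k < N then r k (4 - s) else 0, q, ⟨fun k s hk => if_neg (by omega), ?_⟩⟩
  intro t ht
  have hd := prod_add_ne_zero ht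
  rw [h t ht, hp]
  simp only [eval_add, eval_mul, eval_pow, eval_prod, eval_X, eval_C, eval_finsetSum, add_div]
  rw [mul_div_cancel_right₀ _ (pow_ne_zero _ hd), Finset.sum_div]
  congr 1
  refine Finset.sum_congr rfl fun k hk => ?_
  rw [← Finset.mul_prod_erase _ _ hk, Finset.sum_div, ← Finset.sum_range_reflect]
  refine Finset.sum_congr rfl fun s hs => ?_
  have h1 := ht k (Finset.mem_range.1 hk)
  have h2 : ∏ j ∈ (Finset.range N).erase k, (t + (j : ℝ)) ≠ 0 :=
    Finset.prod_ne_zero_iff.2 fun i hi =>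
      ht i (Finset.mem_range.1 (Finset.mem_of_mem_erase hi))
  have hs5 : s ≤ 4 := by simp only [Finset.mem_range] at hs; omega
  rw [if_pos (Finset.mem_range.1 hk), div_eq_div_iff (by positivity) (by positivity)]
  simp only [show 5 - 1 - s = 4 - s from rfl]
  have : (t + (k : ℝ)) ^ 5 = (t + k) ^ (4 - s) * (t + k) ^ (s + 1) := by
    rw [← pow_add]; congr 1; omega
  rw [mul_pow, this]
  ring

/-! ### Laurent coefficients as partial-fraction coefficients. -/

lemma denErase_comp_constantCoeff (n k : ℕ) :
    PowerSeries.constantCoeff (((denErase n k).comp (X - C (k : ℚ)) : ℚ[X]) : PowerSeries ℚ)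
      ≠ 0 := by
  rw [Polynomial.constantCoeff_coe, Polynomial.coeff_zero_eq_eval_zero]
  simp only [denErase, eval_comp, eval_pow, eval_prod, eval_sub, eval_add, eval_X, eval_C]
  refine pow_ne_zero _ (Finset.prod_ne_zero_iff.2 fun j hj => ?_)
  rw [zero_sub, neg_add_eq_sub, sub_ne_zero]
  exact_mod_cast (Finset.mem_erase.1 hj).1

/-- Multiplication by the inverse power series of the shifted `denErase` leaves ∑ r_i X^i modulo
X^3. -/
lemma laurentCoeff_eq {n k : ℕ} (r : ℕ → ℚ) (W : ℚ[X])
    (h : (num n).comp (X - C (k : ℚ)) =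
      (∑ i ∈ Finset.range 3, C (r i) * X ^ i) * (denErase n k).comp (X - C (k : ℚ)) + X ^ 3 * W)
    {i : ℕ} (hi : i < 3) : laurentCoeff n k i = r i := by
  rw [laurentCoeff, h, Polynomial.coe_add, Polynomial.coe_mul, Polynomial.coe_mul, add_mul,
    mul_assoc, PowerSeries.mul_inv_cancel _ (denErase_comp_constantCoeff n k), mul_one, map_add,
    Polynomial.coe_pow, Polynomial.coe_X, mul_assoc, PowerSeries.coeff_X_pow_mul', if_neg (by omega),
    add_zero, Polynomial.coeff_coe]
  simp only [finsetSum_coeff, coeff_C_mul, coeff_X_pow]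
  rw [Finset.sum_eq_single i]
  · simp
  · intro b _ hb
    simp [hb.symm]
  · intro h'; exact absurd (Finset.mem_range.2 hi) h'

lemma den_monic (n : ℕ) : (den n).Monic :=
  (monic_prod_of_monic _ _ fun _ _ => monic_X_add_C _).pow 3

lemma natDegree_den (n : ℕ) : (den n).natDegree = 3 * (n + 1) := by
  rw [den, natDegree_pow, natDegree_prod_of_monic _ _ fun _ _ => monic_X_add_C _]
  simp only [natDegree_X_add_C, Finset.sum_const, Finset.card_range, smul_eq_mul, mul_one]

lemma natDegree_denErase {n k : ℕ} (hk : k ∈ Finset.range (n + 1)) :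
    (denErase n k).natDegree = 3 * n := by
  rw [denErase, natDegree_pow, natDegree_prod_of_monic _ _ fun _ _ => monic_X_add_C _]
  simp only [natDegree_X_add_C, Finset.sum_const, Finset.card_erase_of_mem hk, Finset.card_range,
    smul_eq_mul, mul_one, Nat.add_sub_cancel]

lemma degree_polar_lt (n : ℕ) (r : ℕ → ℕ → ℚ) :
    (∑ k ∈ Finset.range (n + 1), ∑ i ∈ Finset.range 3,
      C (r k i) * (X + C (k : ℚ)) ^ i * denErase n k).degree < (den n).degree := by
  rw [degree_eq_natDegree (den_monic n).ne_zero, natDegree_den]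
  refine (degree_sum_le _ _).trans_lt ((Finset.sup_lt_iff (WithBot.bot_lt_coe _)).2 fun k hk => ?_)
  refine (degree_sum_le _ _).trans_lt ((Finset.sup_lt_iff (WithBot.bot_lt_coe _)).2 fun i hi => ?_)
  refine lt_of_le_of_lt degree_le_natDegree ?_
  have h2 : (C (r k i) * (X + C (k : ℚ)) ^ i * denErase n k).natDegree ≤ i + 3 * n := by
    refine natDegree_mul_le.trans ?_
    rw [natDegree_denErase hk]
    gcongr
    refine (natDegree_C_mul_le _ _).trans ?_
    rw [natDegree_pow, natDegree_X_add_C, mul_one]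
  simp only [Finset.mem_range] at hi
  exact_mod_cast (by omega : _ < 3 * (n + 1))

/-- After moving -k to the origin, `den n` and every `denErase n l` with l ≠ k are divisible by X^3,
so only the k-th polar part is visible modulo X^3. -/
lemma comp_partialFraction (n k : ℕ) (hk : k ∈ Finset.range (n + 1)) (q : ℚ[X])
    (r : ℕ → ℕ → ℚ) :
    ∃ W : ℚ[X], (q * den n + ∑ l ∈ Finset.range (n + 1), ∑ i ∈ Finset.range 3,
      C (r l i) * (X + C (l : ℚ)) ^ i * denErase n l).comp (X - C (k : ℚ)) =
      (∑ i ∈ Finset.range 3, C (r k i) * X ^ i) * (denErase n k).comp (X - C (k : ℚ)) +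
        X ^ 3 * W := by
  classical
  have hX : (X + C (k : ℚ)).comp (X - C (k : ℚ)) = X := by simp
  have hden : ∃ V : ℚ[X], (den n).comp (X - C (k : ℚ)) = X ^ 3 * V := by
    refine ⟨(denErase n k).comp (X - C (k : ℚ)), ?_⟩
    rw [den, ← Finset.mul_prod_erase _ _ hk, mul_pow, mul_comp, pow_comp, hX, denErase]
  have hE : ∀ l ∈ (Finset.range (n + 1)).erase k, ∃ V : ℚ[X],
      (denErase n l).comp (X - C (k : ℚ)) = X ^ 3 * V := by
    intro l hl
    have hkl : k ∈ (Finset.range (n + 1)).erase l :=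
      Finset.mem_erase.2 ⟨(Finset.mem_erase.1 hl).1.symm, hk⟩
    rw [denErase, ← Finset.mul_prod_erase _ _ hkl, mul_pow, mul_comp, pow_comp, hX]
    exact ⟨_, rfl⟩
  obtain ⟨V, hV⟩ := hden
  choose! U hU using hE
  refine ⟨q.comp (X - C (k : ℚ)) * V + ∑ l ∈ (Finset.range (n + 1)).erase k,
    ∑ i ∈ Finset.range 3, (C (r l i) * (X + C (l : ℚ)) ^ i).comp (X - C (k : ℚ)) * U l, ?_⟩
  rw [add_comp, mul_comp, hV, Polynomial.sum_comp, ← Finset.add_sum_erase _ _ hk,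
    Polynomial.sum_comp, Finset.sum_mul, mul_add, Finset.mul_sum]
  have h1 : ∀ i, (C (r k i) * (X + C (k : ℚ)) ^ i * denErase n k).comp (X - C (k : ℚ)) =
      C (r k i) * X ^ i * (denErase n k).comp (X - C (k : ℚ)) := fun i => by
    rw [mul_comp, mul_comp, pow_comp, hX, C_comp]
  have h2 : ∀ l ∈ (Finset.range (n + 1)).erase k,
      (∑ i ∈ Finset.range 3, C (r l i) * (X + C (l : ℚ)) ^ i * denErase n l).comp
        (X - C (k : ℚ)) = X ^ 3 * ∑ i ∈ Finset.range 3,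
          (C (r l i) * (X + C (l : ℚ)) ^ i).comp (X - C (k : ℚ)) * U l := fun l hl => by
    rw [Polynomial.sum_comp, Finset.mul_sum]
    refine Finset.sum_congr rfl fun i _ => ?_
    rw [mul_comp, hU l hl]
    ring
  rw [Finset.sum_congr rfl h2]
  simp only [h1]
  ring

/-- This identifies the abstract decomposition with `B` and `laurentCoeff`; it also turns an
explicit decomposition for small n into the initial values. -/
lemma partialFraction_unique {n : ℕ} {q : ℚ[X]} {r : ℕ → ℕ → ℚ}
    (h : num n = q * den n + ∑ k ∈ Finset.range (n + 1), ∑ i ∈ Finset.range 3,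
      C (r k i) * (X + C (k : ℚ)) ^ i * denErase n k) :
    B n = q ∧ ∀ k ∈ Finset.range (n + 1), ∀ i < 3, laurentCoeff n k i = r k i := by
  constructor
  · exact (div_modByMonic_unique q (∑ k ∈ Finset.range (n + 1), ∑ i ∈ Finset.range 3,
        C (r k i) * (X + C (k : ℚ)) ^ i * denErase n k) (den_monic n)
      ⟨by rw [h, mul_comm q, add_comm], degree_polar_lt n r⟩).1
  · intro k hk i hi
    obtain ⟨W, hW⟩ := comp_partialFraction n k hk q r
    rw [← h] at hW
    exact laurentCoeff_eq (r k) W hW hi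

theorem num_eq (n : ℕ) :
    num n = B n * den n + ∑ k ∈ Finset.range (n + 1), ∑ i ∈ Finset.range 3,
      C (laurentCoeff n k i) * (X + C (k : ℚ)) ^ i * denErase n k := by
  classical
  obtain ⟨q, r, h⟩ : ∃ (q : ℚ[X]) (r : ℕ → ℕ → ℚ), num n = q * den n +
      ∑ k ∈ Finset.range (n + 1), ∑ i ∈ Finset.range 3,
        C (r k i) * (X + C (k : ℚ)) ^ i * denErase n k := by
    obtain ⟨q, r, h⟩ := exists_partialFraction (num n) (n + 1) 3
    exact ⟨q, r, by simpa only [den, denErase] using h⟩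
  obtain ⟨hB, hr⟩ := partialFraction_unique h
  rw [hB]
  conv_lhs => rw [h]
  congr 1
  refine Finset.sum_congr rfl fun k hk => Finset.sum_congr rfl fun i hi => ?_
  rw [hr k hk i (Finset.mem_range.1 hi)]

/-- The coefficients of the partial-fraction decomposition of `R n`, with `s + 1` the order of the
pole. -/
def pfCoeff (n k s : ℕ) : ℝ :=
  if k ≤ n ∧ s < 3 then (laurentCoeff n k (2 - s) : ℝ) else 0

theorem hasPF_R (n : ℕ) : HasPF (R n) (n + 1) (pfCoeff n) ((B n).map (algebraMap ℚ ℝ)) where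
  zero k s hk := if_neg (by omega)
  eq t ht := by
    have hd := prod_add_ne_zero ht
    have hden : aeval t (den n) ≠ 0 := by rw [aeval_den]; exact pow_ne_zero _ hd
    have hn := congrArg (aeval t) (num_eq n)
    rw [R, hn]
    simp only [map_add, map_mul, map_sum, map_pow, aeval_X, aeval_C, add_div]
    rw [mul_div_cancel_right₀ _ hden, Finset.sum_div, eval_map_algebraMap]
    congr 1
    refine Finset.sum_congr rfl fun k hk => ?_
    have hE : aeval t (den n) = (t + k) ^ 3 * aeval t (denErase n k) := by
      rw [den, ← Finset.mul_prod_erase _ _ hk, denErase]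
      simp [mul_pow]
    have hE0 : aeval t (denErase n k) ≠ 0 := right_ne_zero_of_mul (hE ▸ hden)
    have h1 := ht k (Finset.mem_range.1 hk)
    have hk' : k ≤ n := by simp only [Finset.mem_range] at hk; omega
    rw [hE]
    simp only [Finset.sum_range_succ, Finset.sum_range_zero, pfCoeff, hk', true_and]
    norm_num
    field_simp
    ring

end
end WellPoised

namespace WellPoised
noncomputable section

/-! ### The partial fractions of the certificate and the recurrence relation of `a` -/

/-- Evaluation at t carries the polynomial `certPoly (C m) X` to `certPoly m t`, so the certificate
is a rational function of t to which partial fractions apply. -/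
lemma map_certPoly {K L : Type*} [CommRing K] [CommRing L] (f : K →+* L) (m t : K) :
    f (certPoly m t) = certPoly (f m) (f t) := by
  simp only [certPoly, map_add, map_sub, map_neg, map_mul, map_pow, map_ofNat]

/-- The poles at -(m+1) and -(m+2) may have order five, which is why `HasPF` allows five orders. At
0, ..., -m the denominator of `base` is only cubed, hence the extra squared product in the numerator
below. -/
theorem exists_hasPF_cert (m : ℕ) : ∃ α P, HasPF (cert m) (m + 3) α P := by
  refine hasPF_of_polynomial (C ((-1) ^ (m + 1) / (2 * m.factorial) / ((m + 1) * (m + 2)) : ℝ) *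
    ((∏ i ∈ Finset.range m, (X - C (i + 1 : ℝ))) *
      ∏ i ∈ Finset.range m, (X + C (m + 1 + i : ℝ))) ^ 2 *
    ((X - C (m + 1 : ℝ)) ^ 2 * certPoly (C (m : ℝ)) X) *
    (∏ i ∈ Finset.range (m + 1), (X + C (i : ℝ))) ^ 2) fun t ht => ?_
  have e := map_certPoly (Polynomial.evalRingHom t) (C (m : ℝ)) X
  simp only [coe_evalRingHom, eval_C, eval_X] at e
  simp only [eval_mul, eval_pow, eval_prod, eval_sub, eval_add, eval_C, eval_X, e]
  have hd : ∏ i ∈ Finset.range (m + 1), (t + (i : ℝ)) ≠ 0 :=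
    prod_add_ne_zero fun j hj => ht j (by omega)
  have h1 : t + m + 1 ≠ 0 := by
    have := ht (m + 1) (by omega); push_cast at this; rwa [← add_assoc] at this
  have h2 : t + m + 2 ≠ 0 := by
    have := ht (m + 2) (by omega); push_cast at this; rwa [← add_assoc] at this
  have e2 : ∏ i ∈ Finset.range m, (t + (m + 1 + i : ℝ)) = ∏ i ∈ Finset.range m, (t + m + 1 + i) :=
    Finset.prod_congr rfl fun i _ => by ring
  rw [cert, base, Finset.prod_range_succ _ (m + 2), Finset.prod_range_succ _ (m + 1), e2]
  have m1 : (m : ℝ) + 1 ≠ 0 := by positivity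
  have m2 : (m : ℝ) + 2 ≠ 0 := by positivity
  have hf : (m.factorial : ℝ) ≠ 0 := by positivity
  push_cast
  have h1' : t + (m + 1 : ℝ) ≠ 0 := by rwa [← add_assoc]
  have h2' : t + (m + 2 : ℝ) ≠ 0 := by rwa [← add_assoc]
  rw [add_assoc t (m : ℝ) 1, add_assoc t (m : ℝ) 2, sub_sub]
  generalize ∏ i ∈ Finset.range m, (t - (i + 1 : ℝ)) = x at *
  generalize ∏ i ∈ Finset.range m, (t + (m + 1 : ℝ) + i) = y at *
  generalize ∏ i ∈ Finset.range (m + 1), (t + (i : ℝ)) = d at *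
  generalize t + (m + 1 : ℝ) = w at *
  generalize t + (m + 2 : ℝ) = w' at *
  generalize t - (m + 1 : ℝ) = z at *
  generalize certPoly (m : ℝ) t = v at *
  field_simp

/-- Consecutive terms cancel, and the partial sum up to n is (-1)^n α_n. This is the image, on
coefficients, of the telescoping S(t) + S(t+1). -/
lemma sum_altern_shift (N : ℕ) (α : ℕ → ℝ) (hα : α N = 0) :
    ∑ k ∈ Finset.range (N + 1), (-1 : ℝ) ^ k * (α k + if k = 0 then 0 else α (k - 1)) = 0 := by
  have : ∀ n, ∑ k ∈ Finset.range (n + 1), (-1 : ℝ) ^ k * (α k + if k = 0 then 0 else α (k - 1)) =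
      (-1) ^ n * α n := by
    intro n
    induction n with
    | zero => simp
    | succ n ih => rw [Finset.sum_range_succ, ih]; simp [pow_succ]; ring
  rw [this, hα, mul_zero]

lemma pfCoeff_eq_zero {n k : ℕ} (s : ℕ) (h : n < k) : pfCoeff n k s = 0 := if_neg (by omega)

lemma a_eq_sum (n M : ℕ) (h : n + 1 ≤ M) :
    (a n : ℝ) = -∑ k ∈ Finset.range M, (-1) ^ k * pfCoeff n k 1 := by
  rw [← Finset.sum_subset (Finset.range_subset_range.2 h), a]
  · push_cast
    congr 1
    refine Finset.sum_congr rfl fun k hk => ?_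
    simp only [Finset.mem_range] at hk
    rw [pfCoeff, if_pos ⟨by omega, by omega⟩, A']
  · intro k _ hk
    simp only [Finset.mem_range, not_lt] at hk
    rw [pfCoeff_eq_zero 1 (by omega), mul_zero]

/-- By uniqueness of partial fractions, the telescoping relation holds between the coefficients of
1/(t+k)^2 (index `s = 1`), and `a` is minus their alternating sum. -/
theorem rec_a (m : ℕ) :
    rec0 m * a m + rec1 m * a (m + 1) + rec2 m * a (m + 2) + rec3 m * a (m + 3) = 0 := by
  obtain ⟨α, P, h⟩ := exists_hasPF_cert m
  have hl := ((((hasPF_R m).mono (show m + 1 ≤ m + 4 by omega)).const_mul (rec0 m)).add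
    (((hasPF_R (m + 1)).mono (show m + 1 + 1 ≤ m + 4 by omega)).const_mul (rec1 m))).add
    (((hasPF_R (m + 2)).mono (show m + 2 + 1 ≤ m + 4 by omega)).const_mul (rec2 m)) |>.add
    ((hasPF_R (m + 3)).const_mul (rec3 m))
  have hr := (h.mono (Nat.le_succ _)).add h.shift
  have key := fun k => hl.unique hr (fun t ht => telescoping m ht) k 1 (by norm_num)
  have h0 := sum_altern_shift (m + 3) (fun k => α k 1) (h.zero _ _ le_rfl)
  rw [← Finset.sum_congr rfl fun k _ => congrArg (fun x => (-1 : ℝ) ^ k * x) (key k)] at h0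
  rw [a_eq_sum m (m + 4) (by omega), a_eq_sum (m + 1) (m + 4) (by omega),
    a_eq_sum (m + 2) (m + 4) (by omega), a_eq_sum (m + 3) (m + 4) (by omega), ← neg_eq_zero,
    ← h0]
  simp only [mul_add, Finset.sum_add_distrib, Finset.mul_sum, mul_neg]
  simp only [mul_left_comm ((-1 : ℝ) ^ _)]
  ring

lemma satisfiesRecurrence_of_rec {K : Type*} [Field K] [CharZero K] {u : ℕ → K}
    (f : K →+* ℝ) (h : ∀ m : ℕ, rec0 m * f (u m) + rec1 m * f (u (m + 1)) + rec2 m * f (u (m + 2)) +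
      rec3 m * f (u (m + 3)) = 0) : SatisfiesRecurrence u := by
  intro n hn
  obtain ⟨m, rfl⟩ := Nat.exists_eq_add_of_le' hn
  refine f.injective ?_
  have := h m
  simp only [rec0, rec1, rec2, rec3] at this
  simp only [map_add, map_sub, map_mul, map_pow, map_ofNat, map_natCast, map_one, map_zero,
    show m + 2 - 1 = m + 1 by omega, show m + 2 - 2 = m by omega, Nat.cast_add, Nat.cast_ofNat]
  rw [← this]
  ring_nf

/-! ### The well-poised symmetry -/

lemma prod_range_eq_neg (n : ℕ) {f g : ℕ → ℝ} (h : ∀ i ∈ Finset.range n, f i = -g i) :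
    ∏ i ∈ Finset.range n, f i = (-1) ^ n * ∏ i ∈ Finset.range n, g i := by
  rw [Finset.prod_congr rfl h, Finset.prod_neg, Finset.card_range]

lemma R_reflect (n : ℕ) (t : ℝ) : R n (-n - t) = (-1) ^ n * R n t := by
  have h1 : (∏ i ∈ Finset.range n, (-n - t - (i + 1 : ℝ))) =
      (-1) ^ n * ∏ i ∈ Finset.range n, (t + n + 1 + i) :=
    prod_range_eq_neg n fun i _ => by ring
  have h2 : (∏ i ∈ Finset.range n, (-n - t + n + 1 + (i : ℝ))) =
      (-1) ^ n * ∏ i ∈ Finset.range n, (t - (i + 1 : ℝ)) :=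
    prod_range_eq_neg n fun i _ => by ring
  have h3 : (∏ i ∈ Finset.range (n + 1), (-n - t + (i : ℝ))) =
      (-1) ^ (n + 1) * ∏ i ∈ Finset.range (n + 1), (t + (i : ℝ)) := by
    rw [← Finset.prod_range_reflect (fun i : ℕ => t + (i : ℝ))]
    refine prod_range_eq_neg (n + 1) fun i hi => ?_
    have hi' : i ≤ n := by simp only [Finset.mem_range] at hi; omega
    rw [show n + 1 - 1 - i = n - i by omega, Nat.cast_sub hi']
    ring
  rw [R, R, aeval_num, aeval_num, aeval_den, aeval_den, h1, h2, h3]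
  have hs : ((-1 : ℝ) ^ n) ^ 2 = 1 := by rw [← pow_mul, mul_comm, pow_mul]; simp
  have hs3 : ((-1 : ℝ) ^ (n + 1)) ^ 3 = (-1) ^ (n + 1) := by
    rw [← pow_mul, mul_comm, pow_mul]; norm_num
  rw [mul_pow ((-1 : ℝ) ^ (n + 1)), hs3, mul_pow, mul_pow, mul_pow, mul_pow, hs, div_mul_eq_div_div]
  rw [show ∀ x : ℝ, x / (-1) ^ (n + 1) = x * (-1) ^ (n + 1) from fun x => by
    rcases neg_one_pow_eq_or ℝ (n + 1) with h | h <;> rw [h] <;> ring]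
  rw [pow_succ (-1 : ℝ) n]
  ring

/-- The reflection t ↦ -n-t exchanges the poles -k and -(n-k) and multiplies 1/(t+k)^(s+1) by
(-1)^(s+1); the claim is uniqueness of partial fractions for the two resulting expansions of (-1)^n
R_n. -/
lemma pfCoeff_reflect {n k s : ℕ} (hk : k ≤ n) (hs : s < 5) :
    pfCoeff n (n - k) s = (-1) ^ (n + s + 1) * pfCoeff n k s := by
  have h1 := (hasPF_R n).const_mul ((-1) ^ n)
  have h2 : HasPF (fun t => (-1) ^ n * R n t) (n + 1)
      (fun k s => if k ≤ n then (-1) ^ (s + 1) * pfCoeff n (n - k) s else 0)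
      (((B n).map (algebraMap ℚ ℝ)).comp (-C (n : ℝ) - X)) := by
    refine ⟨fun k s hk => if_neg (by omega), fun t ht => ?_⟩
    rw [← R_reflect, (hasPF_R n).eq]
    · congr 1
      · simp
      · rw [← Finset.sum_range_reflect]
        refine Finset.sum_congr rfl fun k hk => Finset.sum_congr rfl fun s _ => ?_
        have hk' : k ≤ n := by simp only [Finset.mem_range] at hk; omega
        rw [if_pos hk', show n + 1 - 1 - k = n - k by omega, Nat.cast_sub hk',
          show -(n : ℝ) - t + (n - k) = (-1) * (t + k) by ring, mul_pow, div_mul_eq_div_div]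
        congr 1
        rcases neg_one_pow_eq_or ℝ (s + 1) with h | h <;> rw [h] <;> ring
    · intro j hj h0
      have := ht (n - j) (by omega)
      rw [Nat.cast_sub (by omega)] at this
      exact this (by linarith)
  have := h2.unique h1 (fun _ _ => rfl) k s hs
  rw [if_pos hk] at this
  calc pfCoeff n (n - k) s = (-1) ^ (s + 1) * ((-1) ^ (s + 1) * pfCoeff n (n - k) s) := by
        rw [← mul_assoc, ← pow_add, ← two_mul, pow_mul]; simp
    _ = _ := by rw [this]; ring

/-- Replacing k by n-k changes the sign of the sum when s is even, that is, for poles of odd order.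
This removes Li_1(-1) and Li_3(-1) from `r`, and Li_2(-1) and Li_4(-1) from `rt`. -/
theorem sum_altern_pfCoeff_eq_zero (n : ℕ) {s : ℕ} (hs : s < 5) (hs' : Even s) :
    ∑ k ∈ Finset.range (n + 1), (-1 : ℝ) ^ k * pfCoeff n k s = 0 := by
  have h := Finset.sum_range_reflect (fun k => (-1 : ℝ) ^ k * pfCoeff n k s) (n + 1)
  have h' : ∑ k ∈ Finset.range (n + 1), (-1 : ℝ) ^ (n + 1 - 1 - k) * pfCoeff n (n + 1 - 1 - k) s =
      -∑ k ∈ Finset.range (n + 1), (-1 : ℝ) ^ k * pfCoeff n k s := by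
    rw [← Finset.sum_neg_distrib]
    refine Finset.sum_congr rfl fun k hk => ?_
    have hk' : k ≤ n := by simp only [Finset.mem_range] at hk; omega
    rw [show n + 1 - 1 - k = n - k by omega, pfCoeff_reflect hk' hs, ← mul_assoc, ← pow_add,
      ← neg_mul]
    congr 1
    rw [show n - k + (n + s + 1) = k + 2 * (n - k) + s + 1 by omega, pow_succ, pow_add, pow_add,
      pow_mul, hs'.neg_one_pow]
    simp
  rw [h'] at h
  linarith

end
end WellPoised

namespace WellPoised
noncomputable section

/-! ### Values of analytic continuations -/

section Continuation

open MeasureTheory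

variable {c d : ℝ → ℝ} {v w : ℝ}

lemma hasSum_of_eq {K : Type*} [AddCommMonoid K] [TopologicalSpace K] {f g : ℕ → K} {x y : K}
    (h : HasSum f x) (hf : ∀ ν, g ν = f ν)
    (hxy : y = x) : HasSum g y := by
  rwa [hxy, funext hf]

lemma HasContinuedValue.congr (h : HasContinuedValue c v)
    (hcd : ∀ ν : ℕ, d ((ν : ℝ) + 1) = c ((ν : ℝ) + 1)) : HasContinuedValue d v := by
  obtain ⟨F, h1, h2, h3⟩ := h
  exact ⟨F, h1, fun z hz => by simpa only [hcd] using h2 z hz, h3⟩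

lemma HasContinuedValue.add (h : HasContinuedValue c v) (h' : HasContinuedValue d w) :
    HasContinuedValue (fun t => c t + d t) (v + w) := by
  obtain ⟨F, h1, h2, h3⟩ := h
  obtain ⟨G, h1', h2', h3'⟩ := h'
  refine ⟨fun z => F z + G z, h1.add h1', fun z hz => ?_, by simp [h3, h3']⟩
  exact hasSum_of_eq ((h2 z hz).add (h2' z hz)) (fun ν => by push_cast; ring) rfl

lemma HasContinuedValue.const_mul (a : ℝ) (h : HasContinuedValue c v) :
    HasContinuedValue (fun t => a * c t) (a * v) := by
  obtain ⟨F, h1, h2, h3⟩ := h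
  refine ⟨fun z => a * F z, analyticOnNhd_const.mul h1, fun z hz => ?_, by simp [h3]⟩
  exact hasSum_of_eq ((h2 z hz).mul_left (a : ℂ)) (fun ν => by push_cast; ring) rfl

lemma hasContinuedValue_zero : HasContinuedValue (fun _ => 0) 0 :=
  ⟨fun _ => 0, analyticOnNhd_const, fun z _ => by simp, by simp⟩

lemma HasContinuedValue.sum {ι : Type*} (s : Finset ι) {c : ι → ℝ → ℝ} {v : ι → ℝ}
    (h : ∀ i ∈ s, HasContinuedValue (c i) (v i)) :
    HasContinuedValue (fun t => ∑ i ∈ s, c i t) (∑ i ∈ s, v i) := by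
  classical
  induction s using Finset.induction_on with
  | empty => simpa using hasContinuedValue_zero
  | insert i s hi ih =>
    simp only [Finset.sum_insert hi]
    exact (h i (by simp)).add (ih fun j hj => h j (by simp [hj]))

lemma one_sub_ne_zero_of_mem {z : ℂ} (hz : z ∈ Metric.closedBall (0 : ℂ) 1 \ {1}) :
    1 - z ≠ 0 := fun h => hz.2 (sub_eq_zero.1 h).symm

/-- Summation: the continuation of `∑ c(ν) z^ν` from that of the differences of `c`. -/
lemma HasContinuedValue.of_fwdDiff
    (hs : ∀ z : ℂ, ‖z‖ < 1 → Summable fun ν : ℕ => (c ((ν : ℝ) + 1) : ℂ) * z ^ (ν + 1))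
    (h : HasContinuedValue (fun t => c (t + 1) - c t) v) :
    HasContinuedValue c (-(v + c 1) / 2) := by
  obtain ⟨G, h1, h2, h3⟩ := h
  -- If G is the series of the differences, then comparing coefficients gives (1 - z) F(z) = z (G(z)
  -- + c(1)).
  refine ⟨fun z => z * (G z + c 1) / (1 - z), fun z hz => ?_, fun z hz => ?_, ?_⟩
  · exact ((analyticAt_id.mul ((h1 z hz).add analyticAt_const)).div
      (analyticAt_const.sub analyticAt_id) (one_sub_ne_zero_of_mem hz))
  · have hS := hs z hz
    have h4 := (h2 z hz).mul_left z
    have h5 : HasSum (fun ν : ℕ => (c ((ν : ℝ) + 1 + 1) : ℂ) * z ^ (ν + 1 + 1))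
        ((∑' ν : ℕ, (c ((ν : ℝ) + 1) : ℂ) * z ^ (ν + 1)) - c 1 * z) := by
      have := (hasSum_nat_add_iff' (f := fun ν : ℕ => (c ((ν : ℝ) + 1) : ℂ) * z ^ (ν + 1)) 1).2
        hS.hasSum
      simpa using this
    have h6 := h5.sub (hS.hasSum.mul_left z)
    have h7 := h4.unique (hasSum_of_eq h6 (fun ν => by push_cast; ring) rfl)
    have hz1 : 1 - z ≠ 0 := by
      intro h0
      rw [sub_eq_zero] at h0
      rw [← h0] at hz
      simp at hz
    refine hasSum_of_eq hS.hasSum (fun _ => rfl) ?_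
    rw [div_eq_iff hz1]
    linear_combination h7
  · simp only [h3]; push_cast; ring

/-! ### The polynomial part of the series. -/

lemma summable_polynomial_mul_pow (P : ℝ[X]) {z : ℂ} (hz : ‖z‖ < 1) :
    Summable fun ν : ℕ => ((P.eval ((ν : ℝ) + 1) : ℝ) : ℂ) * z ^ (ν + 1) := by
  have h : Summable fun ν : ℕ => ((P.eval (ν : ℝ) : ℝ) : ℂ) * z ^ ν := by
    have : ∀ ν : ℕ, ((P.eval (ν : ℝ) : ℝ) : ℂ) * z ^ ν =
        ∑ i ∈ Finset.range (P.natDegree + 1), (P.coeff i : ℂ) * ((ν : ℂ) ^ i * z ^ ν) := by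
      intro ν
      rw [eval_eq_sum_range]
      push_cast
      rw [Finset.sum_mul]
      exact Finset.sum_congr rfl fun i _ => by ring
    simp only [this]
    exact summable_sum fun i _ => (summable_pow_mul_geometric_of_norm_lt_one i hz).mul_left _
  simpa using (summable_nat_add_iff 1).2 h

lemma hasContinuedValue_polynomial_aux (d : ℕ) : ∀ P : ℝ[X],
    (fwdDiff (1 : ℝ))^[d] (fun t => P.eval t) = 0 →
    HasContinuedValue (fun t => P.eval t) (∑ j ∈ Finset.range d,
      ((fwdDiff (1 : ℝ))^[j] (fun t => P.eval t)) 1 * (-1 / 2) ^ (j + 1)) := by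
  induction d with
  | zero =>
    intro P hP
    simp only [Function.iterate_zero, id] at hP
    have : ∀ t, P.eval t = 0 := fun t => congrFun hP t
    simpa [this] using hasContinuedValue_zero
  | succ d ih =>
    intro P hP
    have e : (fwdDiff (1 : ℝ) fun t => P.eval t) = fun t => (P.comp (X + 1) - P).eval t := by
      funext t
      simp [fwdDiff]
    have h := ih (P.comp (X + 1) - P) (by rw [← e, ← Function.iterate_succ_apply]; exact hP)
    have h' := HasContinuedValue.of_fwdDiff (c := fun t => P.eval t)
      (fun z hz => summable_polynomial_mul_pow P hz)
      (h.congr fun ν => by simp)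
    convert h' using 1
    rw [Finset.sum_range_succ']
    simp only [Function.iterate_succ_apply, e, Function.iterate_zero, id, pow_succ]
    rw [neg_add, add_div, ← Finset.sum_neg_distrib, Finset.sum_div]
    congr 1
    · exact Finset.sum_congr rfl fun i _ => by ring
    · ring

lemma hasContinuedValue_polynomial (P : ℝ[X]) :
    HasContinuedValue (fun t => P.eval t) (∑ j ∈ Finset.range (P.natDegree + 1),
      ((fwdDiff (1 : ℝ))^[j] (fun t => P.eval t)) 1 * (-1 / 2) ^ (j + 1)) :=
  hasContinuedValue_polynomial_aux _ P P.fwdDiff_iter_degree_add_one_eq_zero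

lemma hasContinuedValue_polySum (P : ℚ[X]) :
    HasContinuedValue (fun t => (P.map (algebraMap ℚ ℝ)).eval t) (polySum P) := by
  convert hasContinuedValue_polynomial (P.map (algebraMap ℚ ℝ)) using 1
  rw [natDegree_map, polySum]
  push_cast
  refine Finset.sum_congr rfl fun j _ => ?_
  congr 1
  rw [fwdDiff_iter_eq_sum_shift, fwdDiff_iter_eq_sum_shift]
  push_cast
  refine Finset.sum_congr rfl fun i _ => ?_
  simp only [zsmul_eq_mul, nsmul_eq_mul, mul_one, Rat.cast_mul, eval_map_algebraMap]
  push_cast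
  congr 1
  rw [show (1 + (i : ℝ)) = algebraMap ℚ ℝ (1 + (i : ℚ)) by simp, aeval_algebraMap_apply]
  simp

/-- A lower bound for the denominator of the Cauchy-type kernel `z / (1 - z x)`, `0 ≤ x ≤ 1`. -/
lemma exists_kernel_lower_bound {z₀ : ℂ} (hz : z₀ ∈ Metric.closedBall (0 : ℂ) 1 \ {1}) :
    ∃ δ > 0, ∀ z ∈ Metric.ball z₀ δ, ∀ x ∈ Set.Icc (0 : ℝ) 1, δ ≤ ‖1 - z * x‖ := by
  obtain ⟨x₀, hx₀, hmin⟩ := (isCompact_Icc (a := (0 : ℝ)) (b := 1)).exists_isMinOn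
    (Set.nonempty_Icc.2 zero_le_one)
    (f := fun x : ℝ => ‖1 - z₀ * x‖) (by fun_prop)
  have hpos : 0 < ‖1 - z₀ * x₀‖ := by
    rw [norm_pos_iff]
    intro h0
    have h1 : z₀ * x₀ = 1 := (sub_eq_zero.1 h0).symm
    have h2 : ‖z₀‖ * x₀ = 1 := by
      have := congrArg norm h1
      rwa [norm_mul, Complex.norm_real, Real.norm_of_nonneg hx₀.1, norm_one] at this
    have h3 : ‖z₀‖ ≤ 1 := by simpa using hz.1
    have h4 : x₀ = 1 := by nlinarith [hx₀.1, hx₀.2, norm_nonneg z₀]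
    rw [h4] at h1
    exact hz.2 (by simpa using h1)
  refine ⟨‖1 - z₀ * x₀‖ / 2, by positivity, fun z hz' x hx => ?_⟩
  have h1 : ‖1 - z₀ * x₀‖ ≤ ‖1 - z₀ * x‖ := hmin hx
  have h2 : ‖1 - z₀ * x‖ ≤ ‖1 - z * x‖ + ‖(z - z₀) * x‖ := by
    refine le_trans (le_of_eq ?_) (norm_add_le _ _)
    congr 1; ring
  have h3 : ‖(z - z₀) * x‖ ≤ ‖1 - z₀ * x₀‖ / 2 := by
    rw [norm_mul, Complex.norm_real, Real.norm_of_nonneg hx.1]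
    rw [Metric.mem_ball, dist_eq_norm] at hz'
    nlinarith [hx.2, norm_nonneg (z - z₀)]
  linarith

/-! ### Cauchy-type integrals and the polar terms. -/

variable {α : Type*} [MeasurableSpace α] {μ : Measure α} {f b : α → ℝ}

/-- The exponent is left free so that one statement covers the kernel z/(1 - zb) and its
z-derivative 1/(1 - zb)^2. -/
lemma integrable_kernel (hf : Integrable f μ) (hb : Measurable b)
    {δ : ℝ} (hδ : 0 < δ) {z : ℂ} (h : ∀ᵐ u ∂μ, δ ≤ ‖1 - z * b u‖) (a : ℂ) (n : ℕ) :
    Integrable (fun u => (f u : ℂ) * (a / (1 - z * b u) ^ n)) μ := by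
  refine (hf.ofReal (𝕜 := ℂ)).mul_bdd (c := ‖a‖ / δ ^ n) ?_ ?_
  · exact (by fun_prop : Measurable fun u => a / (1 - z * b u) ^ n).aestronglyMeasurable
  · filter_upwards [h] with u hu
    rw [norm_div, norm_pow]
    gcongr

/-- On a small ball the kernel and its derivative are bounded uniformly in u, so differentiation
under the integral is dominated, and complex differentiability on the ball gives analyticity. -/
lemma analyticAt_integral_kernel (hf : Integrable f μ) (hb : Measurable b)
    (hb01 : ∀ᵐ u ∂μ, b u ∈ Set.Icc (0 : ℝ) 1) {z₀ : ℂ}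
    (hz : z₀ ∈ Metric.closedBall (0 : ℂ) 1 \ {1}) :
    AnalyticAt ℂ (fun z : ℂ => ∫ u, (f u : ℂ) * (z / (1 - z * b u) ^ 1) ∂μ) z₀ := by
  obtain ⟨δ, hδ, hlow⟩ := exists_kernel_lower_bound hz
  refine DifferentiableOn.analyticAt (s := Metric.ball z₀ δ) (fun z hz' => ?_)
    (Metric.ball_mem_nhds _ hδ)
  have hl : ∀ z ∈ Metric.ball z₀ δ, ∀ᵐ u ∂μ, δ ≤ ‖1 - z * b u‖ := fun z hz => by
    filter_upwards [hb01] with u hu using hlow z hz _ hu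
  have hnhds : Metric.ball z₀ δ ∈ 𝓝 z := Metric.isOpen_ball.mem_nhds hz'
  refine (hasDerivAt_integral_of_dominated_loc_of_deriv_le (s := Metric.ball z₀ δ)
    (F' := fun z u => (f u : ℂ) * (1 / (1 - z * b u) ^ 2)) (bound := fun u => |f u| * (1 / δ ^ 2))
    hnhds ?_ (integrable_kernel hf hb hδ (hl z hz') z 1)
    (integrable_kernel hf hb hδ (hl z hz') 1 2).aestronglyMeasurable ?_
    (hf.abs.mul_const _) ?_).2.differentiableAt.differentiableWithinAt
  · filter_upwards [hnhds] with y hy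
    exact (integrable_kernel hf hb hδ (hl y hy) y 1).aestronglyMeasurable
  · filter_upwards [hb01] with u hu y hy
    rw [norm_mul, norm_div, norm_pow, norm_one, Complex.norm_real, Real.norm_eq_abs]
    have := hlow y hy _ hu
    gcongr
  · filter_upwards [hb01] with u hu y hy
    have h0 : 1 - y * b u ≠ 0 := norm_pos_iff.1 (hδ.trans_le (hlow y hy _ hu))
    have h1 : HasDerivAt (fun y : ℂ => y / (1 - y * b u) ^ 1)
        ((1 * (1 - y * b u) - y * (-(b u : ℂ))) / (1 - y * b u) ^ 2) y := by
      simp only [pow_one]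
      refine (hasDerivAt_id y).div ?_ h0
      simpa using ((hasDerivAt_id y).mul_const (b u : ℂ)).const_sub 1
    have h2 := h1.const_mul (f u : ℂ)
    rwa [show 1 * (1 - y * b u) - y * (-(b u : ℂ)) = 1 by ring] at h2

lemma hasSum_integral_kernel (hf : Integrable f μ) (hb : Measurable b)
    (hb01 : ∀ᵐ u ∂μ, b u ∈ Set.Icc (0 : ℝ) 1) {z : ℂ} (hz : ‖z‖ < 1) :
    HasSum (fun ν : ℕ => ((∫ u, f u * b u ^ ν ∂μ : ℝ) : ℂ) * z ^ (ν + 1))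
      (∫ u, (f u : ℂ) * (z / (1 - z * b u) ^ 1) ∂μ) := by
  have hint : ∀ ν : ℕ, Integrable (fun u => f u * b u ^ ν) μ := fun ν => by
    refine hf.mul_bdd (c := 1) (hb.pow_const ν).aestronglyMeasurable ?_
    filter_upwards [hb01] with u hu
    rw [norm_pow, Real.norm_of_nonneg hu.1]
    exact pow_le_one₀ hu.1 hu.2
  have hintc : ∀ ν : ℕ, Integrable (fun u => ((f u * b u ^ ν : ℝ) : ℂ) * z ^ (ν + 1)) μ :=
    fun ν => (hint ν).ofReal.mul_const _
  have hsum : Summable fun ν : ℕ => ∫ u, ‖((f u * b u ^ ν : ℝ) : ℂ) * z ^ (ν + 1)‖ ∂μ := by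
    refine Summable.of_nonneg_of_le (fun ν => integral_nonneg fun u => norm_nonneg _)
      (fun ν => ?_) (((summable_geometric_of_lt_one (norm_nonneg z) hz).mul_right ‖z‖).mul_left
        (∫ u, |f u| ∂μ))
    rw [← pow_succ, ← integral_mul_const]
    refine integral_mono_ae (hintc ν).norm (hf.abs.mul_const _) ?_
    filter_upwards [hb01] with u hu
    rw [norm_mul, norm_pow, Complex.norm_real, Real.norm_eq_abs, abs_mul, abs_pow,
      abs_of_nonneg hu.1]
    have : b u ^ ν ≤ 1 := pow_le_one₀ hu.1 hu.2
    have h2 := abs_nonneg (f u)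
    gcongr
    exact mul_le_of_le_one_right h2 this
  have h := hasSum_integral_of_summable_integral_norm hintc hsum
  refine hasSum_of_eq h (fun ν => ?_) ?_
  · rw [integral_mul_const, integral_complex_ofReal]
  · refine integral_congr_ae ?_
    filter_upwards [hb01] with u hu
    have hn : ‖z * b u‖ < 1 := by
      rw [norm_mul, Complex.norm_real, Real.norm_of_nonneg hu.1]
      nlinarith [hu.2, norm_nonneg z]
    have hg := ((hasSum_geometric_of_norm_lt_one hn).mul_left ((f u : ℂ) * z)).tsum_eq
    rw [pow_one, div_eq_mul_inv, ← mul_assoc, ← hg]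
    refine tsum_congr fun ν => ?_
    push_cast
    ring

/-- Coefficients that are moments of a function with values in [0, 1] sum, by the geometric series,
to an integral that is analytic wherever 1 - zx does not vanish for x in [0, 1]. -/
lemma hasContinuedValue_kernel (hf : Integrable f μ) (hb : Measurable b)
    (hb01 : ∀ᵐ u ∂μ, b u ∈ Set.Icc (0 : ℝ) 1)
    (hc : ∀ ν : ℕ, c ((ν : ℝ) + 1) = ∫ u, f u * b u ^ ν ∂μ) : ∃ v, HasContinuedValue c v := by
  refine ⟨∫ u, f u * (-1 / (1 + b u)) ∂μ, fun z => ∫ u, (f u : ℂ) * (z / (1 - z * b u) ^ 1) ∂μ,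
    fun z hz => analyticAt_integral_kernel hf hb hb01 hz, fun z hz => ?_, ?_⟩
  · simp only [hc]
    exact hasSum_integral_kernel hf hb hb01 hz
  · rw [← integral_complex_ofReal]
    refine integral_congr_ae (Eventually.of_forall fun u => ?_)
    push_cast
    ring

lemma integrableOn_pow_mul_exp (p : ℕ) {r : ℝ} (hr : 0 < r) :
    IntegrableOn (fun u : ℝ => u ^ p * Real.exp (-(r * u))) (Set.Ioi 0) := by
  have := integrableOn_rpow_mul_exp_neg_mul_rpow (p := 1) (s := p) (b := r)
    (by have : (0 : ℝ) ≤ p := by positivity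
        linarith) one_pos hr
  simpa using this

lemma integral_pow_mul_exp (p : ℕ) {r : ℝ} (hr : 0 < r) :
    ∫ u in Set.Ioi (0 : ℝ), u ^ p * Real.exp (-(r * u)) = p.factorial / r ^ (p + 1) := by
  have := Real.integral_rpow_mul_exp_neg_mul_Ioi (a := (p : ℝ) + 1) (by positivity) hr
  rw [Real.Gamma_nat_eq_factorial] at this
  simp only [add_sub_cancel_right, Real.rpow_natCast] at this
  rw [this, show (p : ℝ) + 1 = ((p + 1 : ℕ) : ℝ) by push_cast; ring, Real.rpow_natCast, one_div,
    inv_pow, inv_mul_eq_div]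

/-- The moments come from 1/(t+k)^(p+1) = (1/p!) ∫ u^p e^{-(t+k)u} du over u > 0, with b(u) =
e^{-u}. The case p = 0 is included, although its series at -1 does not converge absolutely. -/
lemma exists_hasContinuedValue_inv_pow (k p : ℕ) :
    ∃ v, HasContinuedValue (fun t => 1 / (t + k) ^ (p + 1)) v := by
  have hk : (0 : ℝ) < k + 1 := by positivity
  refine hasContinuedValue_kernel (μ := volume.restrict (Set.Ioi (0 : ℝ)))
    (f := fun u => u ^ p * Real.exp (-((k + 1 : ℝ) * u)) * (1 / p.factorial))
    (b := fun u => Real.exp (-u)) ((integrableOn_pow_mul_exp p hk).mul_const _)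
    (by fun_prop) ?_ ?_
  · filter_upwards [ae_restrict_mem measurableSet_Ioi] with u hu
    exact ⟨(Real.exp_pos _).le, Real.exp_le_one_iff.2 (by simpa using (le_of_lt hu))⟩
  · intro ν
    have hr : (0 : ℝ) < ν + 1 + k := by positivity
    have e : ∀ u : ℝ, u ^ p * Real.exp (-((k + 1 : ℝ) * u)) * (1 / p.factorial) *
        Real.exp (-u) ^ ν = u ^ p * Real.exp (-((ν + 1 + k : ℝ) * u)) * (1 / p.factorial) := by
      intro u
      rw [← Real.exp_nat_mul, mul_right_comm, mul_assoc (u ^ p), ← Real.exp_add]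
      ring_nf
    simp only [e]
    rw [integral_mul_const, integral_pow_mul_exp p hr]
    have : (p.factorial : ℝ) ≠ 0 := by positivity
    field_simp

end Continuation

end
end WellPoised

namespace WellPoised
noncomputable section

/-! ### Abel values at `-1` -/

/-- The power series `∑_{ν ≥ 1} c(ν) x^ν` converges for `-1 < x < 0` and tends to `v` as `x` tends
to `-1`. -/
structure AbelValue (c : ℝ → ℝ) (v : ℝ) : Prop where
  summable : ∀ x ∈ Set.Ioo (-1 : ℝ) 0, Summable fun ν : ℕ => c ((ν : ℝ) + 1) * x ^ (ν + 1)
  tendsto : Tendsto (fun x : ℝ => ∑' ν : ℕ, c ((ν : ℝ) + 1) * x ^ (ν + 1)) (𝓝[>] (-1)) (𝓝 v)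

lemma Ioo_mem : Set.Ioo (-1 : ℝ) 0 ∈ 𝓝[>] (-1 : ℝ) := Ioo_mem_nhdsGT (by norm_num)

section

variable {c d : ℝ → ℝ} {v w : ℝ}

lemma HasContinuedValue.abelValue (h : HasContinuedValue c v) : AbelValue c v := by
  obtain ⟨F, h1, h2, h3⟩ := h
  have hs : ∀ x ∈ Set.Ioo (-1 : ℝ) 0,
      HasSum (fun ν : ℕ => c ((ν : ℝ) + 1) * x ^ (ν + 1)) (F x).re := by
    intro x hx
    have hx1 : ‖(x : ℂ)‖ < 1 := by
      rw [Complex.norm_real, Real.norm_eq_abs, abs_lt]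
      exact ⟨hx.1, hx.2.trans one_pos⟩
    have := Complex.hasSum_re (h2 x hx1)
    refine hasSum_of_eq this (fun ν => ?_) rfl
    norm_cast
  refine ⟨fun x hx => (hs x hx).summable, ?_⟩
  have hc : ContinuousAt F (((-1 : ℝ) : ℝ) : ℂ) := by
    refine (h1 _ ⟨by simp, ?_⟩).continuousAt
    simp only [Set.mem_singleton_iff]
    norm_cast
  have hc' : ContinuousAt (fun x : ℝ => (F x).re) (-1) :=
    Complex.continuous_re.continuousAt.comp
      (ContinuousAt.comp (f := fun x : ℝ => (x : ℂ)) (g := F) hc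
        Complex.continuous_ofReal.continuousAt)
  have ht := hc'.tendsto.mono_left (nhdsWithin_le_nhds (s := Set.Ioi (-1 : ℝ)))
  have hv : (F ((-1 : ℝ) : ℂ)).re = v := by
    push_cast
    rw [h3, Complex.ofReal_re]
  rw [hv] at ht
  refine ht.congr' ?_
  filter_upwards [Ioo_mem] with x hx
  exact (hs x hx).tsum_eq.symm

lemma AbelValue.valueAtNegOne_eq (h : AbelValue c v) : valueAtNegOne c = v := h.tendsto.limUnder_eq

lemma AbelValue.unique (h : AbelValue c v) (h' : AbelValue c w) : v = w :=
  tendsto_nhds_unique h.tendsto h'.tendsto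

lemma AbelValue.congr (h : AbelValue c v) (hcd : ∀ ν : ℕ, d ((ν : ℝ) + 1) = c ((ν : ℝ) + 1)) :
    AbelValue d v :=
  ⟨by simpa only [hcd] using h.summable, by simpa only [hcd] using h.tendsto⟩

lemma AbelValue.add (h : AbelValue c v) (h' : AbelValue d w) :
    AbelValue (fun t => c t + d t) (v + w) := by
  refine ⟨fun x hx => ?_, (h.tendsto.add h'.tendsto).congr' ?_⟩
  · simpa only [add_mul] using (h.summable x hx).add (h'.summable x hx)
  · filter_upwards [Ioo_mem] with x hx
    simp only [add_mul]
    rw [(h.summable x hx).tsum_add (h'.summable x hx)]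

lemma AbelValue.const_mul (a : ℝ) (h : AbelValue c v) :
    AbelValue (fun t => a * c t) (a * v) := by
  refine ⟨fun x hx => ?_, (h.tendsto.const_mul a).congr fun x => ?_⟩
  · simpa only [mul_assoc] using (h.summable x hx).mul_left a
  · rw [← tsum_mul_left]
    simp only [mul_assoc]

/-- The shifted series is (F(x) - c(1) x)/x, evaluated at x = -1. Hence c(t) + c(t+1) has Abel value
-c(1), which makes telescoping work; staying on -1 < x < 0 avoids the removable singularity at 0. -/
lemma AbelValue.shift (h : AbelValue c v) : AbelValue (fun t => c (t + 1)) (-v - c 1) := by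
  have hs : ∀ x ∈ Set.Ioo (-1 : ℝ) 0, HasSum (fun ν : ℕ => c ((ν : ℝ) + 1 + 1) * x ^ (ν + 1))
      (((∑' ν : ℕ, c ((ν : ℝ) + 1) * x ^ (ν + 1)) - c 1 * x) / x) := by
    intro x hx
    have := (hasSum_nat_add_iff' (f := fun ν : ℕ => c ((ν : ℝ) + 1) * x ^ (ν + 1)) 1).2
      (h.summable x hx).hasSum
    have h2 := this.div_const x
    simp only [Finset.range_one, Finset.sum_singleton, Nat.cast_zero, zero_add, pow_one] at h2
    refine hasSum_of_eq h2 (fun ν => ?_) rfl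
    have hx0 := hx.2.ne
    push_cast
    rw [pow_succ x (ν + 1)]
    field_simp
  refine ⟨fun x hx => (hs x hx).summable, ?_⟩
  have hid : Tendsto (fun x : ℝ => x) (𝓝[>] (-1)) (𝓝 (-1)) := nhdsWithin_le_nhds
  have := (h.tendsto.sub (hid.const_mul (c 1))).div hid (by norm_num)
  rw [show (v - c 1 * -1) / -1 = -v - c 1 by ring] at this
  refine this.congr' ?_
  filter_upwards [Ioo_mem] with x hx
  exact (hs x hx).tsum_eq.symm

lemma AbelValue.of_summable (h : Summable fun ν : ℕ => |c ((ν : ℝ) + 1)|) :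
    AbelValue c (∑' ν : ℕ, c ((ν : ℝ) + 1) * (-1) ^ (ν + 1)) := by
  have hb : ∀ x ∈ Set.Ioo (-1 : ℝ) 0, ∀ ν : ℕ,
      ‖c ((ν : ℝ) + 1) * x ^ (ν + 1)‖ ≤ |c ((ν : ℝ) + 1)| := by
    intro x hx ν
    rw [norm_mul, norm_pow, Real.norm_eq_abs, Real.norm_eq_abs]
    refine mul_le_of_le_one_right (abs_nonneg _) (pow_le_one₀ (abs_nonneg _) ?_)
    rw [abs_le]
    exact ⟨hx.1.le, hx.2.le.trans zero_le_one⟩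
  refine ⟨fun x hx => Summable.of_norm_bounded h (hb x hx), ?_⟩
  refine tendsto_tsum_of_dominated_convergence h (fun ν => ?_) ?_
  · exact ((continuous_const.mul (continuous_id.pow (ν + 1))).tendsto (-1 : ℝ)).mono_left
      nhdsWithin_le_nhds
  · filter_upwards [Ioo_mem] with x hx ν using hb x hx ν

lemma AbelValue.abs_le (h : AbelValue c v) {M : ℝ}
    (hs : Summable fun ν : ℕ => |c ((ν : ℝ) + 1)|) (hM : ∑' ν : ℕ, |c ((ν : ℝ) + 1)| ≤ M) :
    |v| ≤ M := by
  rw [h.unique (AbelValue.of_summable hs)]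
  refine le_trans ?_ hM
  have e : (fun ν : ℕ => ‖c ((ν : ℝ) + 1) * (-1) ^ (ν + 1)‖) = fun ν : ℕ => |c ((ν : ℝ) + 1)| := by
    funext ν
    simp
  have := norm_tsum_le_tsum_norm (f := fun ν : ℕ => c ((ν : ℝ) + 1) * (-1) ^ (ν + 1)) (by rwa [e])
  rwa [e] at this

lemma HasContinuedValue.valueAtNegOne_eq (h : HasContinuedValue c v) : valueAtNegOne c = v :=
  h.abelValue.valueAtNegOne_eq

end

/-! ### Polylogarithm values -/

/-- The value at `-1` of `∑_{ν ≥ 1} z^ν / (ν + k)^(p + 1)`. -/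
def lerch (p k : ℕ) : ℝ := valueAtNegOne fun t => 1 / (t + k) ^ (p + 1)

lemma hasContinuedValue_lerch (p k : ℕ) :
    HasContinuedValue (fun t => 1 / (t + k) ^ (p + 1)) (lerch p k) := by
  obtain ⟨v, hv⟩ := exists_hasContinuedValue_inv_pow k p
  rwa [lerch, hv.valueAtNegOne_eq]

lemma lerch_succ (p k : ℕ) : lerch p (k + 1) = -lerch p k - 1 / ((k : ℝ) + 1) ^ (p + 1) := by
  have h := (hasContinuedValue_lerch p k).abelValue.shift
  rw [add_comm (1 : ℝ) (k : ℝ)] at h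
  refine (hasContinuedValue_lerch p (k + 1)).abelValue.unique (h.congr fun ν => ?_)
  push_cast
  ring

lemma lerch_eq (p k : ℕ) :
    lerch p k = (-1) ^ k * (lerch p 0 - ∑ l ∈ Finset.Icc 1 k, (-1) ^ l / (l : ℝ) ^ (p + 1)) := by
  induction k with
  | zero => simp
  | succ k ih =>
    rw [lerch_succ, ih, Finset.sum_Icc_succ_top (by omega), pow_succ (-1 : ℝ) k]
    have : ((-1 : ℝ) ^ k) * (-1) ^ k = 1 := by rw [← pow_add, ← two_mul, pow_mul]; simp
    push_cast
    rcases neg_one_pow_eq_or ℝ k with h | h <;> rw [h] <;> ring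

/-- For f(ν) = 1/(ν+1)^s the odd indices carry the terms with even denominators, so q = 2^(-s): this
is Li_s(-1) = -(1 - 2^(1-s)) ζ(s). -/
lemma HasSum.alternating {f : ℕ → ℝ} {Z q : ℝ} (hf : HasSum f Z)
    (hq : ∀ k, f (2 * k + 1) = q * f k) :
    HasSum (fun ν => f ν * (-1) ^ (ν + 1)) (-Z + 2 * q * Z) := by
  have hodd : HasSum (fun k => f (2 * k + 1)) (q * Z) := hasSum_of_eq (hf.mul_left q) hq rfl
  have hinj : Function.Injective fun k : ℕ => 2 * k := fun a b h => by simpa using h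
  have heven : HasSum (fun k => f (2 * k)) (Z - q * Z) := by
    have h1 : Summable (fun k => f (2 * k)) := hf.summable.comp_injective hinj
    have h2 := (h1.hasSum.even_add_odd hodd).unique hf
    exact hasSum_of_eq h1.hasSum (fun _ => rfl) (by linarith)
  have := HasSum.even_add_odd (f := fun ν => f ν * (-1) ^ (ν + 1))
    (hasSum_of_eq heven.neg (fun k => by rw [pow_succ, pow_mul]; simp) rfl)
    (hasSum_of_eq hodd
      (fun k => by rw [show 2 * k + 1 + 1 = 2 * (k + 1) by ring, pow_mul]; simp) rfl)
  exact hasSum_of_eq this (fun _ => rfl) (by ring)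

lemma lerch_zero_eq {p : ℕ} {Z : ℝ}
    (hZ : HasSum (fun ν : ℕ => 1 / ((ν : ℝ) + 1) ^ (p + 1)) Z) :
    lerch p 0 = -Z + 2 * (1 / 2 ^ (p + 1)) * Z := by
  have halt := HasSum.alternating (q := 1 / 2 ^ (p + 1)) hZ fun k => by
    rw [div_mul_div_comm, ← mul_pow]
    push_cast
    ring_nf
  have hs : Summable fun ν : ℕ => |(fun t : ℝ => 1 / (t + (0 : ℕ)) ^ (p + 1)) ((ν : ℝ) + 1)| := by
    refine hZ.summable.congr fun ν => ?_
    simp only [Nat.cast_zero, add_zero]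
    rw [abs_of_nonneg (by positivity)]
  rw [(hasContinuedValue_lerch p 0).abelValue.unique (AbelValue.of_summable hs)]
  simp only [Nat.cast_zero, add_zero]
  exact halt.tsum_eq

lemma lerch_one_zero : lerch 1 0 = -(Real.pi ^ 2 / 12) := by
  have h : HasSum (fun ν : ℕ => 1 / ((ν : ℝ) + 1) ^ (1 + 1)) (Real.pi ^ 2 / 6) := by
    have := (hasSum_nat_add_iff' (f := fun n : ℕ => 1 / (n : ℝ) ^ 2) 1).2 hasSum_zeta_two
    simpa using this
  rw [lerch_zero_eq h]
  ring

lemma exists_zeta_three : ∃ Z : ℝ, riemannZeta 3 = Z ∧ lerch 2 0 = -(3 / 4 * Z) := by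
  have hs : Summable fun n : ℕ => 1 / (n : ℝ) ^ 3 :=
    Real.summable_one_div_nat_pow.2 (by norm_num)
  refine ⟨∑' n : ℕ, 1 / (n : ℝ) ^ 3, ?_, ?_⟩
  · have := zeta_nat_eq_tsum_of_gt_one (k := 3) (by norm_num)
    push_cast at this
    rw [this]
    push_cast
    rfl
  · have h : HasSum (fun ν : ℕ => 1 / ((ν : ℝ) + 1) ^ (2 + 1)) (∑' n : ℕ, 1 / (n : ℝ) ^ 3) := by
      have := (hasSum_nat_add_iff' (f := fun n : ℕ => 1 / (n : ℝ) ^ 3) 1).2 hs.hasSum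
      simpa using this
    rw [lerch_zero_eq h]
    ring

/-! ### The linear forms -/

namespace HasPF

variable {f : ℝ → ℝ} {N : ℕ} {α : ℕ → ℕ → ℝ} {P : ℝ[X]}

lemma hasContinuedValue (h : HasPF f N α P) {w : ℝ} (hP : HasContinuedValue (fun t => P.eval t) w) :
    HasContinuedValue f
      (w + ∑ k ∈ Finset.range N, ∑ s ∈ Finset.range 5, α k s * lerch s k) := by
  refine (hP.add (HasContinuedValue.sum _ fun k _ => HasContinuedValue.sum _ fun s _ =>
    (hasContinuedValue_lerch s k).const_mul (α k s))).congr fun ν => ?_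
  rw [h.eq _ fun j _ => by positivity]
  simp only [mul_one_div]

lemma hasDerivAt (h : HasPF f N α P) {t : ℝ} (ht : 0 < t) :
    HasDerivAt f ((derivative P).eval t - ∑ k ∈ Finset.range N, ∑ s ∈ Finset.range 5,
      α k s * (s + 1) / (t + k) ^ (s + 2)) t := by
  have h1 : HasDerivAt (fun t => P.eval t + ∑ k ∈ Finset.range N, ∑ s ∈ Finset.range 5,
      α k s / (t + k) ^ (s + 1)) ((derivative P).eval t + ∑ k ∈ Finset.range N,
        ∑ s ∈ Finset.range 5, -(α k s * (s + 1) / (t + k) ^ (s + 2))) t := by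
    refine (P.hasDerivAt t).add (HasDerivAt.fun_sum fun k _ => HasDerivAt.fun_sum fun s _ => ?_)
    have h0 : t + k ≠ 0 := by positivity
    have := (((hasDerivAt_id t).add_const (k : ℝ)).pow (s + 1)).inv (pow_ne_zero _ h0)
    have := this.const_mul (α k s)
    simp only [id, Pi.pow_apply] at this
    refine this.congr_deriv ?_
    push_cast
    field_simp
    ring
  simp only [Finset.sum_neg_distrib, ← sub_eq_add_neg] at h1
  refine h1.congr_of_eventuallyEq ?_
  filter_upwards [Ioi_mem_nhds ht] with y hy
  exact h.eq y fun j _ => by have : (0 : ℝ) < y := hy; positivity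

lemma hasContinuedValue_neg_deriv (h : HasPF f N α P) {w : ℝ}
    (hP : HasContinuedValue (fun t => (-derivative P).eval t) w) :
    HasContinuedValue (fun t => -deriv f t)
      (w + ∑ k ∈ Finset.range N, ∑ s ∈ Finset.range 5, α k s * (s + 1) * lerch (s + 1) k) := by
  refine (hP.add (HasContinuedValue.sum _ fun k _ => HasContinuedValue.sum _ fun s _ =>
    (hasContinuedValue_lerch (s + 1) k).const_mul (α k s * (s + 1)))).congr fun ν => ?_
  rw [(h.hasDerivAt (by positivity)).deriv]
  simp only [mul_one_div, eval_neg]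
  ring

end HasPF

lemma hasContinuedValue_R (n : ℕ) : HasContinuedValue (R n) (r n) := by
  have h := (hasPF_R n).hasContinuedValue (hasContinuedValue_polySum (B n))
  rwa [r, h.valueAtNegOne_eq]

lemma hasContinuedValue_negDerivR (n : ℕ) : HasContinuedValue (negDerivR n) (rt n) := by
  have hB := hasContinuedValue_polySum (-derivative (B n))
  rw [Polynomial.map_neg, ← derivative_map] at hB
  have h : HasContinuedValue (negDerivR n) _ := (hasPF_R n).hasContinuedValue_neg_deriv hB
  rwa [rt, h.valueAtNegOne_eq]

lemma sum_mul_lerch (n q : ℕ) (x : ℕ → ℝ) :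
    ∑ k ∈ Finset.range n, x k * lerch q k = lerch q 0 * ∑ k ∈ Finset.range n, (-1) ^ k * x k -
      ∑ k ∈ Finset.range n, ∑ l ∈ Finset.Icc 1 k, (-1) ^ (k + l) * (x k / (l : ℝ) ^ (q + 1)) := by
  rw [Finset.mul_sum, ← Finset.sum_sub_distrib]
  refine Finset.sum_congr rfl fun k _ => ?_
  rw [lerch_eq, mul_sub, mul_sub, Finset.mul_sum, Finset.mul_sum]
  congr 1
  · ring
  · exact Finset.sum_congr rfl fun l _ => by ring

lemma sum_range_pfCoeff (n k : ℕ) (g : ℕ → ℝ) :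
    ∑ s ∈ Finset.range 5, pfCoeff n k s * g s =
      pfCoeff n k 0 * g 0 + pfCoeff n k 1 * g 1 + pfCoeff n k 2 * g 2 := by
  have h3 : pfCoeff n k 3 = 0 := if_neg (by omega)
  have h4 : pfCoeff n k 4 = 0 := if_neg (by omega)
  simp [Finset.sum_range_succ, h3, h4]

lemma sum_altern_pfCoeff_one (n : ℕ) :
    ∑ k ∈ Finset.range (n + 1), (-1 : ℝ) ^ k * pfCoeff n k 1 = -a n := by
  rw [a_eq_sum n (n + 1) le_rfl, neg_neg]

lemma pfCoeff_of_le {n k : ℕ} (h : k ≤ n) :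
    pfCoeff n k 0 = A'' n k ∧ pfCoeff n k 1 = A' n k ∧ pfCoeff n k 2 = A n k :=
  ⟨if_pos ⟨h, by omega⟩, if_pos ⟨h, by omega⟩, if_pos ⟨h, by omega⟩⟩

/-- Each polar term contributes a polylogarithm value and a finite rational sum. The two alternating
sums with even index vanish, so log 2 and ζ(3) disappear. -/
theorem r_eq (n : ℕ) : r n = a n * (Real.pi ^ 2 / 12) - b n := by
  have h := (hasPF_R n).hasContinuedValue (hasContinuedValue_polySum (B n))
  rw [r, h.valueAtNegOne_eq]
  simp only [sum_range_pfCoeff n _ fun s => lerch s _, Finset.sum_add_distrib]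
  rw [sum_mul_lerch, sum_mul_lerch, sum_mul_lerch, sum_altern_pfCoeff_one,
    sum_altern_pfCoeff_eq_zero n (s := 0) (by norm_num) (by norm_num),
    sum_altern_pfCoeff_eq_zero n (s := 2) (by norm_num) (by norm_num), lerch_one_zero, b]
  push_cast
  have e : ∑ k ∈ Finset.range (n + 1), ∑ l ∈ Finset.Icc 1 k, (-1 : ℝ) ^ (k + l) *
      (A n k / (l : ℝ) ^ 3 + A' n k / (l : ℝ) ^ 2 + A'' n k / (l : ℝ)) =
      (∑ k ∈ Finset.range (n + 1), ∑ l ∈ Finset.Icc 1 k,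
        (-1) ^ (k + l) * (pfCoeff n k 0 / (l : ℝ) ^ (0 + 1))) +
      (∑ k ∈ Finset.range (n + 1), ∑ l ∈ Finset.Icc 1 k,
        (-1) ^ (k + l) * (pfCoeff n k 1 / (l : ℝ) ^ (1 + 1))) +
      (∑ k ∈ Finset.range (n + 1), ∑ l ∈ Finset.Icc 1 k,
        (-1) ^ (k + l) * (pfCoeff n k 2 / (l : ℝ) ^ (2 + 1))) := by
    simp only [← Finset.sum_add_distrib]
    refine Finset.sum_congr rfl fun k hk => Finset.sum_congr rfl fun l _ => ?_
    have hk' : k ≤ n := by simp only [Finset.mem_range] at hk; omega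
    obtain ⟨h0, h1, h2⟩ := pfCoeff_of_le hk'
    rw [h0, h1, h2]
    ring
  rw [e]
  ring

/-- Differentiation raises each pole order by one, so the surviving alternating sum now multiplies 2
Li_3(-1) = -3ζ(3)/2, with the same coefficient `a`. -/
theorem rt_eq (n : ℕ) {Z : ℝ} (hZ : lerch 2 0 = -(3 / 4 * Z)) :
    rt n = a n * (3 * Z / 2) - bt n := by
  have hB := hasContinuedValue_polySum (-derivative (B n))
  rw [Polynomial.map_neg, ← derivative_map] at hB
  have h : HasContinuedValue (negDerivR n) _ := (hasPF_R n).hasContinuedValue_neg_deriv hB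
  rw [rt, h.valueAtNegOne_eq]
  simp only [mul_assoc, sum_range_pfCoeff n _ fun s => ((s : ℝ) + 1) * lerch (s + 1) _,
    Finset.sum_add_distrib]
  simp only [← mul_assoc]
  rw [sum_mul_lerch, sum_mul_lerch, sum_mul_lerch]
  simp only [← mul_assoc, ← Finset.sum_mul]
  rw [sum_altern_pfCoeff_one,
    sum_altern_pfCoeff_eq_zero n (s := 0) (by norm_num) (by norm_num),
    sum_altern_pfCoeff_eq_zero n (s := 2) (by norm_num) (by norm_num), hZ, bt]
  push_cast
  have e : ∑ k ∈ Finset.range (n + 1), ∑ l ∈ Finset.Icc 1 k, (-1 : ℝ) ^ (k + l) *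
      (3 * A n k / (l : ℝ) ^ 4 + 2 * A' n k / (l : ℝ) ^ 3 + A'' n k / (l : ℝ) ^ 2) =
      (∑ k ∈ Finset.range (n + 1), ∑ l ∈ Finset.Icc 1 k,
        (-1) ^ (k + l) * (pfCoeff n k 0 * (0 + 1) / (l : ℝ) ^ (0 + 1 + 1))) +
      (∑ k ∈ Finset.range (n + 1), ∑ l ∈ Finset.Icc 1 k,
        (-1) ^ (k + l) * (pfCoeff n k 1 * (1 + 1) / (l : ℝ) ^ (1 + 1 + 1))) +
      (∑ k ∈ Finset.range (n + 1), ∑ l ∈ Finset.Icc 1 k,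
        (-1) ^ (k + l) * (pfCoeff n k 2 * (2 + 1) / (l : ℝ) ^ (2 + 1 + 1))) := by
    simp only [← Finset.sum_add_distrib]
    refine Finset.sum_congr rfl fun k hk => Finset.sum_congr rfl fun l _ => ?_
    have hk' : k ≤ n := by simp only [Finset.mem_range] at hk; omega
    obtain ⟨h0, h1, h2⟩ := pfCoeff_of_le hk'
    rw [h0, h1, h2]
    ring
  rw [e]
  ring

/-! ### The recurrence relation of the linear forms -/

lemma hasDerivAt_sq_mul {f u g : ℝ → ℝ} {x : ℝ} (hf : ∀ t, f t = u t ^ 2 * g t) (h0 : u x = 0)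
    (hu : DifferentiableAt ℝ u x) (hg : DifferentiableAt ℝ g x) : f x = 0 ∧ HasDerivAt f 0 x := by
  refine ⟨by rw [hf, h0]; ring, ?_⟩
  have := (hu.hasDerivAt.pow 2).mul hg.hasDerivAt
  simp only [Pi.pow_apply, h0] at this
  rw [show f = u ^ 2 * g from funext hf]
  refine this.congr_deriv ?_
  simp

/-- The factor (t-m-1)^2 extends the squared product in `base` to (t-1)^2...(t-m-1)^2, so there is a
double zero at 1 even for m = 0. These are the boundary terms of both telescoping sums. -/
lemma hasDerivAt_cert_one (m : ℕ) : cert m 1 = 0 ∧ HasDerivAt (cert m) 0 1 := by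
  have hu : ∀ t : ℝ, cert m t = (∏ i ∈ Finset.range (m + 1), (t - (i + 1 : ℝ))) ^ 2 *
      ((-1) ^ (m + 1) / (2 * m.factorial) * (∏ i ∈ Finset.range m, (t + m + 1 + i)) ^ 2 /
        (∏ i ∈ Finset.range (m + 1), (t + i)) ^ 3 * certPoly (m : ℝ) t /
        ((m + 1) * (m + 2) * ((t + m + 1) * (t + m + 2)) ^ 5)) := by
    intro t
    rw [Finset.prod_range_succ, cert, base]
    ring
  have h0 : ∏ i ∈ Finset.range (m + 1), ((1 : ℝ) - (i + 1 : ℝ)) = 0 :=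
    Finset.prod_eq_zero (Finset.mem_range.2 (Nat.succ_pos m)) (by simp)
  have hd : DifferentiableAt ℝ (fun t : ℝ => (-1) ^ (m + 1) / (2 * m.factorial) *
      (∏ i ∈ Finset.range m, (t + m + 1 + i)) ^ 2 /
        (∏ i ∈ Finset.range (m + 1), (t + i)) ^ 3 * certPoly (m : ℝ) t /
        ((m + 1) * (m + 2) * ((t + m + 1) * (t + m + 2)) ^ 5)) 1 := by
    have hp : ∏ i ∈ Finset.range (m + 1), ((1 : ℝ) + i) ≠ 0 :=
      Finset.prod_ne_zero_iff.2 fun i _ => by positivity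
    have hc : DifferentiableAt ℝ (fun t : ℝ => certPoly (m : ℝ) t) 1 := by
      unfold certPoly
      fun_prop
    have h2 : ((m : ℝ) + 1) * (m + 2) * ((1 + m + 1) * (1 + m + 2)) ^ 5 ≠ 0 := by positivity
    refine DifferentiableAt.div (.mul (DifferentiableAt.div ?_ ?_ (pow_ne_zero _ hp)) hc) ?_ h2 <;>
      fun_prop
  exact hasDerivAt_sq_mul hu h0 (by fun_prop) hd

lemma exists_abelValue_cert (m : ℕ) :
    ∃ v w, AbelValue (cert m) v ∧ AbelValue (fun t => -deriv (cert m) t) w := by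
  obtain ⟨α, P, h⟩ := exists_hasPF_cert m
  exact ⟨_, _, (h.hasContinuedValue (hasContinuedValue_polynomial P)).abelValue,
    (h.hasContinuedValue_neg_deriv (hasContinuedValue_polynomial _)).abelValue⟩

theorem rec_r (m : ℕ) :
    rec0 m * r m + rec1 m * r (m + 1) + rec2 m * r (m + 2) + rec3 m * r (m + 3) = 0 := by
  obtain ⟨v, _, hv, _⟩ := exists_abelValue_cert m
  have hl := ((((hasContinuedValue_R m).abelValue.const_mul (rec0 m)).add
    ((hasContinuedValue_R (m + 1)).abelValue.const_mul (rec1 m))).add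
    ((hasContinuedValue_R (m + 2)).abelValue.const_mul (rec2 m))).add
    ((hasContinuedValue_R (m + 3)).abelValue.const_mul (rec3 m))
  have hr := (hv.add hv.shift).congr
    (d := fun t => rec0 m * R m t + rec1 m * R (m + 1) t + rec2 m * R (m + 2) t +
      rec3 m * R (m + 3) t) fun ν =>
    telescoping m (t := (ν : ℝ) + 1) fun j => by positivity
  rw [hl.unique hr, (hasDerivAt_cert_one m).1]
  ring

theorem rec_rt (m : ℕ) :
    rec0 m * rt m + rec1 m * rt (m + 1) + rec2 m * rt (m + 2) + rec3 m * rt (m + 3) = 0 := by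
  obtain ⟨_, w, _, hw⟩ := exists_abelValue_cert m
  have hl := ((((hasContinuedValue_negDerivR m).abelValue.const_mul (rec0 m)).add
    ((hasContinuedValue_negDerivR (m + 1)).abelValue.const_mul (rec1 m))).add
    ((hasContinuedValue_negDerivR (m + 2)).abelValue.const_mul (rec2 m))).add
    ((hasContinuedValue_negDerivR (m + 3)).abelValue.const_mul (rec3 m))
  obtain ⟨α, P, h⟩ := exists_hasPF_cert m
  have hr := (hw.add hw.shift).congr
    (d := fun t => rec0 m * negDerivR m t + rec1 m * negDerivR (m + 1) t +
      rec2 m * negDerivR (m + 2) t + rec3 m * negDerivR (m + 3) t) fun ν => by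
    have ht : (0 : ℝ) < (ν : ℝ) + 1 := by positivity
    have hR := fun n => ((hasPF_R n).hasDerivAt ht).differentiableAt.hasDerivAt
    have e1 := (((((hR m).const_mul (rec0 m)).add ((hR (m + 1)).const_mul (rec1 m))).add
      ((hR (m + 2)).const_mul (rec2 m))).add ((hR (m + 3)).const_mul (rec3 m)))
    have hc := (h.hasDerivAt ht).differentiableAt.hasDerivAt
    have hc1 := ((h.hasDerivAt (by positivity : (0 : ℝ) < (ν : ℝ) + 1 + 1)).differentiableAt.hasDerivAt).comp_add_const
      ((ν : ℝ) + 1) 1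
    -- The telescoping relation holds for all t > 0, hence in a neighbourhood of ν+1, and can be
    -- differentiated there.
    have e2 := (hc.add hc1).congr_of_eventuallyEq (f₁ := fun t => rec0 m * R m t +
        rec1 m * R (m + 1) t + rec2 m * R (m + 2) t + rec3 m * R (m + 3) t) (by
      filter_upwards [Ioi_mem_nhds ht] with y hy
      have hy' : (0 : ℝ) < y := hy
      exact telescoping m fun j => by positivity)
    have e3 := e1.unique e2
    simp only [negDerivR]
    linarith
  rw [hl.unique hr, (hasDerivAt_cert_one m).2.deriv]
  ring

theorem rec_b (m : ℕ) :
    rec0 m * b m + rec1 m * b (m + 1) + rec2 m * b (m + 2) + rec3 m * b (m + 3) = 0 := by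
  have h1 := rec_r m
  have h2 := rec_a m
  simp only [r_eq] at h1
  linear_combination (Real.pi ^ 2 / 12) * h2 - h1

theorem rec_bt (m : ℕ) :
    rec0 m * bt m + rec1 m * bt (m + 1) + rec2 m * bt (m + 2) + rec3 m * bt (m + 3) = 0 := by
  obtain ⟨Z, -, hZ⟩ := exists_zeta_three
  have h1 := rec_rt m
  have h2 := rec_a m
  simp only [rt_eq _ hZ] at h1
  linear_combination (3 * Z / 2) * h2 - h1

end
end WellPoised

namespace WellPoised
noncomputable section

/-! ### Growth of solutions of perturbed linear recurrences -/

lemma tendsto_zero_of_contraction {w η : ℕ → ℝ} {θ : ℝ} (hθ0 : 0 ≤ θ) (hθ : θ < 1)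
    (hw : ∀ n, 0 ≤ w n) (h : ∀ n, w (n + 1) ≤ θ * w n + η n) (hη : Tendsto η atTop (𝓝 0)) :
    Tendsto w atTop (𝓝 0) := by
  rw [Metric.tendsto_atTop]
  intro ε hε
  have h1 : 0 < 1 - θ := by linarith
  obtain ⟨N, hN⟩ := eventually_atTop.1 (hη.eventually_lt_const (by positivity : 0 < ε / 2 * (1 - θ)))
  have hk : ∀ k, w (N + k) ≤ θ ^ k * w N + ε / 2 := by
    intro k
    induction k with
    | zero => simp; linarith
    | succ k ih =>
      have a1 := h (N + k)
      have a2 := hN (N + k) (by omega)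
      have a3 := mul_le_mul_of_nonneg_left ih hθ0
      rw [← add_assoc, pow_succ]
      nlinarith
  have hp : Tendsto (fun k => θ ^ k * w N) atTop (𝓝 (0 * w N)) :=
    (tendsto_pow_atTop_nhds_zero_of_lt_one hθ0 hθ).mul_const _
  rw [zero_mul] at hp
  obtain ⟨M, hM⟩ := eventually_atTop.1 (hp.eventually_lt_const (by positivity : 0 < ε / 2))
  refine ⟨N + M, fun n hn => ?_⟩
  obtain ⟨k, rfl⟩ := Nat.exists_eq_add_of_le (show N ≤ n by omega)
  rw [Real.dist_eq, sub_zero, abs_of_nonneg (hw _)]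
  have := hM k (by omega)
  have := hk k
  linarith

/-- Iterating k steps forward bounds w_n by θ^k plus a small error, using only the uniform bound w ≤
1; then k tends to infinity with n fixed. -/
lemma tendsto_zero_of_backward_contraction {w η : ℕ → ℝ} {θ : ℝ} (hθ0 : 0 ≤ θ) (hθ : θ < 1)
    (hw : ∀ n, 0 ≤ w n) (hw1 : ∀ n, w n ≤ 1) (h : ∀ n, w n ≤ θ * w (n + 1) + η n)
    (hη : Tendsto η atTop (𝓝 0)) : Tendsto w atTop (𝓝 0) := by
  rw [Metric.tendsto_atTop]
  intro ε hε
  have h1 : 0 < 1 - θ := by linarith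
  obtain ⟨N, hN⟩ := eventually_atTop.1 (hη.eventually_lt_const (by positivity : 0 < ε / 2 * (1 - θ)))
  refine ⟨N, fun n hn => ?_⟩
  have hk : ∀ k, ∀ n ≥ N, w n ≤ θ ^ k + ε / 2 := by
    intro k
    induction k with
    | zero => intro n _; simp; linarith [hw1 n]
    | succ k ih =>
      intro n hn
      have a1 := h n
      have a2 := hN n hn
      have a3 := mul_le_mul_of_nonneg_left (ih (n + 1) (by omega)) hθ0
      rw [pow_succ]
      nlinarith
  have hp : Tendsto (fun k => θ ^ k + ε / 2) atTop (𝓝 (0 + ε / 2)) :=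
    (tendsto_pow_atTop_nhds_zero_of_lt_one hθ0 hθ).add_const _
  have := ge_of_tendsto' hp fun k => hk k n hn
  rw [Real.dist_eq, sub_zero, abs_of_nonneg (hw _)]
  linarith

/-- X and Z are the sizes of the components in the expanding and the contracting direction. For
large n the cone Z ≤ X is invariant. Once it is entered, Z/X contracts; if it is never entered, X/Z
satisfies a backward contraction. -/
theorem growth_dichotomy {X Z ε : ℕ → ℝ} {L ρ : ℝ} (hρ : 0 < ρ) (hL : ρ < L)
    (hX0 : ∀ n, 0 ≤ X n) (hZ0 : ∀ n, 0 ≤ Z n) (hpos : ∀ n, 0 < X n + Z n)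
    (hX : ∀ n, |X (n + 1) - L * X n| ≤ ε n * (X n + Z n))
    (hZ : ∀ n, |Z (n + 1) - ρ * Z n| ≤ ε n * (X n + Z n)) (hε : Tendsto ε atTop (𝓝 0)) :
    ((∀ᶠ n in atTop, 0 < X n) ∧ Tendsto (fun n => Z n / X n) atTop (𝓝 0) ∧
      Tendsto (fun n => X (n + 1) / X n) atTop (𝓝 L)) ∨
    ((∀ᶠ n in atTop, 0 < Z n) ∧ Tendsto (fun n => X n / Z n) atTop (𝓝 0) ∧
      Tendsto (fun n => Z (n + 1) / Z n) atTop (𝓝 ρ)) := by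
  have hε0 : ∀ n, 0 ≤ ε n := fun n => by
    have := (abs_nonneg _).trans (hX n)
    exact nonneg_of_mul_nonneg_left this (hpos n)
  obtain ⟨N, hN⟩ := eventually_atTop.1
    (hε.eventually_lt_const (by linarith : 0 < (L - ρ) / 4))
  -- For ε < (L-ρ)/4 the midpoint κ separates the rates: ρ + 2ε ≤ κ ≤ L - 2ε.
  set κ := (L + ρ) / 2 with hκ
  have hκ0 : 0 < κ := by rw [hκ]; linarith
  have h2ε : Tendsto (fun n => 2 * ε n) atTop (𝓝 0) := by simpa using hε.const_mul 2
  have hcone : ∀ n ≥ N, Z n ≤ X n → Z (n + 1) ≤ X (n + 1) ∧ κ * X n ≤ X (n + 1) ∧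
      Z (n + 1) ≤ ρ * Z n + 2 * ε n * X n := by
    intro n hn hZX
    have a1 := abs_le.1 (hX n)
    have a2 := abs_le.1 (hZ n)
    have a3 := hN n hn
    have a4 : ε n * (X n + Z n) ≤ 2 * ε n * X n := by nlinarith [hε0 n]
    have a5 : 2 * ε n * X n ≤ (L - ρ) / 2 * X n :=
      mul_le_mul_of_nonneg_right (by linarith) (hX0 n)
    have a6 : ρ * Z n ≤ ρ * X n := mul_le_mul_of_nonneg_left hZX hρ.le
    refine ⟨?_, ?_, by linarith⟩
    · nlinarith
    · rw [hκ]; nlinarith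
  by_cases hcase : ∃ n ≥ N, Z n ≤ X n
  · left
    obtain ⟨n₀, hn₀, hZX⟩ := hcase
    have hall : ∀ n, Z (n + n₀) ≤ X (n + n₀) := by
      intro n
      induction n with
      | zero => simpa using hZX
      | succ n ih => rw [Nat.add_right_comm]; exact (hcone _ (by omega) ih).1
    have hXp : ∀ n, 0 < X (n + n₀) := fun n => by
      have := hall n
      have := hpos (n + n₀)
      by_contra h
      linarith
    refine ⟨eventually_atTop.2 ⟨n₀, fun n hn => by
      obtain ⟨k, rfl⟩ := Nat.exists_eq_add_of_le' hn
      exact hXp k⟩, ?_, ?_⟩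
    · rw [← tendsto_add_atTop_iff_nat n₀]
      have hη : Tendsto (fun n => 2 * ε (n + n₀) / κ) atTop (𝓝 0) := by
        simpa using ((tendsto_add_atTop_iff_nat n₀).2 h2ε).div_const κ
      refine tendsto_zero_of_contraction (θ := ρ / κ) (by positivity)
        ((div_lt_one hκ0).2 (by rw [hκ]; linarith)) (fun n => div_nonneg (hZ0 _) (hX0 _))
        (fun n => ?_) hη
      obtain ⟨-, c2, c3⟩ := hcone (n + n₀) (by omega) (hall n)
      have hx := hXp n
      rw [show n + 1 + n₀ = n + n₀ + 1 by omega]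
      calc Z (n + n₀ + 1) / X (n + n₀ + 1)
          ≤ (ρ * Z (n + n₀) + 2 * ε (n + n₀) * X (n + n₀)) / (κ * X (n + n₀)) :=
            div_le_div₀ (by have := hZ0 (n + n₀); have := hε0 (n + n₀); positivity) c3
              (by positivity) c2
        _ = _ := by field_simp
    · rw [← tendsto_add_atTop_iff_nat n₀, tendsto_iff_dist_tendsto_zero]
      refine squeeze_zero (fun _ => dist_nonneg) (fun n => ?_)
        ((tendsto_add_atTop_iff_nat n₀).2 h2ε)
      have hx := hXp n
      rw [Real.dist_eq, show X (n + n₀ + 1) / X (n + n₀) - L =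
        (X (n + n₀ + 1) - L * X (n + n₀)) / X (n + n₀) by field_simp, abs_div, abs_of_pos hx,
        div_le_iff₀ hx]
      nlinarith [hX (n + n₀), hε0 (n + n₀), hall n]
  · right
    push Not at hcase
    have hall : ∀ n, X (n + N) < Z (n + N) := fun n => hcase _ (by omega)
    have hZp : ∀ n, 0 < Z (n + N) := fun n => (hX0 _).trans_lt (hall n)
    have hL0 : 0 < L := hρ.trans hL
    refine ⟨eventually_atTop.2 ⟨N, fun n hn => by
      obtain ⟨k, rfl⟩ := Nat.exists_eq_add_of_le' hn
      exact hZp k⟩, ?_, ?_⟩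
    · rw [← tendsto_add_atTop_iff_nat N]
      have hη : Tendsto (fun n => 2 * ε (n + N) / L) atTop (𝓝 0) := by
        simpa using ((tendsto_add_atTop_iff_nat N).2 h2ε).div_const L
      refine tendsto_zero_of_backward_contraction (θ := κ / L) (by positivity)
        ((div_lt_one hL0).2 (by rw [hκ]; linarith)) (fun n => div_nonneg (hX0 _) (hZ0 _))
        (fun n => (div_le_one (hZp n)).2 (hall n).le) (fun n => ?_) hη
      have hz := hZp n
      have hz1 := hZp (n + 1)
      have a1 := abs_le.1 (hX (n + N))
      have a2 := abs_le.1 (hZ (n + N))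
      have a3 := hN (n + N) (by omega)
      have a4 : ε (n + N) * (X (n + N) + Z (n + N)) ≤ 2 * ε (n + N) * Z (n + N) := by
        nlinarith [hε0 (n + N), hall n]
      have a5 : 2 * ε (n + N) * Z (n + N) ≤ (L - ρ) / 2 * Z (n + N) :=
        mul_le_mul_of_nonneg_right (by linarith) hz.le
      rw [show n + 1 + N = n + N + 1 by omega] at hz1 ⊢
      -- Outside the cone Z grows at most by κ per step while X would grow by about L > κ, so X/Z is
      -- bounded through its next value.
      have b1 : Z (n + N + 1) ≤ κ * Z (n + N) := by rw [hκ]; nlinarith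
      have b2 : L * X (n + N) ≤ X (n + N + 1) + 2 * ε (n + N) * Z (n + N) := by linarith
      have b3 : X (n + N + 1) ≤ κ * Z (n + N) * (X (n + N + 1) / Z (n + N + 1)) := by
        calc X (n + N + 1) = Z (n + N + 1) * (X (n + N + 1) / Z (n + N + 1)) := by field_simp
          _ ≤ _ := mul_le_mul_of_nonneg_right b1 (div_nonneg (hX0 _) hz1.le)
      rw [div_le_iff₀ hz]
      have : (κ / L * (X (n + N + 1) / Z (n + N + 1)) + 2 * ε (n + N) / L) * Z (n + N) =
          (κ * Z (n + N) * (X (n + N + 1) / Z (n + N + 1)) + 2 * ε (n + N) * Z (n + N)) / L := by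
        field_simp
      rw [this, le_div_iff₀ hL0]
      linarith
    · rw [← tendsto_add_atTop_iff_nat N, tendsto_iff_dist_tendsto_zero]
      refine squeeze_zero (fun _ => dist_nonneg) (fun n => ?_)
        ((tendsto_add_atTop_iff_nat N).2 h2ε)
      have hz := hZp n
      rw [Real.dist_eq, show Z (n + N + 1) / Z (n + N) - ρ =
        (Z (n + N + 1) - ρ * Z (n + N)) / Z (n + N) by field_simp, abs_div, abs_of_pos hz,
        div_le_iff₀ hz]
      nlinarith [hZ (n + N), hε0 (n + N), hall n]

/-! ### From ratios to n-th roots. -/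

lemma tendsto_root_of_ratio {y : ℕ → ℝ} {L : ℝ} (hL : 0 < L) (hy : ∀ᶠ n in atTop, 0 < y n)
    (h : Tendsto (fun n => y (n + 1) / y n) atTop (𝓝 L)) :
    Tendsto (fun n => y n ^ (1 / (n : ℝ))) atTop (𝓝 L) := by
  have h1 : Tendsto (fun n => Real.log (y (n + 1)) - Real.log (y n)) atTop (𝓝 (Real.log L)) := by
    refine ((Real.continuousAt_log hL.ne').tendsto.comp h).congr' ?_
    filter_upwards [hy, (tendsto_add_atTop_nat 1).eventually hy] with n h0 h1
    exact Real.log_div h1.ne' h0.ne'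
  have h2 := h1.cesaro
  simp only [Finset.sum_range_sub fun n => Real.log (y n)] at h2
  have h3 : Tendsto (fun n : ℕ => (n : ℝ)⁻¹ * Real.log (y 0)) atTop (𝓝 0) := by
    simpa using tendsto_inv_atTop_nhds_zero_nat.mul_const (Real.log (y 0))
  have h4 := h2.add h3
  rw [add_zero] at h4
  have h5 := (Real.continuous_exp.tendsto _).comp h4
  rw [Real.exp_log hL] at h5
  refine h5.congr' ?_
  filter_upwards [hy] with n hn
  rw [Function.comp_apply, Real.rpow_def_of_pos hn]
  congr 1
  rw [one_div]
  ring

lemma tendsto_const_root {C : ℝ} (hC : 0 < C) :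
    Tendsto (fun n : ℕ => C ^ (1 / (n : ℝ))) atTop (𝓝 1) := by
  have h := (Real.continuous_const_rpow hC.ne').tendsto 0 |>.comp tendsto_one_div_atTop_nhds_zero_nat
  rwa [Real.rpow_zero] at h

lemma tendsto_const_mul_root {y : ℕ → ℝ} {L C : ℝ} (hC : 0 < C) (hy : ∀ᶠ n in atTop, 0 < y n)
    (h : Tendsto (fun n => y n ^ (1 / (n : ℝ))) atTop (𝓝 L)) :
    Tendsto (fun n => (C * y n) ^ (1 / (n : ℝ))) atTop (𝓝 L) := by
  have := (tendsto_const_root hC).mul h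
  rw [one_mul] at this
  refine this.congr' ?_
  filter_upwards [hy] with n hn
  rw [Real.mul_rpow hC.le hn.le]

/-- With complex conjugate zeros a single |u_n| may be much smaller than Z_n, but three consecutive
terms control Z_n. This yields a limsup where a limit is not asserted. -/
theorem limsup_root_eq {u Z : ℕ → ℝ} {ρ C : ℝ} (hC : 0 < C)
    (hZ : ∀ᶠ n in atTop, 0 < Z n)
    (hlim : Tendsto (fun n => Z n ^ (1 / (n : ℝ))) atTop (𝓝 ρ))
    (hu : ∀ᶠ n in atTop, |u n| ≤ C * Z n)
    (hZu : ∀ᶠ n in atTop, Z n ≤ C * (|u n| + |u (n + 1)| + |u (n + 2)|)) :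
    limsup (fun n : ℕ => ((|u n| ^ (1 / (n : ℝ)) : ℝ) : EReal)) atTop = (ρ : EReal) := by
  apply le_antisymm
  · have h1 : Tendsto (fun n : ℕ => (((C * Z n) ^ (1 / (n : ℝ)) : ℝ) : EReal)) atTop
        (𝓝 (ρ : EReal)) :=
      (continuous_coe_real_ereal.tendsto ρ).comp (tendsto_const_mul_root hC hZ hlim)
    rw [← h1.limsup_eq]
    refine limsup_le_limsup ?_
    filter_upwards [hu] with n hn
    exact EReal.coe_le_coe_iff.2 (Real.rpow_le_rpow (abs_nonneg _) hn (by positivity))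
  · by_contra hlt
    push Not at hlt
    obtain ⟨r, hr1, hr2⟩ := EReal.lt_iff_exists_real_btwn.1 hlt
    have hr2' : r < ρ := EReal.coe_lt_coe_iff.1 hr2
    have hev := eventually_lt_of_limsup_lt hr1
    have hev' : ∀ᶠ n in atTop, 0 < r ∧ |u n| ≤ r ^ n := by
      filter_upwards [hev, eventually_ge_atTop 1] with n hn hn1
      have h1 : |u n| ^ (1 / (n : ℝ)) < r := EReal.coe_lt_coe_iff.1 hn
      have h0 : 0 ≤ |u n| ^ (1 / (n : ℝ)) := by positivity
      refine ⟨h0.trans_lt h1, ?_⟩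
      have h2 := pow_le_pow_left₀ h0 h1.le n
      rwa [one_div, Real.rpow_inv_natCast_pow (abs_nonneg _) (by omega)] at h2
    have hr0 : 0 < r := hev'.exists.choose_spec.1
    have hK : 0 < C * (1 + r + r ^ 2) := by positivity
    have hpow : Tendsto (fun n : ℕ => (r ^ n) ^ (1 / (n : ℝ))) atTop (𝓝 r) := by
      refine tendsto_const_nhds.congr' ?_
      filter_upwards [eventually_ge_atTop 1] with n hn
      rw [one_div, Real.pow_rpow_inv_natCast hr0.le (by omega)]
    have hup := tendsto_const_mul_root hK (Eventually.of_forall fun n => pow_pos hr0 n) hpow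
    -- If |u_n| ≤ r^n eventually with r < ρ, then Z_n ≤ C(1 + r + r^2) r^n, and its n-th root would
    -- have limit at most r.
    refine absurd (le_of_tendsto_of_tendsto hlim hup ?_) (not_le.2 hr2')
    filter_upwards [hZ, hZu, hev', (tendsto_add_atTop_nat 1).eventually hev',
      (tendsto_add_atTop_nat 2).eventually hev'] with n h0 h1 h2 h3 h4
    refine Real.rpow_le_rpow h0.le (h1.trans ?_) (by positivity)
    rw [mul_assoc]
    refine mul_le_mul_of_nonneg_left ?_ hC.le
    have e3 := h3.2
    have e4 := h4.2
    rw [pow_add] at e3 e4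
    nlinarith [h2.2]

/-- The alternative for the growth of the solutions of a linear recurrence of order three whose
limit characteristic polynomial has a dominant real zero `l₃` and two conjugate zeros `l₁`. -/
theorem recurrence_growth {u p q s : ℕ → ℝ} {l₁ : ℂ} {l₃ P Q S : ℝ}
    (hP : 2 * l₁.re + l₃ = P) (hQ : ‖l₁‖ ^ 2 + 2 * l₁.re * l₃ = Q) (hS : ‖l₁‖ ^ 2 * l₃ = S)
    (him : l₁.im ≠ 0) (hl : ‖l₁‖ < l₃)
    (hp : Tendsto p atTop (𝓝 P)) (hq : Tendsto q atTop (𝓝 Q)) (hs : Tendsto s atTop (𝓝 S))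
    (hs0 : ∀ n, s n ≠ 0) (h0 : u 0 ≠ 0 ∨ u 1 ≠ 0 ∨ u 2 ≠ 0)
    (hrec : ∀ n, u (n + 3) = p n * u (n + 2) - q n * u (n + 1) + s n * u n) :
    Tendsto (fun n => |u n| ^ (1 / (n : ℝ))) atTop (𝓝 l₃) ∨
    limsup (fun n : ℕ => ((|u n| ^ (1 / (n : ℝ)) : ℝ) : EReal)) atTop = (‖l₁‖ : EReal) := by
  have hl1 : l₁ ≠ 0 := fun h => him (by simp [h])
  have hρ : 0 < ‖l₁‖ := norm_pos_iff.2 hl1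
  -- Since `s n` never vanishes, the recurrence runs backward, and three consecutive zeros would
  -- propagate to the start.
  have hne : ∀ n, u n ≠ 0 ∨ u (n + 1) ≠ 0 ∨ u (n + 2) ≠ 0 := by
    intro n
    induction n with
    | zero => exact h0
    | succ n ih =>
      by_contra h
      push Not at h
      obtain ⟨h1, h2, h3⟩ := h
      have := hrec n
      rw [show n + 1 + 2 = n + 3 by omega] at h3
      rw [show n + 1 + 1 = n + 2 by omega] at h2
      rw [h3, h2, h1] at this
      simp only [mul_zero, sub_zero, zero_add] at this
      have h4 : u n = 0 := (mul_eq_zero.1 this.symm).resolve_left (hs0 n)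
      tauto
  set l₂ : ℂ := (starRingEnd ℂ) l₁ with hl2
  have hsum : l₁ + l₂ = ((2 * l₁.re : ℝ) : ℂ) := Complex.add_conj l₁
  have hprod : l₁ * l₂ = ((‖l₁‖ ^ 2 : ℝ) : ℂ) := by
    rw [hl2, Complex.mul_conj, Complex.normSq_eq_norm_sq]
  -- With E the shift, x = (E - l₁)(E - l₂)u and z = (E - l₂)(E - l₃)u: each factor left out becomes
  -- the multiplier of a first-order recurrence, up to the error `e` from the varying coefficients.
  -- The third component is the conjugate of z.
  set x : ℕ → ℝ := fun n => u (n + 2) - 2 * l₁.re * u (n + 1) + ‖l₁‖ ^ 2 * u n with hx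
  set z : ℕ → ℂ := fun n => u (n + 2) - (l₂ + l₃) * u (n + 1) + l₂ * l₃ * u n with hz
  set e : ℕ → ℝ := fun n => (p n - P) * u (n + 2) - (q n - Q) * u (n + 1) + (s n - S) * u n with he
  have hxe : ∀ n, x (n + 1) = l₃ * x n + e n := by
    intro n
    simp only [hx, he, show n + 1 + 2 = n + 3 by omega, show n + 1 + 1 = n + 2 by omega, hrec n]
    rw [← hP, ← hQ, ← hS]
    ring
  have hze : ∀ n, z (n + 1) = l₁ * z n + e n := by
    intro n
    simp only [hz, he, show n + 1 + 2 = n + 3 by omega, show n + 1 + 1 = n + 2 by omega, hrec n]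
    have hP' : (P : ℂ) = l₁ + l₂ + l₃ := by rw [hsum, ← hP]; push_cast; ring
    have hQ' : (Q : ℂ) = l₁ * l₂ + (l₁ + l₂) * l₃ := by
      rw [hsum, hprod, ← hQ]; push_cast; ring
    have hS' : (S : ℂ) = l₁ * l₂ * l₃ := by rw [hprod, ← hS]; push_cast; ring
    push_cast
    rw [hP', hQ', hS']
    ring
  have hD : (l₃ : ℂ) - l₁ ≠ 0 := by
    intro h
    have := congrArg Complex.im h
    simp at this
    exact him this
  have hy : ∀ n, ((u (n + 1) : ℂ) - l₂ * u n) = (x n - z n) / (l₃ - l₁) := by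
    intro n
    rw [eq_div_iff hD]
    simp only [hx, hz]
    push_cast
    have h1 : (2 * (l₁.re : ℂ)) = l₁ + l₂ := by rw [hsum]; push_cast; ring
    have h2 : ((‖l₁‖ : ℂ)) ^ 2 = l₁ * l₂ := by rw [hprod]; push_cast; ring
    rw [h1, h2]
    ring
  -- As u is real, the imaginary part of u(n+1) - l₂ u(n) is l₁.im · u(n). Thus x and z determine
  -- u(n), u(n+1), u(n+2), with the constants c₀, c₁, c₂ below.
  have hu0 : ∀ n, l₁.im * u n = ((x n - z n) / (l₃ - l₁)).im := by
    intro n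
    rw [← hy]
    simp [hl2]
  set D := ‖(l₃ : ℂ) - l₁‖ with hDdef
  have hD0 : 0 < D := norm_pos_iff.2 hD
  have him0 : 0 < |l₁.im| := abs_pos.2 him
  have hyn : ∀ n, ‖((x n : ℂ) - z n) / (l₃ - l₁)‖ ≤ (|x n| + ‖z n‖) / D := by
    intro n
    rw [norm_div]
    gcongr
    refine (norm_sub_le _ _).trans ?_
    rw [Complex.norm_real, Real.norm_eq_abs]
  set c₀ := 1 / (|l₁.im| * D) with hc₀
  set c₁ := 1 / D + ‖l₁‖ * c₀ with hc₁
  set c₂ := 1 + |2 * l₁.re| * c₁ + ‖l₁‖ ^ 2 * c₀ with hc₂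
  have hc₀0 : 0 < c₀ := by positivity
  have hc₁0 : 0 < c₁ := by positivity
  have hc₂0 : 0 < c₂ := by positivity
  have b0 : ∀ n, |u n| ≤ c₀ * (|x n| + ‖z n‖) := by
    intro n
    have h1 : |l₁.im| * |u n| ≤ (|x n| + ‖z n‖) / D := by
      rw [← abs_mul, hu0]
      exact (Complex.abs_im_le_norm _).trans (hyn n)
    rw [hc₀, one_div_mul_eq_div, le_div_iff₀ (by positivity)]
    rw [le_div_iff₀ hD0] at h1
    linarith
  have b1 : ∀ n, |u (n + 1)| ≤ c₁ * (|x n| + ‖z n‖) := by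
    intro n
    have h1 : (u (n + 1) : ℂ) = (x n - z n) / (l₃ - l₁) + l₂ * u n := by rw [← hy]; ring
    have h2 : |u (n + 1)| ≤ (|x n| + ‖z n‖) / D + ‖l₁‖ * |u n| := by
      rw [← Real.norm_eq_abs, ← Complex.norm_real, h1]
      refine (norm_add_le _ _).trans (add_le_add (hyn n) ?_)
      rw [norm_mul, hl2, Complex.norm_conj, Complex.norm_real, Real.norm_eq_abs]
    have h3 := mul_le_mul_of_nonneg_left (b0 n) hρ.le
    rw [hc₁, add_mul, one_div_mul_eq_div, mul_assoc]
    linarith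
  have b2 : ∀ n, |u (n + 2)| ≤ c₂ * (|x n| + ‖z n‖) := by
    intro n
    have h1 : u (n + 2) = x n + 2 * l₁.re * u (n + 1) - ‖l₁‖ ^ 2 * u n := by simp only [hx]; ring
    have h2 : |u (n + 2)| ≤ |x n| + |2 * l₁.re| * |u (n + 1)| + ‖l₁‖ ^ 2 * |u n| := by
      rw [h1]
      refine (abs_sub _ _).trans (add_le_add ((abs_add_le _ _).trans ?_) ?_)
      · rw [abs_mul]
      · rw [abs_mul, abs_of_nonneg (by positivity : (0 : ℝ) ≤ ‖l₁‖ ^ 2)]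
    have h3 := mul_le_mul_of_nonneg_left (b1 n) (abs_nonneg (2 * l₁.re))
    have h4 := mul_le_mul_of_nonneg_left (b0 n) (by positivity : (0 : ℝ) ≤ ‖l₁‖ ^ 2)
    rw [hc₂]
    nlinarith [norm_nonneg (z n)]
  have hpos : ∀ n, 0 < |x n| + ‖z n‖ := by
    intro n
    by_contra h
    have h' : |x n| + ‖z n‖ = 0 := le_antisymm (not_lt.1 h) (by positivity)
    have a0 := b0 n
    have a1 := b1 n
    have a2 := b2 n
    rw [h', mul_zero] at a0 a1 a2
    rcases hne n with g | g | g
    · exact g (abs_nonpos_iff.1 a0)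
    · exact g (abs_nonpos_iff.1 a1)
    · exact g (abs_nonpos_iff.1 a2)
  set ε : ℕ → ℝ := fun n => |p n - P| * c₂ + |q n - Q| * c₁ + |s n - S| * c₀ with hε
  have heb : ∀ n, |e n| ≤ ε n * (|x n| + ‖z n‖) := by
    intro n
    have h1 : |e n| ≤ |p n - P| * |u (n + 2)| + |q n - Q| * |u (n + 1)| + |s n - S| * |u n| := by
      simp only [he]
      refine (abs_add_le _ _).trans (add_le_add ((abs_sub _ _).trans (add_le_add ?_ ?_)) ?_) <;>
        rw [abs_mul]
    have h2 := mul_le_mul_of_nonneg_left (b2 n) (abs_nonneg (p n - P))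
    have h3 := mul_le_mul_of_nonneg_left (b1 n) (abs_nonneg (q n - Q))
    have h4 := mul_le_mul_of_nonneg_left (b0 n) (abs_nonneg (s n - S))
    simp only [hε]
    linarith
  have hε0 : Tendsto ε atTop (𝓝 0) := by
    have h1 : ∀ {f : ℕ → ℝ} {A : ℝ} (c : ℝ), Tendsto f atTop (𝓝 A) →
        Tendsto (fun n => |f n - A| * c) atTop (𝓝 0) := by
      intro f A c hf
      have := ((hf.sub_const A).abs).mul_const c
      simpa using this
    simpa using ((h1 c₂ hp).add (h1 c₁ hq)).add (h1 c₀ hs)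
  have hl3 : 0 < l₃ := hρ.trans hl
  rcases growth_dichotomy (X := fun n => |x n|) (Z := fun n => ‖z n‖) (ε := ε) hρ hl
    (fun n => abs_nonneg _) (fun n => norm_nonneg _) hpos
    (fun n => by
      have h1 : |l₃ * x n| = l₃ * |x n| := by rw [abs_mul, abs_of_pos hl3]
      have h2 := abs_abs_sub_abs_le (x (n + 1)) (l₃ * x n)
      rw [h1, hxe, add_sub_cancel_left] at h2
      rw [hxe]
      exact h2.trans (heb n))
    (fun n => by
      have h2 := abs_norm_sub_norm_le (z (n + 1)) (l₁ * z n)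
      rw [norm_mul, hze, add_sub_cancel_left, Complex.norm_real, Real.norm_eq_abs] at h2
      rw [hze]
      exact h2.trans (heb n)) hε0 with ⟨hXp, hZX, hrat⟩ | ⟨hZp, hXZ, hrat⟩
  · left
    have hroot := tendsto_root_of_ratio hl3 hXp hrat
    have hlow : ∀ᶠ n in atTop, 1 / (2 * D ^ 2) * |x n| ≤ |u n| := by
      -- The x-part of l₁.im · u(n) is l₁.im · x(n)/D^2; this threshold makes the z-part at most
      -- half of it.
      filter_upwards [hXp, hZX.eventually_lt_const (by positivity : 0 < |l₁.im| / (2 * D))]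
        with n hn hzn
      rw [div_lt_iff₀ hn] at hzn
      have h1 : l₁.im * u n = l₁.im * x n / D ^ 2 - (z n / (l₃ - l₁)).im := by
        rw [hu0, sub_div, Complex.sub_im]
        congr 1
        rw [Complex.div_im, Complex.normSq_eq_norm_sq, ← hDdef]
        simp
        ring
      have h2 : |(z n / (l₃ - l₁)).im| ≤ ‖z n‖ / D := by
        refine (Complex.abs_im_le_norm _).trans ?_
        rw [norm_div]
      have h3 : |l₁.im * x n / D ^ 2| ≤ |l₁.im * u n| + ‖z n‖ / D := by
        have : l₁.im * x n / D ^ 2 = l₁.im * u n + (z n / (l₃ - l₁)).im := by rw [h1]; ring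
        rw [this]
        exact (abs_add_le _ _).trans (by gcongr)
      rw [abs_div, abs_mul, abs_mul, abs_of_pos (by positivity : 0 < D ^ 2)] at h3
      have h4 : ‖z n‖ / D ≤ |l₁.im| * |x n| / (2 * D ^ 2) := by
        rw [div_le_div_iff₀ hD0 (by positivity)]
        have := mul_le_mul_of_nonneg_right hzn.le (by positivity : 0 ≤ 2 * D ^ 2)
        calc ‖z n‖ * (2 * D ^ 2) ≤ |l₁.im| / (2 * D) * |x n| * (2 * D ^ 2) := this
          _ = _ := by field_simp
      have h5 : |l₁.im| * (1 / (2 * D ^ 2) * |x n|) ≤ |l₁.im| * |u n| := by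
        have : |l₁.im| * |x n| / D ^ 2 = |l₁.im| * (1 / (2 * D ^ 2) * |x n|) +
          |l₁.im| * |x n| / (2 * D ^ 2) := by field_simp; ring
        linarith
      exact le_of_mul_le_mul_left h5 him0
    have hup : ∀ᶠ n in atTop, |u n| ≤ 2 * c₀ * |x n| := by
      filter_upwards [hXp, hZX.eventually_lt_const one_pos] with n hn hzn
      rw [div_lt_one hn] at hzn
      nlinarith [b0 n]
    refine tendsto_of_tendsto_of_tendsto_of_le_of_le'
      (tendsto_const_mul_root (by positivity : 0 < 1 / (2 * D ^ 2)) hXp hroot)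
      (tendsto_const_mul_root (by positivity : 0 < 2 * c₀) hXp hroot) ?_ ?_
    · filter_upwards [hlow] with n hn
      exact Real.rpow_le_rpow (by positivity) hn (by positivity)
    · filter_upwards [hup] with n hn
      exact Real.rpow_le_rpow (by positivity) hn (by positivity)
  · right
    have hroot := tendsto_root_of_ratio hρ hZp hrat
    set K := 1 + ‖l₂ + l₃‖ + ‖l₂ * l₃‖ with hK
    refine limsup_root_eq (C := 2 * c₀ + K) (by positivity) hZp hroot ?_ ?_
    · filter_upwards [hZp, hXZ.eventually_lt_const one_pos] with n hn hzn
      rw [div_lt_one hn] at hzn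
      have : 0 ≤ K * ‖z n‖ := by positivity
      nlinarith [b0 n]
    · refine Eventually.of_forall fun n => ?_
      have h1 : ‖z n‖ ≤ |u (n + 2)| + ‖l₂ + l₃‖ * |u (n + 1)| + ‖l₂ * l₃‖ * |u n| := by
        simp only [hz]
        refine (norm_add_le _ _).trans (add_le_add ((norm_sub_le _ _).trans (add_le_add ?_ ?_)) ?_)
        · rw [Complex.norm_real, Real.norm_eq_abs]
        · rw [norm_mul, Complex.norm_real, Real.norm_eq_abs]
        · rw [norm_mul, Complex.norm_real, Real.norm_eq_abs]
      refine h1.trans ?_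
      have g1 := norm_nonneg (l₂ + (l₃ : ℂ))
      have g2 := norm_nonneg (l₂ * (l₃ : ℂ))
      have g3 := abs_nonneg (u n)
      have g4 := abs_nonneg (u (n + 1))
      have g5 := abs_nonneg (u (n + 2))
      have : |u (n + 2)| + ‖l₂ + l₃‖ * |u (n + 1)| + ‖l₂ * l₃‖ * |u n| ≤
          K * (|u n| + |u (n + 1)| + |u (n + 2)|) := by
        rw [hK]
        nlinarith [mul_nonneg g1 g3, mul_nonneg g1 g5, mul_nonneg g2 g4, mul_nonneg g2 g5]
      refine this.trans (mul_le_mul_of_nonneg_right (by linarith) (by positivity))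

end
end WellPoised

namespace WellPoised
noncomputable section

/-! ### Bounds of the coefficients of partial fractions -/

/-- The coefficients of `f` are bounded by those of a geometric series. -/
def CoeffBound (f : PowerSeries ℚ) (K N : ℚ) : Prop :=
  ∀ i, |PowerSeries.coeff i f| ≤ K * N ^ i

/-- The convolution of N^p and N'^q is dominated by the binomial expansion of (N + N')^i, so the
rates add: N counts factors and costs only a polynomial in n for fixed i. -/
lemma CoeffBound.mul {f g : PowerSeries ℚ} {K N K' N' : ℚ} (hf : CoeffBound f K N)
    (hg : CoeffBound g K' N') (hK : 0 ≤ K) (hK' : 0 ≤ K') (hN : 0 ≤ N) (hN' : 0 ≤ N') :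
    CoeffBound (f * g) (K * K') (N + N') := by
  intro i
  rw [PowerSeries.coeff_mul, (Commute.all N N').add_pow', Finset.mul_sum]
  refine (Finset.abs_sum_le_sum_abs _ _).trans (Finset.sum_le_sum fun m hm => ?_)
  rw [abs_mul]
  have h1 : (1 : ℚ) ≤ (i.choose m.1 : ℚ) := by
    have := Finset.HasAntidiagonal.mem_antidiagonal.1 hm
    exact_mod_cast Nat.choose_pos (by omega : m.1 ≤ i)
  calc _ ≤ (K * N ^ m.1) * (K' * N' ^ m.2) :=
        mul_le_mul (hf _) (hg _) (abs_nonneg _) (by positivity)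
    _ = K * K' * (1 * (N ^ m.1 * N' ^ m.2)) := by ring
    _ ≤ _ := by rw [nsmul_eq_mul]; gcongr

lemma CoeffBound.prod {ι : Type*} (s : Finset ι) {f : ι → PowerSeries ℚ} {K : ι → ℚ}
    (hf : ∀ i ∈ s, CoeffBound (f i) (K i) 1) (hK : ∀ i ∈ s, 0 ≤ K i) :
    CoeffBound (∏ i ∈ s, f i) (∏ i ∈ s, K i) s.card := by
  classical
  induction s using Finset.induction_on with
  | empty =>
    intro i
    rw [Finset.prod_empty, PowerSeries.coeff_one]
    split_ifs with h <;> simp [h]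
  | insert a s ha ih =>
    rw [Finset.prod_insert ha, Finset.prod_insert ha, Finset.card_insert_of_notMem ha]
    push_cast
    rw [add_comm (s.card : ℚ)]
    exact (hf a (by simp)).mul (ih (fun i hi => hf i (by simp [hi])) fun i hi => hK i (by simp [hi]))
      (hK a (by simp)) (Finset.prod_nonneg fun i hi => hK i (by simp [hi])) zero_le_one
      (by positivity)

lemma CoeffBound.pow {f : PowerSeries ℚ} {K N : ℚ} (hf : CoeffBound f K N) (hK : 0 ≤ K)
    (hN : 0 ≤ N) (e : ℕ) : CoeffBound (f ^ e) (K ^ e) (e * N) := by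
  induction e with
  | zero =>
    intro i
    rw [pow_zero, PowerSeries.coeff_one]
    split_ifs with h <;> simp [h]
  | succ e ih =>
    rw [pow_succ, pow_succ]
    push_cast
    rw [add_mul, one_mul]
    exact ih.mul hf (by positivity) hK (by positivity) hN

lemma coeffBound_linear {c K : ℚ} (hc : |c| ≤ K) (hK : 1 ≤ K) :
    CoeffBound (PowerSeries.X + PowerSeries.C c) K 1 := by
  intro i
  rw [one_pow, mul_one, map_add, PowerSeries.coeff_X, PowerSeries.coeff_C]
  rcases i with _ | _ | i
  · simpa using hc
  · simpa using hK
  · simp; linarith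

/-- The inverse is the geometric series with coefficients ±c^(-i-1), and |c| ≥ 1 makes all of them
at most 1/|c|. -/
lemma coeffBound_linear_inv {c : ℚ} (hc : 1 ≤ |c|) :
    CoeffBound (PowerSeries.X + PowerSeries.C c)⁻¹ |c|⁻¹ 1 := by
  have hc0 : c ≠ 0 := by rintro rfl; norm_num at hc
  have hinv : (PowerSeries.X + PowerSeries.C c)⁻¹ =
      PowerSeries.mk fun i => c⁻¹ * (-c⁻¹) ^ i := by
    rw [PowerSeries.inv_eq_iff_mul_eq_one (by simpa using hc0)]
    ext i
    rw [mul_add, map_add, mul_comm _ (PowerSeries.C c), PowerSeries.coeff_C_mul,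
      PowerSeries.coeff_mk, PowerSeries.coeff_one]
    rcases i with _ | i
    · simp [hc0]
    · rw [PowerSeries.coeff_succ_mul_X, PowerSeries.coeff_mk]
      simp only [Nat.succ_ne_zero, if_false, pow_succ]
      field_simp
      ring
  intro i
  rw [hinv, PowerSeries.coeff_mk, abs_mul, abs_pow, abs_neg, abs_inv, one_pow, mul_one]
  exact mul_le_of_le_one_right (by positivity) (pow_le_one₀ (by positivity) (inv_le_one_of_one_le₀ hc))

lemma prod_inv_powerSeries {ι : Type*} (s : Finset ι) (f : ι → PowerSeries ℚ) :
    (∏ i ∈ s, f i)⁻¹ = ∏ i ∈ s, (f i)⁻¹ := by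
  classical
  induction s using Finset.induction_on with
  | empty => simp
  | insert a s ha ih =>
    rw [Finset.prod_insert ha, Finset.prod_insert ha, PowerSeries.mul_inv_rev, ih, mul_comm]

lemma pow_inv_powerSeries (f : PowerSeries ℚ) (e : ℕ) : (f ^ e)⁻¹ = f⁻¹ ^ e := by
  rw [← Finset.card_range e, ← Finset.prod_const, prod_inv_powerSeries, Finset.prod_const]

lemma prod_Icc_eq_choose (n k : ℕ) :
    ∏ j ∈ Finset.Icc 1 n, ((k : ℚ) + j) = n.factorial * (n + k).choose n := by
  have h : ∏ j ∈ Finset.Icc 1 n, (k + j) = (k + 1).ascFactorial n := by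
    rw [Nat.ascFactorial_eq_prod_range, ← Finset.Ico_add_one_right_eq_Icc,
      Finset.prod_Ico_eq_prod_range]
    exact Finset.prod_congr (by simp) fun i _ => by ring
  rw [Nat.ascFactorial_eq_factorial_mul_choose, add_comm k n] at h
  exact_mod_cast h

lemma prod_Icc_sub_eq_choose {n k : ℕ} (hk : k ≤ n) :
    ∏ j ∈ Finset.Icc (n + 1) (2 * n), ((j : ℚ) - k) = n.factorial * (2 * n - k).choose n := by
  have h := prod_Icc_eq_choose n (n - k)
  rw [show n + (n - k) = 2 * n - k by omega] at h
  rw [← h, ← Finset.Ico_add_one_right_eq_Icc, ← Finset.Ico_add_one_right_eq_Icc,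
    Finset.prod_Ico_eq_prod_range, Finset.prod_Ico_eq_prod_range]
  refine Finset.prod_congr (by congr 1; omega) fun i _ => ?_
  push_cast [hk]
  ring

lemma prod_erase_abs {n k : ℕ} (hk : k ≤ n) :
    ∏ j ∈ (Finset.range (n + 1)).erase k, |(j : ℚ) - k| = k.factorial * (n - k).factorial := by
  have h1 : (Finset.range (n + 1)).erase k = Finset.range k ∪ Finset.Ico (k + 1) (n + 1) := by
    ext j
    simp only [Finset.mem_erase, Finset.mem_range, Finset.mem_union, Finset.mem_Ico]
    omega
  have hd : Disjoint (Finset.range k) (Finset.Ico (k + 1) (n + 1)) := by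
    rw [Finset.disjoint_left]
    intro j
    simp only [Finset.mem_range, Finset.mem_Ico]
    omega
  rw [h1, Finset.prod_union hd]
  congr 1
  · rw [← Finset.prod_range_add_one_eq_factorial, ← Finset.prod_range_reflect]
    push_cast
    refine Finset.prod_congr rfl fun j hj => ?_
    have hj' : j + 1 ≤ k := by simpa using hj
    rw [show k - 1 - j = k - (j + 1) by omega, Nat.cast_sub hj', sub_sub_cancel_left, abs_neg]
    push_cast
    exact abs_of_nonneg (by positivity)
  · rw [← Finset.prod_range_add_one_eq_factorial, Finset.prod_Ico_eq_prod_range]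
    push_cast
    refine Finset.prod_congr (by simp) fun j _ => ?_
    rw [show (k : ℚ) + 1 + j - k = j + 1 by ring]
    exact abs_of_nonneg (by positivity)

/-- R_n(t)(t+k)^3 expanded at -k is a product of linear factors and inverses of linear factors. The
bounds of their constant terms multiply to the binomials, all factorials n! cancelling. -/
theorem abs_laurentCoeff_le {n k : ℕ} (hk : k ≤ n) (i : ℕ) :
    |laurentCoeff n k i| ≤ (n + 1) * ((n + k).choose n ^ 2 * (2 * n - k).choose n ^ 2 *
      n.choose k ^ 3) * (7 * n + 1) ^ i := by
  have hkn : (k : ℚ) ≤ n := by exact_mod_cast hk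
  have hnum : (((num n).comp (X - C (k : ℚ)) : ℚ[X]) : PowerSeries ℚ) =
      PowerSeries.C ((-1) ^ (n + 1) / (n.factorial : ℚ)) *
        (PowerSeries.X + PowerSeries.C ((n : ℚ) / 2 - k)) *
      ((∏ j ∈ Finset.Icc 1 n, (PowerSeries.X + PowerSeries.C (-(k + j : ℚ)))) *
        ∏ j ∈ Finset.Icc (n + 1) (2 * n), (PowerSeries.X + PowerSeries.C ((j : ℚ) - k))) ^ 2 := by
    have : (num n).comp (X - C (k : ℚ)) = C ((-1) ^ (n + 1) / (n.factorial : ℚ)) *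
        (X + C ((n : ℚ) / 2 - k)) * ((∏ j ∈ Finset.Icc 1 n, (X + C (-(k + j : ℚ)))) *
        ∏ j ∈ Finset.Icc (n + 1) (2 * n), (X + C ((j : ℚ) - k))) ^ 2 := by
      have e1 : ∏ j ∈ Finset.Icc 1 n, (X + C (-(k + j : ℚ))) =
          ∏ j ∈ Finset.Icc 1 n, ((X : ℚ[X]) - C (k : ℚ) - C (j : ℚ)) :=
        Finset.prod_congr rfl fun j _ => by rw [map_neg, map_add]; ring
      have e2 : ∏ j ∈ Finset.Icc (n + 1) (2 * n), (X + C ((j : ℚ) - k)) =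
          ∏ j ∈ Finset.Icc (n + 1) (2 * n), ((X : ℚ[X]) - C (k : ℚ) + C (j : ℚ)) :=
        Finset.prod_congr rfl fun j _ => by rw [map_sub]; ring
      rw [e1, e2, num, map_sub]
      simp only [mul_comp, C_comp, add_comp, X_comp, pow_comp, prod_comp, sub_comp]
      ring
    rw [this]
    simp only [← Polynomial.coeToPowerSeries.ringHom_apply, map_prod, map_mul, map_add, map_pow]
    simp only [Polynomial.coeToPowerSeries.ringHom_apply, Polynomial.coe_C, Polynomial.coe_X]
  have hden : (((denErase n k).comp (X - C (k : ℚ)) : ℚ[X]) : PowerSeries ℚ) =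
      (∏ j ∈ (Finset.range (n + 1)).erase k,
        (PowerSeries.X + PowerSeries.C ((j : ℚ) - k))) ^ 3 := by
    have : (denErase n k).comp (X - C (k : ℚ)) =
        (∏ j ∈ (Finset.range (n + 1)).erase k, (X + C ((j : ℚ) - k))) ^ 3 := by
      simp only [denErase, C_comp, add_comp, X_comp, pow_comp, prod_comp, map_sub]
      congr 1
      exact Finset.prod_congr rfl fun j _ => by ring
    rw [this]
    simp only [← Polynomial.coeToPowerSeries.ringHom_apply, map_prod, map_add, map_pow]
    simp only [Polynomial.coeToPowerSeries.ringHom_apply, Polynomial.coe_C, Polynomial.coe_X]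
  have h1 : CoeffBound (PowerSeries.C ((-1) ^ (n + 1) / (n.factorial : ℚ))) (1 / n.factorial) 0 := by
    intro i
    rw [PowerSeries.coeff_C]
    split_ifs with h
    · simp [h, abs_div]
    · simp [h]
  have h2 : CoeffBound (PowerSeries.X + PowerSeries.C ((n : ℚ) / 2 - k)) (n + 1) 1 := by
    refine coeffBound_linear ?_ (by linarith [(Nat.cast_nonneg n : (0 : ℚ) ≤ n)])
    have hk0 : (0 : ℚ) ≤ k := by positivity
    rw [abs_le]
    constructor <;> linarith
  have h3 := CoeffBound.prod (Finset.Icc 1 n)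
    (f := fun j => PowerSeries.X + PowerSeries.C (-(k + j : ℚ))) (K := fun j => (k : ℚ) + j)
    (fun j hj => by
      have hj1 : (1 : ℚ) ≤ j := by exact_mod_cast (Finset.mem_Icc.1 hj).1
      have hk0 : (0 : ℚ) ≤ k := by positivity
      refine coeffBound_linear ?_ (by linarith)
      rw [abs_neg, abs_of_nonneg (by linarith)]) fun j _ => by positivity
  have h4 := CoeffBound.prod (Finset.Icc (n + 1) (2 * n))
    (f := fun j => PowerSeries.X + PowerSeries.C ((j : ℚ) - k)) (K := fun j => (j : ℚ) - k)
    (fun j hj => by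
      have hj1 : ((n + 1 : ℕ) : ℚ) ≤ j := by exact_mod_cast (Finset.mem_Icc.1 hj).1
      push_cast at hj1
      refine coeffBound_linear ?_ (by linarith)
      rw [abs_of_nonneg (by linarith)]) fun j hj => by
        have hj1 : ((n + 1 : ℕ) : ℚ) ≤ j := by exact_mod_cast (Finset.mem_Icc.1 hj).1
        push_cast at hj1
        linarith
  have h5 := CoeffBound.prod ((Finset.range (n + 1)).erase k)
    (f := fun j => (PowerSeries.X + PowerSeries.C ((j : ℚ) - k))⁻¹)
    (K := fun j => |(j : ℚ) - k|⁻¹)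
    (fun j hj => by
      refine coeffBound_linear_inv ?_
      have hne : ((j : ℤ) - k) ≠ 0 := by
        have := (Finset.mem_erase.1 hj).1
        omega
      have := Int.one_le_abs hne
      exact_mod_cast this) fun j _ => by positivity
  rw [prod_Icc_eq_choose] at h3
  rw [prod_Icc_sub_eq_choose hk] at h4
  rw [Finset.prod_inv_distrib, prod_erase_abs hk] at h5
  have hmain := ((h1.mul h2 (by positivity) (by positivity) le_rfl zero_le_one).mul
    ((h3.mul h4 (by positivity) (by positivity) (by positivity) (by positivity)).pow
      (by positivity) (by positivity) 2) (by positivity) (by positivity) (by positivity)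
      (by positivity)).mul (h5.pow (by positivity) (by positivity) 3) (by positivity)
      (by positivity) (by positivity) (by positivity)
  have hc := hmain i
  rw [laurentCoeff, hnum, hden, pow_inv_powerSeries, prod_inv_powerSeries]
  refine hc.trans (le_of_eq ?_)
  -- The rate counts linear factors: 1 from t + n/2, 4n from the squared numerator, 3n from the
  -- cubed denominator.
  have hN : (0 : ℚ) + 1 + (2 : ℕ) * (((Finset.Icc 1 n).card : ℚ) +
      ((Finset.Icc (n + 1) (2 * n)).card : ℚ)) +
      (3 : ℕ) * (((Finset.range (n + 1)).erase k).card : ℚ) = 7 * n + 1 := by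
    rw [Nat.card_Icc, Nat.card_Icc, Finset.card_erase_of_mem (Finset.mem_range.2 (by omega)),
      Finset.card_range, show 2 * n + 1 - (n + 1) = n by omega, Nat.add_sub_cancel]
    push_cast
    ring
  rw [hN]
  congr 1
  have hch : (n.choose k : ℚ) * (k.factorial * (n - k).factorial) = n.factorial := by
    rw [← mul_assoc]
    exact_mod_cast Nat.choose_mul_factorial_mul_factorial hk
  have hf : (n.factorial : ℚ) ≠ 0 := by positivity
  have hf' : (k.factorial * (n - k).factorial : ℚ) ≠ 0 := by positivity
  have hinv : (k.factorial * (n - k).factorial : ℚ)⁻¹ = n.choose k / n.factorial := by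
    have hc0 : (n.choose k : ℚ) ≠ 0 := by exact_mod_cast (Nat.choose_pos hk).ne'
    rw [← hch]; field_simp
  rw [hinv]
  field_simp

/-! ### The exponential bound for the binomial product. -/

lemma choose_mul_le (N j p q : ℕ) (h : j ≤ N) :
    N.choose j * (p ^ j * q ^ (N - j)) ≤ (p + q) ^ N := by
  rw [add_pow]
  refine le_trans (le_of_eq ?_) (Finset.single_le_sum (f := fun m => p ^ m * q ^ (N - m) *
    N.choose m) (fun _ _ => Nat.zero_le _) (Finset.mem_range.2 (Nat.lt_succ_of_le h)))
  ring

/-- Each binomial is bounded by one term of (p+q)^N, with weights (7,3), (7,4) and (3,4). The first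
binomial, which occurs squared in the coefficient bound, is here to the first power, since the
differenced series absorbs one copy. -/
lemma choose_product_le (k m : ℕ) :
    ((k + m) + k).choose (k + m) * ((k + m) + m).choose (k + m) ^ 2 * (k + m).choose k ^ 3 ≤
      150 ^ (k + m) := by
  have h1 := choose_mul_le ((k + m) + k) (k + m) 7 3 (by omega)
  have h2 := choose_mul_le ((k + m) + m) (k + m) 7 4 (by omega)
  have h3 := choose_mul_le (k + m) k 3 4 (by omega)
  rw [Nat.add_sub_cancel_left] at h1 h2 h3
  norm_num at h1 h2 h3
  have h := Nat.mul_le_mul (Nat.mul_le_mul h1 (Nat.pow_le_pow_left h2 2)) (Nat.pow_le_pow_left h3 3)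
  set T := ((k + m) + k).choose (k + m) * ((k + m) + m).choose (k + m) ^ 2 * (k + m).choose k ^ 3
    with hT
  have e1 : ((k + m) + k).choose (k + m) * (7 ^ (k + m) * 3 ^ k) *
      (((k + m) + m).choose (k + m) * (7 ^ (k + m) * 4 ^ m)) ^ 2 *
      ((k + m).choose k * (3 ^ k * 4 ^ m)) ^ 3 =
      (7 ^ (k + m)) ^ 3 * (T * (81 ^ k * 1024 ^ m)) := by
    rw [hT, show (81 : ℕ) ^ k = 3 ^ (4 * k) by rw [pow_mul]; norm_num,
      show (1024 : ℕ) ^ m = 4 ^ (5 * m) by rw [pow_mul]; norm_num]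
    ring
  have e2 : 10 ^ ((k + m) + k) * (11 ^ ((k + m) + m)) ^ 2 * (7 ^ (k + m)) ^ 3 =
      (7 ^ (k + m)) ^ 3 * (12100 ^ k * 146410 ^ m) := by
    rw [show (12100 : ℕ) ^ k = 10 ^ (2 * k) * 11 ^ (2 * k) by
        rw [pow_mul, pow_mul, ← mul_pow]; norm_num,
      show (146410 : ℕ) ^ m = 10 ^ m * 11 ^ (4 * m) by rw [pow_mul, ← mul_pow]; norm_num]
    ring
  rw [e1, e2] at h
  have h' := Nat.le_of_mul_le_mul_left h (by positivity)
  -- The weights balance both ends: 12100/81 ≈ 149.4 and 146410/1024 ≈ 143.0.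
  have h4 : 12100 ^ k * 146410 ^ m ≤ 150 ^ (k + m) * (81 ^ k * 1024 ^ m) := by
    calc 12100 ^ k * 146410 ^ m ≤ (150 * 81) ^ k * (150 * 1024) ^ m := by gcongr <;> norm_num
      _ = _ := by rw [mul_pow, mul_pow, pow_add]; ring
  exact Nat.le_of_mul_le_mul_right (h'.trans h4) (by positivity)

end
end WellPoised

namespace WellPoised
noncomputable section

/-! ### Repeated differences -/

/-- The `n`-th iterate of the operator `f ↦ f x - f (x + 1)`. -/
def altDiff (f : ℝ → ℝ) : ℕ → ℝ → ℝ
  | 0, x => f x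
  | n + 1, x => altDiff f n x - altDiff f n (x + 1)

lemma altDiff_eq (f : ℝ → ℝ) (n : ℕ) (x : ℝ) :
    altDiff f n x = (-1) ^ n * ((fwdDiff (1 : ℝ))^[n] f) x := by
  induction n generalizing x with
  | zero => simp [altDiff]
  | succ n ih =>
    rw [altDiff, ih, ih, Function.iterate_succ_apply', fwdDiff]
    ring

lemma altDiff_polynomial {P : ℝ[X]} {n : ℕ} (h : P.natDegree < n) (x : ℝ) :
    altDiff (fun t => P.eval t) n x = 0 := by
  have := Polynomial.fwdDiff_iter_eq_zero_of_degree_lt h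
  rw [altDiff_eq, this]
  simp

lemma altDiff_add (f g : ℝ → ℝ) (n : ℕ) (x : ℝ) :
    altDiff (fun t => f t + g t) n x = altDiff f n x + altDiff g n x := by
  induction n generalizing x with
  | zero => rfl
  | succ n ih => simp only [altDiff, ih]; ring

lemma altDiff_const_mul (c : ℝ) (f : ℝ → ℝ) (n : ℕ) (x : ℝ) :
    altDiff (fun t => c * f t) n x = c * altDiff f n x := by
  induction n generalizing x with
  | zero => rfl
  | succ n ih => simp only [altDiff, ih]; ring

lemma altDiff_sum {ι : Type*} (s : Finset ι) (f : ι → ℝ → ℝ) (n : ℕ) (x : ℝ) :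
    altDiff (fun t => ∑ i ∈ s, f i t) n x = ∑ i ∈ s, altDiff (f i) n x := by
  induction n generalizing x with
  | zero => rfl
  | succ n ih => simp only [altDiff, ih, Finset.sum_sub_distrib]

lemma altDiff_comp_add (f : ℝ → ℝ) (c : ℝ) (n : ℕ) (x : ℝ) :
    altDiff (fun t => f (t + c)) n x = altDiff f n (x + c) := by
  induction n generalizing x with
  | zero => rfl
  | succ n ih => simp only [altDiff, ih]; rw [add_right_comm]

lemma altDiff_congr {f g : ℝ → ℝ} (h : ∀ x, 0 < x → f x = g x) (n : ℕ) {x : ℝ} (hx : 0 < x) :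
    altDiff f n x = altDiff g n x := by
  induction n generalizing x with
  | zero => exact h x hx
  | succ n ih => simp only [altDiff, ih hx, ih (show 0 < x + 1 by linarith)]

lemma altDiff_eq_zero {f : ℝ → ℝ} (n : ℕ) {x : ℝ} (h : ∀ i ≤ n, f (x + (i : ℕ)) = 0) :
    altDiff f n x = 0 := by
  induction n generalizing x with
  | zero => simpa [altDiff] using h 0 le_rfl
  | succ n ih =>
    rw [altDiff, ih fun i hi => h i (by omega), ih fun i hi => ?_, sub_zero]
    have := h (i + 1) (by omega)
    push_cast at this
    rwa [add_assoc, add_comm (1 : ℝ)]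

/-- Euler's transformation: c(t) - c(t+1) has Abel value 2v + c(1), and the zeros of c at 1, ..., n
kill the boundary term at each of the n steps. -/
lemma AbelValue.altDiff {c : ℝ → ℝ} {v : ℝ} (h : AbelValue c v) {n : ℕ}
    (hz : ∀ i < n, c ((i : ℕ) + 1) = 0) : AbelValue (altDiff c n) (2 ^ n * v) := by
  induction n with
  | zero => rw [pow_zero, one_mul]; exact h.congr fun _ => rfl
  | succ n ih =>
    have h1 := ih fun i hi => hz i (by omega)
    have h2 := h1.add (h1.shift.const_mul (-1))
    rw [altDiff_eq_zero n fun i hi => by rw [add_comm]; exact hz i (by omega)] at h2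
    rw [show (2 : ℝ) ^ n * v + -1 * (-(2 ^ n * v) - 0) = 2 ^ (n + 1) * v by ring] at h2
    exact h2.congr fun ν => by rw [WellPoised.altDiff]; ring

lemma altDiff_mul_left (f : ℝ → ℝ) (n : ℕ) (x : ℝ) :
    altDiff (fun t => t * f t) (n + 1) x =
      (x + n + 1) * altDiff f (n + 1) x - (n + 1) * altDiff f n x := by
  induction n generalizing x with
  | zero => simp only [altDiff]; push_cast; ring
  | succ n ih =>
    rw [altDiff, ih, ih, altDiff.eq_def f (n + 1 + 1)]
    simp only
    rw [altDiff.eq_def f (n + 1) , altDiff.eq_def f (n + 1) (x + 1)]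
    push_cast
    ring

/-- The beta function `n! / (x (x + 1) ... (x + n))`. -/
def betaNat (n : ℕ) (x : ℝ) : ℝ := n.factorial / ∏ i ∈ Finset.range (n + 1), (x + i)

lemma betaNat_zero (x : ℝ) : betaNat 0 x = 1 / x := by simp [betaNat]

lemma betaNat_nonneg (n : ℕ) {x : ℝ} (hx : 0 < x) : 0 ≤ betaNat n x := by
  have : 0 < ∏ i ∈ Finset.range (n + 1), (x + i) := Finset.prod_pos fun i _ => by positivity
  unfold betaNat
  positivity

lemma betaNat_succ (n : ℕ) {x : ℝ} (hx : 0 < x) :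
    (x + n + 1) * betaNat (n + 1) x = (n + 1) * betaNat n x := by
  have h : 0 < ∏ i ∈ Finset.range (n + 1), (x + i) := Finset.prod_pos fun i _ => by positivity
  rw [betaNat, betaNat, Finset.prod_range_succ _ (n + 1), Nat.factorial_succ]
  have h' : x + n + 1 ≠ 0 := by positivity
  push_cast
  rw [← add_assoc]
  field_simp

lemma betaNat_add_one (n : ℕ) {x : ℝ} (hx : 0 < x) :
    (x + n + 1) * betaNat n (x + 1) = x * betaNat n x := by
  have h : 0 < ∏ i ∈ Finset.range (n + 1), (x + i) := Finset.prod_pos fun i _ => by positivity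
  have h1 : 0 < ∏ i ∈ Finset.range (n + 1), (x + 1 + i) := Finset.prod_pos fun i _ => by positivity
  have e := Finset.prod_range_succ (fun i : ℕ => x + (i : ℝ)) (n + 1)
  rw [Finset.prod_range_succ'] at e
  simp only [Nat.cast_add, Nat.cast_one, Nat.cast_zero, add_zero] at e
  have e2 : ∏ i ∈ Finset.range (n + 1), (x + 1 + (i : ℝ)) =
      ∏ i ∈ Finset.range (n + 1), (x + ((i : ℝ) + 1)) :=
    Finset.prod_congr rfl fun i _ => by ring
  rw [betaNat, betaNat, mul_div_assoc', mul_div_assoc', div_eq_div_iff h1.ne' h.ne', e2]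
  linear_combination (-(n.factorial : ℝ)) * e

lemma betaNat_sub (n : ℕ) {x : ℝ} (hx : 0 < x) :
    betaNat n x - betaNat n (x + 1) = betaNat (n + 1) x := by
  have h1 := betaNat_succ n hx
  have h2 := betaNat_add_one n hx
  have h3 : x + n + 1 ≠ 0 := by positivity
  refine mul_left_cancel₀ h3 ?_
  linear_combination -h1 - h2

lemma altDiff_inv (n : ℕ) {x : ℝ} (hx : 0 < x) :
    altDiff (fun t => 1 / t ^ (0 + 1)) n x = betaNat n x := by
  induction n generalizing x with
  | zero => simp [altDiff, betaNat_zero]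
  | succ n ih => rw [altDiff, ih hx, ih (by linarith), betaNat_sub n hx]

/-- This is the Leibniz rule for t · t^(-s-2) = t^(-s-1); it allows a double induction on s and n.
-/
lemma altDiff_inv_pow_succ (s n : ℕ) {x : ℝ} (hx : 0 < x) :
    (x + n + 1) * altDiff (fun t => 1 / t ^ (s + 1 + 1)) (n + 1) x =
      altDiff (fun t => 1 / t ^ (s + 1)) (n + 1) x +
        (n + 1) * altDiff (fun t => 1 / t ^ (s + 1 + 1)) n x := by
  have h := altDiff_mul_left (fun t => 1 / t ^ (s + 1 + 1)) n x
  rw [altDiff_congr (g := fun t => 1 / t ^ (s + 1)) (fun t ht => ?_) _ hx] at h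
  · linarith
  · rw [pow_succ t (s + 1)]
    field_simp

/-- For s = 0 the difference is exactly the beta function. Every further pole order costs only a
factor n+1, so differencing gains as much for higher poles, up to a polynomial. -/
theorem altDiff_inv_pow_bounds (s n : ℕ) {x : ℝ} (hx : 1 ≤ x) :
    0 ≤ altDiff (fun t => 1 / t ^ (s + 1)) n x ∧
      altDiff (fun t => 1 / t ^ (s + 1)) n x ≤ ((n : ℝ) + 1) ^ s * betaNat n x := by
  have hx0 : 0 < x := by linarith
  induction s generalizing n with
  | zero =>
    rw [altDiff_inv n hx0, pow_zero, one_mul]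
    exact ⟨betaNat_nonneg n hx0, le_rfl⟩
  | succ s ihs =>
    induction n with
    | zero =>
      simp only [altDiff, betaNat_zero, Nat.cast_zero, zero_add, one_pow, one_mul]
      refine ⟨by positivity, one_div_le_one_div_of_le hx0 (le_self_pow₀ hx (by omega))⟩
    | succ n ihn =>
      obtain ⟨h1, h2⟩ := ihs (n + 1)
      obtain ⟨h3, h4⟩ := ihn
      have h := altDiff_inv_pow_succ s n hx0
      have hb := betaNat_succ n hx0
      have hb0 := betaNat_nonneg (n + 1) hx0
      have hpos : 0 < x + n + 1 := by positivity
      constructor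
      · refine nonneg_of_mul_nonneg_right ?_ hpos
        rw [h]
        positivity
      · refine le_of_mul_le_mul_left ?_ hpos
        rw [h]
        calc _ ≤ (((n + 1 : ℕ) : ℝ) + 1) ^ s * betaNat (n + 1) x +
              (n + 1) * (((n : ℝ) + 1) ^ (s + 1) * betaNat n x) := by gcongr
          _ = (((n + 1 : ℕ) : ℝ) + 1) ^ s * betaNat (n + 1) x +
              ((n : ℝ) + 1) ^ (s + 1) * ((x + n + 1) * betaNat (n + 1) x) := by rw [hb]; ring
          _ ≤ (((n + 1 : ℕ) : ℝ) + 1) ^ s * ((x + n + 1) * betaNat (n + 1) x) +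
              (n + 1) * (((n + 1 : ℕ) : ℝ) + 1) ^ s * ((x + n + 1) * betaNat (n + 1) x) := by
            gcongr
            · exact le_mul_of_one_le_left hb0 (by linarith [(Nat.cast_nonneg n : (0 : ℝ) ≤ n)])
            · rw [pow_succ, mul_comm]
              gcongr
              linarith
          _ = _ := by push_cast; ring

lemma betaNat_le (n : ℕ) {x : ℝ} (hx : 0 < x) : betaNat n x ≤ 1 / x := by
  induction n with
  | zero => rw [betaNat_zero]
  | succ n ih =>
    have := betaNat_sub n hx
    have := betaNat_nonneg n (show 0 < x + 1 by linarith)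
    linarith

/-- The sum telescopes by `betaNat_sub`, with `betaNat n` tending to 0. -/
lemma hasSum_betaNat (n : ℕ) {x : ℝ} (hx : 0 < x) :
    HasSum (fun ν : ℕ => betaNat (n + 1) (x + ν)) (betaNat n x) := by
  rw [hasSum_iff_tendsto_nat_of_nonneg fun ν => betaNat_nonneg _ (by positivity)]
  have hs : ∀ N : ℕ, ∑ ν ∈ Finset.range N, betaNat (n + 1) (x + ν) =
      betaNat n x - betaNat n (x + N) := by
    intro N
    induction N with
    | zero => simp
    | succ N ih =>
      rw [Finset.sum_range_succ, ih, ← betaNat_sub n (by positivity)]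
      push_cast
      rw [← add_assoc]
      ring
  simp only [hs]
  have h0 : Tendsto (fun N : ℕ => betaNat n (x + N)) atTop (𝓝 0) := by
    have hl : Tendsto (fun N : ℕ => 1 / (x + N)) atTop (𝓝 0) := by
      simp only [one_div]
      exact tendsto_inv_atTop_zero.comp
        (tendsto_atTop_add_const_left _ _ tendsto_natCast_atTop_atTop)
    exact squeeze_zero (fun N => betaNat_nonneg n (by positivity))
      (fun N => betaNat_le n (by positivity)) hl
  simpa using h0.const_sub (betaNat n x)

lemma betaNat_le_inv_choose (n k : ℕ) :
    betaNat n (k + 1) ≤ 1 / ((n + 1 + k).choose (n + 1) : ℝ) := by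
  have h := prod_Icc_eq_choose (n + 1) k
  have h' : ∏ i ∈ Finset.range (n + 1), ((k : ℝ) + 1 + i) =
      (n + 1).factorial * (n + 1 + k).choose (n + 1) := by
    have h2 := congrArg (fun q : ℚ => (q : ℝ)) h
    push_cast at h2
    rw [← h2, ← Finset.Ico_add_one_right_eq_Icc, Finset.prod_Ico_eq_prod_range]
    exact Finset.prod_congr (by simp) fun i _ => by push_cast; ring
  have hc : (0 : ℝ) < (n + 1 + k).choose (n + 1) := by
    exact_mod_cast Nat.choose_pos (by omega)
  have hf : (0 : ℝ) < (n + 1).factorial := by positivity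
  rw [betaNat, h', div_le_div_iff₀ (by positivity) hc, one_mul]
  gcongr
  omega

/-! ### Upper bounds of the linear forms -/

/-- The (n+1)-fold difference annihilates P, multiplies the Abel value by 2^(n+1), and makes the
series absolutely convergent. Each polar term then sums to at most a power of n+2 times |β| ·
betaNat n (k+1), where the beta value is at most the inverse of the binomial in `hβ`. -/
theorem abelValue_le {f : ℝ → ℝ} {n e : ℕ} {β : ℕ → ℕ → ℝ} {P : ℝ[X]} {v M : ℝ}
    (hf : ∀ t, 0 < t → f t = P.eval t +
      ∑ k ∈ Finset.range (n + 1 + 1), ∑ s ∈ Finset.range (e + 1), β k s / (t + k) ^ (s + 1))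
    (hP : P.natDegree < n + 1) (hv : AbelValue f v) (hz : ∀ i < n + 1, f ((i : ℕ) + 1) = 0)
    (hM : 0 ≤ M)
    (hβ : ∀ k ≤ n + 1, ∀ s, |β k s| ≤ M * (n + 1 + k).choose (n + 1)) :
    |v| ≤ (n + 2) * ((e + 1) * (M * ((n : ℝ) + 2) ^ e)) / 2 ^ (n + 1) := by
  have hb : ∀ ν : ℕ, |altDiff f (n + 1) ((ν : ℝ) + 1)| ≤
      ∑ k ∈ Finset.range (n + 1 + 1), ∑ s ∈ Finset.range (e + 1),
        |β k s| * ((n : ℝ) + 2) ^ s * betaNat (n + 1) ((k : ℝ) + 1 + ν) := by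
    intro ν
    rw [altDiff_congr hf _ (by positivity), altDiff_add, altDiff_polynomial hP, zero_add,
      altDiff_sum]
    refine (Finset.abs_sum_le_sum_abs _ _).trans (Finset.sum_le_sum fun k _ => ?_)
    rw [altDiff_sum]
    refine (Finset.abs_sum_le_sum_abs _ _).trans (Finset.sum_le_sum fun s _ => ?_)
    have h1 : altDiff (fun t => β k s / (t + k) ^ (s + 1)) (n + 1) ((ν : ℝ) + 1) =
        β k s * altDiff (fun t => 1 / t ^ (s + 1)) (n + 1) ((k : ℝ) + 1 + ν) := by
      rw [show (k : ℝ) + 1 + ν = (ν : ℝ) + 1 + k by ring,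
        ← altDiff_comp_add (fun t => 1 / t ^ (s + 1)), ← altDiff_const_mul]
      simp only [mul_one_div]
    obtain ⟨h2, h3⟩ := altDiff_inv_pow_bounds s (n + 1) (x := (k : ℝ) + 1 + ν)
      (by have : (0 : ℝ) ≤ k := by positivity
          have : (0 : ℝ) ≤ ν := by positivity
          linarith)
    rw [h1, abs_mul, abs_of_nonneg h2, mul_assoc]
    push_cast at h3
    rw [show (n : ℝ) + 1 + 1 = n + 2 by ring] at h3
    gcongr
  have hsum := hasSum_sum (s := Finset.range (n + 1 + 1)) fun k _ =>
    hasSum_sum (s := Finset.range (e + 1)) fun s _ =>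
      (hasSum_betaNat n (x := (k : ℝ) + 1) (by positivity)).mul_left (|β k s| * ((n : ℝ) + 2) ^ s)
  have hs : Summable fun ν : ℕ => |altDiff f (n + 1) ((ν : ℝ) + 1)| :=
    Summable.of_nonneg_of_le (fun _ => abs_nonneg _) hb hsum.summable
  have h := (hv.altDiff hz).abs_le hs ((hs.tsum_le_tsum hb hsum.summable).trans_eq hsum.tsum_eq)
  rw [abs_mul, abs_of_nonneg (by positivity)] at h
  rw [le_div_iff₀ (by positivity), mul_comm]
  refine h.trans ?_
  have hterm : ∀ k ∈ Finset.range (n + 1 + 1), ∑ s ∈ Finset.range (e + 1),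
      |β k s| * ((n : ℝ) + 2) ^ s * betaNat n ((k : ℝ) + 1) ≤
        (e + 1) * (M * ((n : ℝ) + 2) ^ e) := by
    intro k hk
    have hk' : k ≤ n + 1 := by simp only [Finset.mem_range] at hk; omega
    have hc : (0 : ℝ) < (n + 1 + k).choose (n + 1) := by
      exact_mod_cast Nat.choose_pos (by omega)
    refine (Finset.sum_le_card_nsmul _ _ (M * ((n : ℝ) + 2) ^ e) fun s hs => ?_).trans_eq ?_
    · have hse : s ≤ e := by simp only [Finset.mem_range] at hs; omega
      calc |β k s| * ((n : ℝ) + 2) ^ s * betaNat n ((k : ℝ) + 1)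
          ≤ M * (n + 1 + k).choose (n + 1) * ((n : ℝ) + 2) ^ e *
            (1 / ((n + 1 + k).choose (n + 1) : ℝ)) := by
            gcongr
            · exact betaNat_nonneg n (by positivity)
            · exact hβ k hk' s
            · linarith [(Nat.cast_nonneg n : (0 : ℝ) ≤ n)]
            · exact betaNat_le_inv_choose n k
        _ = _ := by field_simp
    · rw [Finset.card_range, nsmul_eq_mul]; push_cast; ring
  refine (Finset.sum_le_card_nsmul _ _ _ hterm).trans_eq ?_
  rw [Finset.card_range, nsmul_eq_mul]; push_cast; ring

/-- At index N = n+1 the numerator has degree at most 4N+1 and the denominator 3(N+1), so N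
differences annihilate the polynomial part. -/
lemma natDegree_B_lt (n : ℕ) : (B (n + 1)).natDegree < n + 1 := by
  have h : (num (n + 1)).natDegree ≤ 4 * (n + 1) + 1 := by
    rw [num]
    refine natDegree_mul_le.trans ?_
    have h1 : (C ((-1) ^ (n + 1 + 1) / ((n + 1).factorial : ℚ)) *
        (X + C (((n + 1 : ℕ) : ℚ) / 2))).natDegree ≤ 1 :=
      (natDegree_C_mul_le _ _).trans (natDegree_X_add_C _).le
    have h2 : (((∏ j ∈ Finset.Icc 1 (n + 1), (X - C (j : ℚ))) *
        (∏ j ∈ Finset.Icc (n + 1 + 1) (2 * (n + 1)), (X + C (j : ℚ)))) ^ 2).natDegree ≤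
          2 * ((n + 1) + (n + 1)) := by
      refine natDegree_pow_le.trans (Nat.mul_le_mul_left 2 (natDegree_mul_le.trans ?_))
      rw [natDegree_prod_of_monic _ _ fun _ _ => monic_X_sub_C _,
        natDegree_prod_of_monic _ _ fun _ _ => monic_X_add_C _]
      simp only [natDegree_X_sub_C, natDegree_X_add_C, Finset.sum_const, Nat.card_Icc, smul_eq_mul]
      omega
    omega
  rw [B, natDegree_divByMonic _ (den_monic _), natDegree_den]
  omega

lemma hasDerivAt_R {n i : ℕ} (hi : i < n) :
    R n ((i : ℝ) + 1) = 0 ∧ HasDerivAt (R n) 0 ((i : ℝ) + 1) := by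
  refine hasDerivAt_sq_mul (u := fun t => ∏ i ∈ Finset.range n, (t - (i + 1 : ℝ)))
    (g := fun t => (-1) ^ (n + 1) / n.factorial * (t + n / 2) *
      (∏ i ∈ Finset.range n, (t + n + 1 + i)) ^ 2 / (∏ i ∈ Finset.range (n + 1), (t + i)) ^ 3)
    (fun t => ?_) ?_ (by fun_prop) ?_
  · rw [R, aeval_num, aeval_den]
    ring
  · exact Finset.prod_eq_zero (Finset.mem_range.2 hi) (sub_self _)
  · refine DifferentiableAt.div (by fun_prop) (by fun_prop)
      (pow_ne_zero _ (Finset.prod_ne_zero_iff.2 fun i _ => by positivity))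

lemma abs_pfCoeff_le {n k : ℕ} (hk : k ≤ n) (s : ℕ) :
    |pfCoeff n k s| ≤ (n + 1) * 150 ^ n * (7 * n + 1) ^ 2 * (n + k).choose n := by
  rw [pfCoeff]
  split_ifs with h
  · obtain ⟨m, rfl⟩ := Nat.exists_eq_add_of_le hk
    have h1 := abs_laurentCoeff_le hk (2 - s)
    have h2 := choose_product_le k m
    have h1' : |(laurentCoeff (k + m) k (2 - s) : ℝ)| ≤ ((k + m : ℕ) + 1) *
        ((k + m + k).choose (k + m) ^ 2 * (2 * (k + m) - k).choose (k + m) ^ 2 *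
          (k + m).choose k ^ 3) * (7 * (k + m : ℕ) + 1) ^ (2 - s) := by
      exact_mod_cast h1
    rw [show 2 * (k + m) - k = k + m + m by omega] at h1'
    have h2' : ((k + m + k).choose (k + m) : ℝ) * (k + m + m).choose (k + m) ^ 2 *
        (k + m).choose k ^ 3 ≤ 150 ^ (k + m) := by exact_mod_cast h2
    refine h1'.trans ?_
    have h3 : (7 * ((k + m : ℕ) : ℝ) + 1) ^ (2 - s) ≤ (7 * ((k + m : ℕ) : ℝ) + 1) ^ 2 :=
      pow_le_pow_right₀ (by linarith [(Nat.cast_nonneg (k + m) : (0 : ℝ) ≤ (k + m : ℕ))])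
        (Nat.sub_le _ _)
    calc _ = ((k + m : ℕ) + 1) * (((k + m + k).choose (k + m) : ℝ) *
          (k + m + m).choose (k + m) ^ 2 * (k + m).choose k ^ 3) *
          (7 * (k + m : ℕ) + 1) ^ (2 - s) * (k + m + k).choose (k + m) := by ring
      _ ≤ _ := by gcongr
  · rw [abs_zero]; positivity

/-- The factor 3 allows for differentiating a pole of order at most three, so that one statement
serves `r` and `rt`. The constant is 147 = 3 · 7^2, and 75 = 150/2 by the Euler transformation. -/
lemma abelValue_le_of_pfCoeff {f : ℝ → ℝ} {n e : ℕ} {β : ℕ → ℕ → ℝ} {P : ℝ[X]} {v : ℝ}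
    (hf : ∀ t, 0 < t → f t = P.eval t +
      ∑ k ∈ Finset.range (n + 1 + 1), ∑ s ∈ Finset.range (e + 1), β k s / (t + k) ^ (s + 1))
    (hP : P.natDegree < n + 1) (hv : AbelValue f v) (hz : ∀ i < n + 1, f ((i : ℕ) + 1) = 0)
    (hβ : ∀ k s, ∃ s', |β k s| ≤ 3 * |pfCoeff (n + 1) k s'|) :
    |v| ≤ 147 * (e + 1) * ((n : ℝ) + 2) ^ (e + 4) * 75 ^ (n + 1) := by
  have hM : ∀ k ≤ n + 1, ∀ s, |β k s| ≤
      147 * ((n : ℝ) + 2) ^ 3 * (75 ^ (n + 1) * 2 ^ (n + 1)) * (n + 1 + k).choose (n + 1) := by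
    intro k hk s
    obtain ⟨s', hs'⟩ := hβ k s
    have h1 := abs_pfCoeff_le hk s'
    have h0 : (0 : ℝ) ≤ n := by positivity
    refine (hs'.trans (mul_le_mul_of_nonneg_left h1 (by norm_num))).trans ?_
    rw [← mul_pow, show (75 : ℝ) * 2 = 150 by norm_num, ← mul_assoc]
    refine mul_le_mul_of_nonneg_right ?_ (by positivity)
    push_cast
    calc 3 * (((n : ℝ) + 1 + 1) * 150 ^ (n + 1) * (7 * (n + 1) + 1) ^ 2)
        ≤ 3 * (((n : ℝ) + 2) * 150 ^ (n + 1) * (7 * (n + 2)) ^ 2) := by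
          rw [show (n : ℝ) + 1 + 1 = n + 2 by ring]
          gcongr
          linarith
      _ = _ := by ring
  have h := abelValue_le hf hP hv hz (by positivity) hM
  refine h.trans_eq ?_
  rw [div_eq_iff (by positivity)]
  ring

theorem abs_r_le (n : ℕ) : |r (n + 1)| ≤ 735 * ((n : ℝ) + 2) ^ 8 * 75 ^ (n + 1) := by
  have h := abelValue_le_of_pfCoeff (n := n) (e := 4)
    (fun t ht => (hasPF_R (n + 1)).eq t fun j _ => by positivity)
    (natDegree_map_le.trans_lt (natDegree_B_lt n)) (hasContinuedValue_R (n + 1)).abelValue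
    (fun i hi => (hasDerivAt_R hi).1) fun k s => ⟨s, by linarith [abs_nonneg (pfCoeff (n + 1) k s)]⟩
  refine h.trans_eq ?_
  norm_num

theorem abs_rt_le (n : ℕ) : |rt (n + 1)| ≤ 882 * ((n : ℝ) + 2) ^ 9 * 75 ^ (n + 1) := by
  have h := abelValue_le_of_pfCoeff (n := n) (e := 5) (f := negDerivR (n + 1))
    (P := -derivative ((B (n + 1)).map (algebraMap ℚ ℝ)))
    -- Differentiation moves pole order s to s+1 with factor s; hence `e = 5` here against `e = 4`
    -- for `r`.
    (β := fun k s => if s = 0 then 0 else pfCoeff (n + 1) k (s - 1) * s)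
    (fun t ht => ?_) ?_ (hasContinuedValue_negDerivR (n + 1)).abelValue
    (fun i hi => by rw [negDerivR, (hasDerivAt_R hi).2.deriv, neg_zero]) fun k s => ?_
  · refine h.trans_eq ?_
    norm_num
  · rw [negDerivR, ((hasPF_R (n + 1)).hasDerivAt ht).deriv, eval_neg, neg_sub, sub_eq_neg_add]
    congr 1
    refine Finset.sum_congr rfl fun k _ => ?_
    rw [Finset.sum_range_succ' _ 5]
    simp [add_assoc]
  · rw [natDegree_neg]
    exact (natDegree_derivative_le _).trans_lt ((Nat.sub_le _ _).trans_lt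
      (natDegree_map_le.trans_lt (natDegree_B_lt n)))
  · refine ⟨s - 1, ?_⟩
    rcases s with _ | s
    · simp
    · simp only [Nat.succ_ne_zero, if_false, Nat.add_sub_cancel]
      by_cases hs : s < 3
      · rw [abs_mul, mul_comm, abs_of_nonneg (by positivity : (0 : ℝ) ≤ ((s + 1 : ℕ) : ℝ))]
        refine mul_le_mul_of_nonneg_right ?_ (abs_nonneg _)
        exact_mod_cast hs
      · rw [show pfCoeff (n + 1) k s = 0 from if_neg (by omega)]
        simp

end
end WellPoised

namespace WellPoised
noncomputable section

/-! ### Initial values -/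

/-- The k-th inner list is A_k, A'_k, A''_k. Here and for n = 1, 2 the explicit decomposition is a
polynomial identity, and uniqueness turns it into values of `laurentCoeff`. -/
lemma partialFraction_zero : num 0 = 0 * den 0 + ∑ k ∈ Finset.range (0 + 1),
    ∑ i ∈ Finset.range 3, C ((([[0, -1, 0]] : List (List ℚ)).getD k []).getD i 0) *
      (X + C (k : ℚ)) ^ i * denErase 0 k := by
  refine Polynomial.funext fun t => ?_
  simp [num, den, denErase, Finset.sum_range_succ]

lemma partialFraction_one : num 1 = 0 * den 1 + ∑ k ∈ Finset.range (1 + 1),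
    ∑ i ∈ Finset.range 3, C ((([[2, -4, 1 / 2], [2, 4, 1 / 2]] : List (List ℚ)).getD k []).getD i 0) *
      (X + C (k : ℚ)) ^ i * denErase 1 k := by
  have h0 : (Finset.range (1 + 1)).erase 0 = {1} := by decide
  have h1 : (Finset.range (1 + 1)).erase 1 = {0} := by decide
  refine Polynomial.funext fun t => ?_
  simp [num, den, denErase, Finset.sum_range_succ, Finset.prod_range_succ, h0, h1]
  ring

lemma partialFraction_two : num 2 = C (-1 / 2) * den 2 + ∑ k ∈ Finset.range (2 + 1),
    ∑ i ∈ Finset.range 3, C ((([[-36, 192, -2041 / 4], [0, 648, 0], [36, 192, 2041 / 4]] :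
      List (List ℚ)).getD k []).getD i 0) * (X + C (k : ℚ)) ^ i * denErase 2 k := by
  have h0 : (Finset.range (2 + 1)).erase 0 = {1, 2} := by decide
  have h1 : (Finset.range (2 + 1)).erase 1 = {0, 2} := by decide
  have h2 : (Finset.range (2 + 1)).erase 2 = {0, 1} := by decide
  have h3 : Finset.Icc 1 2 = {1, 2} := by decide
  have h4 : Finset.Icc (2 + 1) (2 * 2) = {3, 4} := by decide
  refine Polynomial.funext fun t => ?_
  rw [num, h3, h4, den]
  simp [denErase, Finset.sum_range_succ, Finset.prod_range_succ, h0, h1, h2]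
  norm_num
  ring

lemma polySum_C (c : ℚ) : polySum (C c) = -c / 2 := by
  simp [polySum]
  ring

lemma polySum_zero : polySum 0 = 0 := by simpa using polySum_C 0

theorem initial_zero : a 0 = 1 ∧ b 0 = 0 ∧ bt 0 = 0 := by
  obtain ⟨hB, h⟩ := partialFraction_unique partialFraction_zero
  refine ⟨?_, ?_, ?_⟩
  · simp [a, A', h 0 (by simp) 1 (by simp)]
  · simp [b, hB, polySum_zero]
  · simp [bt, hB, polySum_zero]

theorem initial_one : a 1 = 8 ∧ b 1 = 13 / 2 ∧ bt 1 = 29 / 2 := by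
  obtain ⟨hB, h⟩ := partialFraction_unique partialFraction_one
  have h00 := h 0 (by simp) 0 (by simp)
  have h01 := h 0 (by simp) 1 (by simp)
  have h02 := h 0 (by simp) 2 (by simp)
  have h10 := h 1 (by simp) 0 (by simp)
  have h11 := h 1 (by simp) 1 (by simp)
  have h12 := h 1 (by simp) 2 (by simp)
  simp at h00 h01 h02 h10 h11 h12
  refine ⟨?_, ?_, ?_⟩
  · simp [a, A', Finset.sum_range_succ, *]
    norm_num
  · simp [b, A, A', A'', polySum_zero, Finset.sum_range_succ, *]
    norm_num
  · simp [bt, A, A', A'', polySum_zero, Finset.sum_range_succ, *]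
    norm_num

theorem initial_two : a 2 = 264 ∧ b 2 = 1737 / 8 ∧ bt 2 = 7617 / 16 := by
  obtain ⟨hB, h⟩ := partialFraction_unique partialFraction_two
  have h00 := h 0 (by simp) 0 (by simp)
  have h01 := h 0 (by simp) 1 (by simp)
  have h02 := h 0 (by simp) 2 (by simp)
  have h10 := h 1 (by simp) 0 (by simp)
  have h11 := h 1 (by simp) 1 (by simp)
  have h12 := h 1 (by simp) 2 (by simp)
  have h20 := h 2 (by simp) 0 (by simp)
  have h21 := h 2 (by simp) 1 (by simp)
  have h22 := h 2 (by simp) 2 (by simp)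
  simp at h00 h01 h02 h10 h11 h12 h20 h21 h22
  have h3 : Finset.Icc 1 2 = {1, 2} := by decide
  refine ⟨?_, ?_, ?_⟩
  · simp [a, A', Finset.sum_range_succ, h01, h11, h21]
    norm_num
  · rw [b, hB, polySum_C]
    simp [A, A', A'', Finset.sum_range_succ, h00, h01, h02, h10, h11, h12, h20, h21, h22, h3]
    norm_num
  · rw [bt, hB, derivative_C, neg_zero, polySum_zero]
    simp [A, A', A'', Finset.sum_range_succ, h00, h01, h02, h10, h11, h12, h20, h21, h22, h3]
    norm_num

end
end WellPoised

namespace WellPoised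
noncomputable section

/-! ### Asymptotics -/

/-- All coefficients have degree 6 in m+2; divided by (m+2)^6 they become polynomials in 1/(m+2),
and the limits are ratios of leading coefficients. -/
lemma tendsto_div_of_eval_inv {f g F G : ℕ → ℝ} {L M : ℝ} (hM : M ≠ 0)
    (hF : Tendsto F atTop (𝓝 L)) (hG : Tendsto G atTop (𝓝 M))
    (hf : ∀ m : ℕ, f m = ((m : ℝ) + 2) ^ 6 * F m) (hg : ∀ m : ℕ, g m = ((m : ℝ) + 2) ^ 6 * G m) :
    Tendsto (fun m => f m / g m) atTop (𝓝 (L / M)) := by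
  refine (hF.div hG hM).congr fun m => ?_
  have h : ((m : ℝ) + 2) ^ 6 ≠ 0 := by positivity
  rw [hf, hg, mul_div_mul_left _ _ h]
  rfl

lemma tendsto_comp_inv {F : ℝ → ℝ} {L : ℝ} (hF : ContinuousAt F 0) (h : F 0 = L) :
    Tendsto (fun m : ℕ => F ((m : ℝ) + 2)⁻¹) atTop (𝓝 L) := by
  rw [← h]
  exact hF.tendsto.comp (tendsto_inv_atTop_zero.comp
    (tendsto_atTop_add_const_right _ _ tendsto_natCast_atTop_atTop))

lemma rec3_pos (m : ℕ) : 0 < rec3 m := by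
  have h : rec3 m = (1457 * (m : ℝ) ^ 2 + 4465 * m + 3450) * (m + 3) ^ 4 := by rw [rec3]; ring
  rw [h]
  positivity

lemma rec0_neg (m : ℕ) : rec0 m < 0 := by
  have h : rec0 m = -(3 * (1457 * ((m : ℝ) + 2) ^ 2 + 1551 * (m + 2) + 442) * (3 * m + 4) *
      (3 * m + 2) * (m + 1) ^ 2) := by
    rw [rec0]
    ring
  rw [h, neg_lt_zero]
  positivity

lemma tendsto_rec3 : Tendsto (fun m : ℕ => (fun y : ℝ => (1457 - 1363 * y + 348 * y ^ 2) *
    (1 + y) ^ 4) ((m : ℝ) + 2)⁻¹) atTop (𝓝 1457) :=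
  tendsto_comp_inv (F := fun y : ℝ => (1457 - 1363 * y + 348 * y ^ 2) * (1 + y) ^ 4)
    (by fun_prop) (by norm_num)

lemma rec3_eq (m : ℕ) : rec3 m = ((m : ℝ) + 2) ^ 6 *
    (fun y : ℝ => (1457 - 1363 * y + 348 * y ^ 2) * (1 + y) ^ 4) ((m : ℝ) + 2)⁻¹ := by
  have h : (m : ℝ) + 2 ≠ 0 := by positivity
  rw [rec3]
  field_simp
  ring

lemma tendsto_rec2_div : Tendsto (fun m => -rec2 m / rec3 m) atTop (𝓝 102) := by
  have := tendsto_div_of_eval_inv (f := fun m => -rec2 m) (by norm_num) (tendsto_comp_inv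
    (F := fun y : ℝ => 148614 + 158202 * y - 9295 * y ^ 2 - 61894 * y ^ 3 - 11111 * y ^ 4 +
      8932 * y ^ 5 + 2784 * y ^ 6) (by fun_prop) rfl) tendsto_rec3 (fun m => by
    have h : (m : ℝ) + 2 ≠ 0 := by positivity
    rw [rec2]
    field_simp) rec3_eq
  norm_num at this
  exact this

lemma tendsto_rec1_div : Tendsto (fun m => rec1 m / rec3 m) atTop (𝓝 67) := by
  have := tendsto_div_of_eval_inv (f := rec1) (by norm_num) (tendsto_comp_inv
    (F := fun y : ℝ => 97619 - 91321 * y - 9443 * y ^ 2 + 35343 * y ^ 3 - 5440 * y ^ 4 -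
      5678 * y ^ 5 + 1768 * y ^ 6) (by fun_prop) rfl) tendsto_rec3 (fun m => by
    have h : (m : ℝ) + 2 ≠ 0 := by positivity
    rw [rec1]
    field_simp) rec3_eq
  norm_num at this
  exact this

lemma tendsto_rec0_div : Tendsto (fun m => -rec0 m / rec3 m) atTop (𝓝 27) := by
  have := tendsto_div_of_eval_inv (f := fun m => -rec0 m) (by norm_num) (tendsto_comp_inv
    (F := fun y : ℝ => 3 * (1457 + 1551 * y + 442 * y ^ 2) * (3 - 2 * y) * (3 - 4 * y) *
      (1 - y) ^ 2) (by fun_prop) rfl) tendsto_rec3 (fun m => by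
    have h : (m : ℝ) + 2 ≠ 0 := by positivity
    rw [rec0]
    field_simp
    ring) rec3_eq
  norm_num at this
  exact this

section

variable {u : ℕ → ℝ} {l₁ : ℂ} {l₃ : ℝ}

/-- The conditions that `l₁`, its conjugate, and `l₃` are the roots of
`X ^ 3 - 102 * X ^ 2 + 67 * X - 27`, with `l₁` inside the unit disc in the upper half-plane. -/
structure IsRoots (l₁ : ℂ) (l₃ : ℝ) : Prop where
  sum : 2 * l₁.re + l₃ = 102
  sum_mul : ‖l₁‖ ^ 2 + 2 * l₁.re * l₃ = 67
  prod : ‖l₁‖ ^ 2 * l₃ = 27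
  im_pos : 0 < l₁.im
  norm_lt : ‖l₁‖ < 1
  lt_real : 101 < l₃

lemma IsRoots.growth (h : IsRoots l₁ l₃)
    (hu : ∀ m : ℕ, rec0 m * u m + rec1 m * u (m + 1) + rec2 m * u (m + 2) + rec3 m * u (m + 3) = 0)
    (h0 : u 0 ≠ 0 ∨ u 1 ≠ 0 ∨ u 2 ≠ 0) :
    Tendsto (fun n => |u n| ^ (1 / (n : ℝ))) atTop (𝓝 l₃) ∨
    limsup (fun n : ℕ => ((|u n| ^ (1 / (n : ℝ)) : ℝ) : EReal)) atTop = (‖l₁‖ : EReal) := by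
  refine recurrence_growth h.sum h.sum_mul h.prod h.im_pos.ne' (by linarith [h.norm_lt, h.lt_real])
    tendsto_rec2_div tendsto_rec1_div tendsto_rec0_div (fun n => ?_) h0 fun n => ?_
  · exact div_ne_zero (neg_ne_zero.2 (rec0_neg n).ne) (rec3_pos n).ne'
  · have := (rec3_pos n).ne'
    field_simp
    linarith [hu n]

/-- In powers of m, `rec1` and -`rec2` - `rec1` - `rec3` have positive coefficients only, and `rec0`
is negative. Replacing u(m+1) by the larger u(m+2) in the one unfavourable term then gives u(m+3) ≥
u(m+2). -/
lemma monotone_of_rec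
    (hu : ∀ m : ℕ, rec0 m * u m + rec1 m * u (m + 1) + rec2 m * u (m + 2) + rec3 m * u (m + 3) = 0)
    (h0 : 0 ≤ u 0) (h1 : 0 ≤ u 1) (h2 : u 1 ≤ u 2) (m : ℕ) :
    0 ≤ u m ∧ 0 ≤ u (m + 1) ∧ u (m + 1) ≤ u (m + 2) := by
  induction m with
  | zero => exact ⟨h0, h1, h2⟩
  | succ m ih =>
    obtain ⟨g0, g1, g2⟩ := ih
    refine ⟨g1, g1.trans g2, ?_⟩
    rw [show m + 1 + 1 = m + 2 by omega, show m + 1 + 2 = m + 3 by omega]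
    have e1 : 0 ≤ rec1 m := by
      have : rec1 m = 97619 * (m : ℝ) ^ 6 + 1080107 * (m : ℝ) ^ 5 + 4934487 * (m : ℝ) ^ 4 +
          11925999 * (m : ℝ) ^ 3 + 16102866 * (m : ℝ) ^ 2 + 11531670 * (m : ℝ) + 3425652 := by
        rw [rec1]; ring
      rw [this]
      positivity
    have e2 : rec3 m ≤ -rec2 m - rec1 m := by
      have : -rec2 m - rec1 m - rec3 m = 49538 * (m : ℝ) ^ 6 + 839514 * (m : ℝ) ^ 5 +
          5419370 * (m : ℝ) ^ 4 +
          17604201 * (m : ℝ) ^ 3 + 30828562 * (m : ℝ) ^ 2 + 27848433 * (m : ℝ) + 10200990 := by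
        rw [rec1, rec2, rec3]; ring
      have : 0 ≤ -rec2 m - rec1 m - rec3 m := by
        rw [this]
        positivity
      linarith
    refine le_of_mul_le_mul_left ?_ (rec3_pos m)
    have i1 := mul_le_mul_of_nonneg_right e2 (g1.trans g2)
    have i2 := mul_le_mul_of_nonneg_left g2 e1
    have i3 := mul_nonneg (neg_nonneg.2 (rec0_neg m).le) g0
    linarith [hu m]

/-- A sequence that stays at least 1 has all n-th roots at least 1, which is incompatible with a
limsup ‖l₁‖ < 1. -/
theorem IsRoots.tendsto (h : IsRoots l₁ l₃)
    (hu : ∀ m : ℕ, rec0 m * u m + rec1 m * u (m + 1) + rec2 m * u (m + 2) + rec3 m * u (m + 3) = 0)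
    (h0 : 0 ≤ u 0) (h1 : 1 ≤ u 1) (h2 : u 1 ≤ u 2) :
    Tendsto (fun n => |u n| ^ (1 / (n : ℝ))) atTop (𝓝 l₃) := by
  refine (h.growth hu (Or.inr (Or.inl (by linarith)))).resolve_right fun hl => ?_
  have hm := monotone_of_rec hu h0 (zero_le_one.trans h1) h2
  have hge : ∀ n, 1 ≤ u (n + 1) := by
    intro n
    induction n with
    | zero => exact h1
    | succ n ih => exact ih.trans (hm n).2.2
  have : (1 : EReal) ≤ (‖l₁‖ : EReal) := by
    rw [← hl]
    refine le_limsup_of_frequently_le (Eventually.frequently ?_)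
    filter_upwards [eventually_ge_atTop 1] with n hn
    obtain ⟨k, rfl⟩ := Nat.exists_eq_add_of_le' hn
    have := Real.one_le_rpow ((hge k).trans (le_abs_self _))
      (by positivity : (0 : ℝ) ≤ 1 / ((k + 1 : ℕ) : ℝ))
    exact_mod_cast this
  have h' : (1 : ℝ) ≤ ‖l₁‖ := by exact_mod_cast this
  linarith [h.norm_lt]

/-- Growth at rate l₃ > 101 would give |u_n| ≥ 100^n eventually, against a bound of order 75^n up to
a polynomial. -/
theorem IsRoots.limsup (h : IsRoots l₁ l₃)
    (hu : ∀ m : ℕ, rec0 m * u m + rec1 m * u (m + 1) + rec2 m * u (m + 2) + rec3 m * u (m + 3) = 0)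
    (h0 : u 0 ≠ 0) {K : ℝ} {d : ℕ}
    (hK : ∀ n : ℕ, |u (n + 1)| ≤ K * ((n : ℝ) + 2) ^ d * 75 ^ (n + 1)) :
    Filter.limsup (fun n : ℕ => ((|u n| ^ (1 / (n : ℝ)) : ℝ) : EReal)) atTop = (‖l₁‖ : EReal) := by
  refine (h.growth hu (Or.inl h0)).resolve_left fun hl => ?_
  have h1 : ∀ᶠ n : ℕ in atTop, 100 < |u n| ^ (1 / (n : ℝ)) :=
    hl.eventually_const_lt (by linarith [h.lt_real])
  -- Here 3/4 = 75/100, and 2^d comes from k + 2 ≤ 2(k+1) with n = k+1.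
  have h2 : Tendsto (fun n : ℕ => K * 2 ^ d * ((n : ℝ) ^ d * (3 / 4 : ℝ) ^ n)) atTop (𝓝 0) := by
    simpa using (tendsto_pow_const_mul_const_pow_of_abs_lt_one d
      (show |(3 / 4 : ℝ)| < 1 by rw [abs_of_pos] <;> norm_num)).const_mul (K * 2 ^ d)
  obtain ⟨n, hn, hn2, hn1⟩ := (h1.and ((h2.eventually_lt_const one_pos).and
    (eventually_ge_atTop 1))).exists
  obtain ⟨k, rfl⟩ := Nat.exists_eq_add_of_le' hn1
  have h3 : (100 : ℝ) ^ (k + 1) ≤ |u (k + 1)| := by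
    have := pow_le_pow_left₀ (by norm_num) hn.le (k + 1)
    rwa [← Real.rpow_mul_natCast (abs_nonneg _), one_div,
      inv_mul_cancel₀ (by positivity), Real.rpow_one] at this
  have hK0 : 0 ≤ K := by
    have := (abs_nonneg _).trans (hK 0)
    by_contra hneg
    have h5 : K * (((0 : ℕ) : ℝ) + 2) ^ d * 75 ^ (0 + 1) < 0 :=
      mul_neg_of_neg_of_pos (mul_neg_of_neg_of_pos (not_le.1 hneg) (by positivity)) (by positivity)
    linarith
  have h4 : K * ((k : ℝ) + 2) ^ d * 75 ^ (k + 1) ≤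
      K * 2 ^ d * (((k + 1 : ℕ) : ℝ) ^ d * (3 / 4 : ℝ) ^ (k + 1)) * 100 ^ (k + 1) := by
    have e : K * 2 ^ d * (((k + 1 : ℕ) : ℝ) ^ d * (3 / 4 : ℝ) ^ (k + 1)) * 100 ^ (k + 1) =
        K * (2 * ((k + 1 : ℕ) : ℝ)) ^ d * ((3 / 4) * 100) ^ (k + 1) := by
      rw [mul_pow, mul_pow (3 / 4 : ℝ)]; ring
    rw [e, show (3 / 4 : ℝ) * 100 = 75 by norm_num]
    gcongr
    push_cast
    linarith [(Nat.cast_nonneg k : (0 : ℝ) ≤ k)]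
  have h6 : (0 : ℝ) < 100 ^ (k + 1) := by positivity
  nlinarith [hK k]

end

/-- Only the real zero x is located, by the intermediate value theorem. Vieta's relations then give
the real part (102 - x)/2 and the squared modulus 27/x of the complex zero; the remaining relation
is the cubic equation for x. -/
lemma exists_isRoots : ∃ (l₁ : ℂ) (l₃ : ℝ), IsRoots l₁ l₃ ∧
    (0.32925097 ≤ l₁.re ∧ l₁.re < 0.32925098) ∧ (0.39751691 ≤ l₁.im ∧ l₁.im < 0.39751692) ∧
    (0.51616460 ≤ ‖l₁‖ ∧ ‖l₁‖ < 0.51616461) ∧ (101.34149804 ≤ l₃ ∧ l₃ < 101.34149805) := by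
  -- One more digit than stated leaves room for the digits of the complex zero derived from x.
  obtain ⟨x, hx, hx0⟩ : ∃ x ∈ Set.Ioo (101.341498049 : ℝ) 101.34149805,
      x ^ 3 - 102 * x ^ 2 + 67 * x - 27 = 0 :=
    intermediate_value_Ioo (by norm_num)
      (f := fun x : ℝ => x ^ 3 - 102 * x ^ 2 + 67 * x - 27) (by fun_prop)
      ⟨by norm_num, by norm_num⟩
  obtain ⟨hx1, hx2⟩ := hx
  have hxpos : 0 < x := by linarith
  set p : ℝ := (102 - x) / 2 with hp
  have hq1 : 0.266425901 < 27 / x := by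
    rw [lt_div_iff₀ hxpos]; nlinarith
  have hq2 : 27 / x < 0.266425902 := by
    rw [div_lt_iff₀ hxpos]; nlinarith
  set y : ℝ := √(27 / x - p ^ 2) with hy
  have hp1 : 0.329250975 < p := by rw [hp]; linarith
  have hp2 : p < 0.3292509755 := by rw [hp]; linarith
  have hy2 : y ^ 2 = 27 / x - p ^ 2 := Real.sq_sqrt (by nlinarith)
  have hn : ‖(⟨p, y⟩ : ℂ)‖ ^ 2 = 27 / x := by
    rw [← Complex.normSq_eq_norm_sq, Complex.normSq_apply]
    linarith [hy2]
  have hn0 : 0 ≤ ‖(⟨p, y⟩ : ℂ)‖ := norm_nonneg _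
  have hy0 : 0 ≤ y := Real.sqrt_nonneg _
  have hy3 : 0.39751691 < y := by
    refine lt_of_pow_lt_pow_left₀ 2 hy0 ?_
    rw [hy2]
    nlinarith
  have hy4 : y < 0.39751692 := by
    refine lt_of_pow_lt_pow_left₀ 2 (by norm_num) ?_
    rw [hy2]
    nlinarith
  have hn1 : 0.51616460 < ‖(⟨p, y⟩ : ℂ)‖ := by
    refine lt_of_pow_lt_pow_left₀ 2 hn0 ?_
    rw [hn]
    refine lt_trans ?_ hq1
    norm_num
  have hn2 : ‖(⟨p, y⟩ : ℂ)‖ < 0.51616461 := by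
    refine lt_of_pow_lt_pow_left₀ 2 (by norm_num) ?_
    rw [hn]
    refine hq2.trans ?_
    norm_num
  refine ⟨⟨p, y⟩, x, ⟨?_, ?_, ?_, by simp only; linarith, by linarith, by linarith⟩,
    ⟨by simp only; linarith, by simp only; linarith⟩, ⟨by simp only; linarith, by simp only; linarith⟩,
    ⟨hn1.le, hn2⟩, ⟨by linarith, hx2⟩⟩
  · simp only [hp]; ring
  · rw [hn]
    simp only [hp]
    field_simp
    linarith
  · rw [hn]
    field_simp

lemma IsRoots.factor {l₁ : ℂ} {l₃ : ℝ} (h : IsRoots l₁ l₃) :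
    (X ^ 3 - 102 * X ^ 2 + 67 * X - 27 : ℂ[X]) =
      (X - C l₁) * (X - C ((starRingEnd ℂ) l₁)) * (X - C (l₃ : ℂ)) := by
  have hsum : l₁ + (starRingEnd ℂ) l₁ = ((2 * l₁.re : ℝ) : ℂ) := Complex.add_conj l₁
  have hprod : l₁ * (starRingEnd ℂ) l₁ = ((‖l₁‖ ^ 2 : ℝ) : ℂ) := by
    rw [Complex.mul_conj, Complex.normSq_eq_norm_sq]
  have h1 : l₁ + (starRingEnd ℂ) l₁ + l₃ = 102 := by
    rw [hsum, ← Complex.ofReal_add, h.sum]; norm_num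
  have h2 : l₁ * (starRingEnd ℂ) l₁ + (l₁ + (starRingEnd ℂ) l₁) * l₃ = 67 := by
    rw [hsum, hprod, ← Complex.ofReal_mul, ← Complex.ofReal_add, h.sum_mul]; norm_num
  have h3 : l₁ * (starRingEnd ℂ) l₁ * l₃ = 27 := by
    rw [hprod, ← Complex.ofReal_mul, h.prod]; norm_num
  refine Polynomial.funext fun t => ?_
  simp only [eval_sub, eval_add, eval_mul, eval_pow, eval_X, eval_C, eval_ofNat]
  linear_combination (-t ^ 2) * (-h1) + (-t) * h2 + h3

lemma r_zero_ne_zero : r 0 ≠ 0 := by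
  rw [r_eq, initial_zero.1, initial_zero.2.1]
  have := Real.pi_pos
  norm_num

lemma rt_zero_ne_zero : rt 0 ≠ 0 := by
  obtain ⟨Z, hZ, hl⟩ := exists_zeta_three
  have h0 : Z ≠ 0 := by
    rintro rfl
    exact riemannZeta_ne_zero_of_one_le_re (s := 3) (by norm_num) (by simpa using hZ)
  rw [rt_eq 0 hl, initial_zero.1, initial_zero.2.2]
  simpa using h0

end
end WellPoised

/-! ### Assembly of the theorem. -/

theorem theorem3 :
    -- the values at `z = -1` exist by analytic continuation
    (∀ n : ℕ, WellPoised.HasContinuedValue (WellPoised.R n) (WellPoised.r n)) ∧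
    (∀ n : ℕ, WellPoised.HasContinuedValue (WellPoised.negDerivR n) (WellPoised.rt n)) ∧
    -- they are linear forms with the same leading coefficient
    (∀ n : ℕ, WellPoised.r n = (WellPoised.a n : ℝ) * (Real.pi ^ 2 / 12) - (WellPoised.b n : ℝ)) ∧
    (∀ n : ℕ, (WellPoised.rt n : ℂ)
      = (WellPoised.a n : ℂ) * (3 * riemannZeta 3 / 2) - (WellPoised.bt n : ℂ)) ∧
    -- the recurrence relation
    WellPoised.SatisfiesRecurrence WellPoised.r ∧
    WellPoised.SatisfiesRecurrence WellPoised.rt ∧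
    WellPoised.SatisfiesRecurrence WellPoised.a ∧
    WellPoised.SatisfiesRecurrence WellPoised.b ∧
    WellPoised.SatisfiesRecurrence WellPoised.bt ∧
    -- the initial values
    (WellPoised.a 0 = 1 ∧ WellPoised.a 1 = 8 ∧ WellPoised.a 2 = 264) ∧
    (WellPoised.b 0 = 0 ∧ WellPoised.b 1 = 13 / 2 ∧ WellPoised.b 2 = 1737 / 8) ∧
    (WellPoised.bt 0 = 0 ∧ WellPoised.bt 1 = 29 / 2 ∧ WellPoised.bt 2 = 7617 / 16) ∧
    -- the asymptotics
    (∃ (l₁ l₂ : ℂ) (l₃ : ℝ),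
      (Polynomial.X ^ 3 - 102 * Polynomial.X ^ 2 + 67 * Polynomial.X - 27 : Polynomial ℂ)
        = (Polynomial.X - Polynomial.C l₁) * (Polynomial.X - Polynomial.C l₂)
          * (Polynomial.X - Polynomial.C (l₃ : ℂ)) ∧
      l₂ = (starRingEnd ℂ) l₁ ∧
      (0.32925097 ≤ l₁.re ∧ l₁.re < 0.32925098) ∧
      (0.39751691 ≤ l₁.im ∧ l₁.im < 0.39751692) ∧
      (0.51616460 ≤ ‖l₁‖ ∧ ‖l₁‖ < 0.51616461) ∧
      (101.34149804 ≤ l₃ ∧ l₃ < 101.34149805) ∧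
      Filter.limsup (fun n : ℕ => ((|WellPoised.r n| ^ (1 / (n : ℝ)) : ℝ) : EReal)) Filter.atTop
        = ((‖l₁‖ : ℝ) : EReal) ∧
      Filter.limsup (fun n : ℕ => ((|WellPoised.rt n| ^ (1 / (n : ℝ)) : ℝ) : EReal)) Filter.atTop
        = ((‖l₁‖ : ℝ) : EReal) ∧
      Filter.Tendsto (fun n : ℕ => |(WellPoised.a n : ℝ)| ^ (1 / (n : ℝ))) Filter.atTop (nhds l₃) ∧
      Filter.Tendsto (fun n : ℕ => |(WellPoised.b n : ℝ)| ^ (1 / (n : ℝ))) Filter.atTop (nhds l₃) ∧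
      Filter.Tendsto (fun n : ℕ => |(WellPoised.bt n : ℝ)| ^ (1 / (n : ℝ))) Filter.atTop
        (nhds l₃)) := by
  obtain ⟨Z, hZ, hl⟩ := WellPoised.exists_zeta_three
  obtain ⟨l₁, l₃, h, hre, him, hn, h3⟩ := WellPoised.exists_isRoots
  obtain ⟨ha0, hb0, hbt0⟩ := WellPoised.initial_zero
  obtain ⟨ha1, hb1, hbt1⟩ := WellPoised.initial_one
  obtain ⟨ha2, hb2, hbt2⟩ := WellPoised.initial_two
  refine ⟨WellPoised.hasContinuedValue_R, WellPoised.hasContinuedValue_negDerivR, WellPoised.r_eq,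
    fun n => ?_,
    WellPoised.satisfiesRecurrence_of_rec (RingHom.id ℝ) WellPoised.rec_r,
    WellPoised.satisfiesRecurrence_of_rec (RingHom.id ℝ) WellPoised.rec_rt,
    WellPoised.satisfiesRecurrence_of_rec (algebraMap ℚ ℝ) WellPoised.rec_a,
    WellPoised.satisfiesRecurrence_of_rec (algebraMap ℚ ℝ) WellPoised.rec_b,
    WellPoised.satisfiesRecurrence_of_rec (algebraMap ℚ ℝ) WellPoised.rec_bt,
    ⟨ha0, ha1, ha2⟩, ⟨hb0, hb1, hb2⟩, ⟨hbt0, hbt1, hbt2⟩,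
    l₁, _, l₃, h.factor, rfl, hre, him, hn, h3,
    h.limsup WellPoised.rec_r WellPoised.r_zero_ne_zero WellPoised.abs_r_le,
    h.limsup WellPoised.rec_rt WellPoised.rt_zero_ne_zero WellPoised.abs_rt_le,
    h.tendsto WellPoised.rec_a ?_ ?_ ?_, h.tendsto WellPoised.rec_b ?_ ?_ ?_,
    h.tendsto WellPoised.rec_bt ?_ ?_ ?_⟩
  · rw [hZ, WellPoised.rt_eq n hl]
    push_cast
    ring
  all_goals simp only [ha0, ha1, ha2, hb0, hb1, hb2, hbt0, hbt1, hbt2]; norm_num
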